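/- **Theorem (Extension problem).** Let $0<s<1$, let $L$ be a (possibly unbounded) normal, nonnegative linear operator on the complex Hilbert space $L^2(\Omega)=L^2(\Omega,d\eta)$, where $d\eta$ is a positive measure (normal: densely defined, closed, $\mathrm{Dom}(L^*)=\mathrm{Dom}(L)$ and $\|L^*\varphi\|=\|L\varphi\|$ there; nonnegative: $\langle L\varphi,\varphi\rangle\in[0,\infty)$ for $\varphi\in \mathrm{Dom}(L)$), and let $H=\partial_t+L$ on $L^2(\mathbb R\times\Omega)=L^2(\mathbb R;L^2(\Omega))$. *Notation.* $E$ is the spectral resolution of $L$, $\widehat u(\rho)\in L^2(\Omega)$ is the unitary Fourier transform of $u$ in $t$, $\langle\cdot,\cdot\rangle$ is linear in the first entry. For $0\le\sigma\le 1$, $$\|u\|_{H^\sigma}^2=\int_{\mathbb R}\int_{[0,\infty)}|i\rho+\lambda|^\sigma\,d\langle E(\lambda)\widehat u(\rho),\widehat u(\rho)\rangle\,d\rho,\qquad \mathrm{Dom}(H^\sigma)=\{u\in L^2(\mathbb R\times\Omega):\|u\|_{H^\sigma}<\infty\},$$ and for $u,v\in\mathrm{Dom}(H^\sigma)$ $$\langle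 H^\sigma u,v\rangle=\int_{\mathbb R}\int_{[0,\infty)}(i\rho+\lambda)^\sigma\,d\langle E(\lambda)\widehat u(\rho),\widehat v(\rho)\rangle\,d\rho$$ with the principal branch of the power; so $H^\sigma u$ is an element of the dual of $\mathrm{Dom}(H^\sigma)$. Moreover $(e^{-\tau H}u)(t)=e^{-\tau L}\big(u(t-\tau)\big)$, with $e^{-\tau L}=\int e^{-\tau\lambda}\,dE(\lambda)$, and $\langle e^{-rH}(H^su),v\rangle:=\langle H^su,(e^{-rH})^*v\rangle$. Let $u\in\mathrm{Dom}(H^s)$. Put $U(0)=u$ and, for $y>0$, $$U(y)=\frac{y^{2s}}{4^s\Gamma(s)}\int_0^\infty e^{-y^2/(4\tau)}e^{-\tau H}u\,\frac{d\tau}{\tau^{1+s}} .$$ Then the following hold. 1. For every $y>0$ the integral above converges absolutely in $L^2(\mathbb R\times\Omega)$, and so does the integral in $$U(y)=\frac1{\Gamma(s)}\int_0^\infty e^{-r}e^{-\frac{y^2}{4r}H}u\,\frac{dr}{r^{1-s}} .$$ Also $U(y)=\frac1{\Gamma(s)}\int_0^\infty e^{-y^2/(4r)}e^{-rH}(H^su)\frac{dr}{r^{1-s}}$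 in the weak sense: for every $v\in\mathrm{Dom}(H^s)$ and $R>0$ the function $r\mapsto e^{-y^2/(4r)}r^{s-1}\langle e^{-rH}(H^su),v\rangle$ is integrable on $(0,R]$ and $$\langle U(y),v\rangle=\lim_{R\to\infty}\frac1{\Gamma(s)}\int_0^R e^{-y^2/(4r)}\langle e^{-rH}(H^su),v\rangle\,\frac{dr}{r^{1-s}};$$ if, for some $c>0$, $E([0,c))\widehat u(\rho)=0$ for a.e. $\rho$, this function is integrable on $(0,\infty)$. 2. $U(y)\in\mathrm{Dom}(H)$ for each $y>0$, $U\in C^\infty((0,\infty);L^2(\mathbb R\times\Omega))\cap C([0,\infty);L^2(\mathbb R\times\Omega))$ and $U\in L^2((0,\infty);\mathrm{Dom}(H),y^{1-2s}dy)$, in particular $\int_0^\infty y^{1-2s}\|U(y)\|_{H^1}^2\,dy<\infty$. 3. For each $v\in\mathrm{Dom}(H)$ and $y>0$, $\langle HU(y),v\rangle=\big\langle\frac{1-2s}{y}\partial_yU(y)+\partial_{yy}U(y),v\big\rangle_{L^2(\mathbb R\times\Omega)}$, and $\lim_{y\to0^+}U(y)=u$ in $L^2(\mathbb R\times\Omega)$.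 4. $\lim_{y\to\infty}\langle U(y),v\rangle=0$ for every $v\in L^2(\mathbb R\times\Omega)$. 5. $\sup_{y>0}|\langle y^{1-2s}\partial_yU(y),v\rangle|\le C_s\|u\|_{H^s}\|v\|_{H^s}$ for every $v\in\mathrm{Dom}(H^s)$, where the constant $C_s$ depends only on $s$. 6. For every $v\in\mathrm{Dom}(H^s)$, $$-\frac1{2s}\lim_{y\to0^+}\langle y^{1-2s}\partial_yU(y),v\rangle=\frac{|\Gamma(-s)|}{4^s\Gamma(s)}\langle H^su,v\rangle=-\lim_{y\to0^+}\Big\langle\frac{U(y)-U(0)}{y^{2s}},v\Big\rangle .$$ -/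

import Mathlib

universe u

open MeasureTheory Set Filter Topology
open scoped ENNReal ContDiff FourierTransform

noncomputable section

namespace ParabolicExtension

/-! ### Normal nonnegative operators and their spectral resolution -/

section Operators

variable {X : Type*} [NormedAddCommGroup X] [InnerProductSpace ℂ X] [CompleteSpace X]

/-- A (possibly unbounded) linear operator is normal if it is densely defined, closed, and
satisfies `Dom L† = Dom L` together with `‖L† φ‖ = ‖L φ‖` there. -/
structure IsNormalOp (L : X →ₗ.[ℂ] X) : Prop where
  dense : Dense (L.domain : Set X)
  closed : L.IsClosed
  domain_eq : L.adjoint.domain = L.domain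
  norm_eq : ∀ (φ : L.domain) (φ' : L.adjoint.domain), (φ : X) = (φ' : X) → ‖L.adjoint φ'‖ = ‖L φ‖

/-- Nonnegativity: `⟨L φ, φ⟩` is a nonnegative real number for every `φ ∈ Dom L`. -/
def IsNonneg (L : X →ₗ.[ℂ] X) : Prop :=
  ∀ φ : L.domain, (inner ℂ (φ : X) (L φ)).im = 0 ∧ 0 ≤ (inner ℂ (φ : X) (L φ)).re

variable (X) in
/-- A resolution of the identity (projection-valued measure) on the Borel sets of `ℝ`. Only the
values on Borel sets matter. -/
structure ResolutionOfIdentity where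
  proj : Set ℝ → X →L[ℂ] X
  isProj : ∀ B, MeasurableSet B → IsStarProjection (proj B)
  proj_univ : proj univ = 1
  proj_inter : ∀ B C, MeasurableSet B → MeasurableSet C → proj (B ∩ C) = proj B * proj C
  hasSum_proj : ∀ B : ℕ → Set ℝ, (∀ n, MeasurableSet (B n)) → Pairwise (Function.onFun Disjoint B) →
    ∀ φ : X, HasSum (fun n => proj (B n) φ) (proj (⋃ n, B n) φ)

namespace ResolutionOfIdentity

variable (E : ResolutionOfIdentity X)

theorem inner_proj_eq {B : Set ℝ} (hB : MeasurableSet B) (φ : X) :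
    (inner ℂ φ (E.proj B φ)).re = ‖E.proj B φ‖ ^ 2 := by
  have h := E.isProj B hB
  have h1 : E.proj B (E.proj B φ) = E.proj B φ := by
    have := h.isIdempotentElem
    exact congrArg (fun T : X →L[ℂ] X => T φ) this
  have h2 : inner ℂ φ (E.proj B (E.proj B φ)) = inner ℂ (E.proj B φ) (E.proj B φ) := by
    have h3 : ContinuousLinearMap.adjoint (E.proj B) = E.proj B := h.isSelfAdjoint
    rw [← ContinuousLinearMap.adjoint_inner_left, h3]
  rw [← h1, h2, h1, inner_self_eq_norm_sq_to_K]
  norm_cast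

theorem proj_empty : E.proj ∅ = 0 := by
  ext φ
  have h := (E.hasSum_proj (fun _ => ∅) (fun _ => MeasurableSet.empty)
    (fun _ _ _ => by simp [Function.onFun]) φ).summable
  simpa using tendsto_nhds_unique tendsto_const_nhds h.tendsto_atTop_zero

/-- The scalar spectral measure `μ_φ(B) = ⟨E(B) φ, φ⟩`. -/
def measure (φ : X) : Measure ℝ :=
  Measure.ofMeasurable (fun B _ => ENNReal.ofReal (inner ℂ φ (E.proj B φ)).re)
    (by simp [E.proj_empty])
    (by
      intro B hB hd
      have h := (E.hasSum_proj B hB hd φ).mapL (Complex.reCLM ∘L (innerSL ℂ φ).restrictScalars ℝ)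
      have h' : HasSum (fun n => (inner ℂ φ (E.proj (B n) φ)).re)
          (inner ℂ φ (E.proj (⋃ n, B n) φ)).re := h
      rw [← h'.tsum_eq, ENNReal.ofReal_tsum_of_nonneg _ h'.summable]
      intro n
      rw [E.inner_proj_eq (hB n)]
      positivity)

/-- `∫ f d⟨E φ, ψ⟩` for `f : ℝ → ℂ`, the complex measure `B ↦ ⟨E(B) φ, ψ⟩` (linear in `φ`,
antilinear in `ψ`) being expressed through the positive measures `μ_φ` by polarization. -/
def pairing (f : ℝ → ℂ) (φ ψ : X) : ℂ :=
  (1 / 4) * ((∫ l, f l ∂E.measure (φ + ψ)) - (∫ l, f l ∂E.measure (φ - ψ))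
    + Complex.I * (∫ l, f l ∂E.measure (φ + Complex.I • ψ))
    - Complex.I * (∫ l, f l ∂E.measure (φ - Complex.I • ψ)))

open Classical in
/-- The bounded operator `∫ f dE`, characterized weakly by `⟨(∫ f dE) φ, ψ⟩ = ∫ f d⟨E φ, ψ⟩`.
It exists, and is unique, for every `E`-essentially bounded Borel function `f`. -/
def integral (f : ℝ → ℂ) : X →L[ℂ] X :=
  if h : ∃ T : X →L[ℂ] X, ∀ φ ψ, inner ℂ ψ (T φ) = E.pairing f φ ψ then h.choose else 0

/-- `E` is the spectral resolution of `L`: `L = ∫ l dE(l)`, that is,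
`Dom L = {φ : ∫ l² dμ_φ(l) < ∞}` and `⟨L φ, φ⟩ = ∫ l dμ_φ(l)` on this domain. -/
structure Resolves (L : X →ₗ.[ℂ] X) : Prop where
  mem_domain_iff : ∀ φ : X, φ ∈ L.domain ↔ ∫⁻ l, ENNReal.ofReal (l ^ 2) ∂E.measure φ < ⊤
  inner_eq : ∀ φ : L.domain, inner ℂ (φ : X) (L φ) = ((∫ l, l ∂E.measure (φ : X) : ℝ) : ℂ)

variable (X) in
open Classical in
/-- The resolution of the identity with all its mass at `0` (the one of the zero operator). -/
def atZero : ResolutionOfIdentity X where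
  proj B := if (0 : ℝ) ∈ B then 1 else 0
  isProj B _ := by split_ifs <;> constructor <;> simp [IsIdempotentElem]
  proj_univ := by simp
  proj_inter B C _ _ := by by_cases h : (0 : ℝ) ∈ B <;> by_cases h' : (0 : ℝ) ∈ C <;> simp [h, h']
  hasSum_proj B _ hd φ := by
    by_cases h : ∃ n, (0 : ℝ) ∈ B n
    · obtain ⟨n, hn⟩ := h
      have h1 : (0 : ℝ) ∈ ⋃ n, B n := mem_iUnion.2 ⟨n, hn⟩
      have h2 : ∀ m, m ≠ n → (0 : ℝ) ∉ B m := fun m hm h0 =>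
        (Set.disjoint_left.1 (hd hm) h0 hn)
      convert hasSum_single n (f := fun m => (if (0 : ℝ) ∈ B m then (1 : X →L[ℂ] X) else 0) φ) ?_
        using 1
      · simp [hn, h1]
      · intro m hm
        simp [h2 m hm]
    · have h1 : (0 : ℝ) ∉ ⋃ n, B n := by simpa using h
      have h2 : ∀ m, (0 : ℝ) ∉ B m := fun m h0 => h ⟨m, h0⟩
      simp [h1, h2]

end ResolutionOfIdentity

open Classical in
/-- The spectral resolution of `L` (it exists, and is unique on Borel sets, when `L` is normal and
nonnegative; the value in the `else` branch is never used for such `L`). -/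
def spectralResolution (L : X →ₗ.[ℂ] X) : ResolutionOfIdentity X :=
  if h : ∃ E : ResolutionOfIdentity X, E.Resolves L then h.choose
  else ResolutionOfIdentity.atZero X

/-- The operator `e^{-τ L}` of the semigroup generated by `-L`. -/
def semigroup (L : X →ₗ.[ℂ] X) (τ : ℝ) : X →L[ℂ] X :=
  (spectralResolution L).integral (fun l => Complex.exp (-(τ * l)))

end Operators

/-! ### The parabolic operator `H = ∂ₜ + L` and its fractional powers -/

section Parabolic

variable {X : Type*} [NormedAddCommGroup X] [InnerProductSpace ℂ X] [CompleteSpace X]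

variable (X) in
/-- `L²(ℝ; X)`. For `X = L²(Ω, η)` this is `L²(ℝ × Ω)`, a function `u(t, x)` being regarded as the
function `t ↦ u(t, ·)`. -/
abbrev TimeL2 : Type _ := Lp X 2 (volume : Measure ℝ)

/-- The spectral symbol `iρ + l` of `∂ₜ + L`, as a function of `ξ = ρ / 2π`: Mathlib's Fourier
transform `𝓕` uses the kernel `e^{-2π i t ξ}`, and the unitary transform with kernel
`(2π)^{-1/2} e^{-i t ρ}` is `ρ ↦ (2π)^{-1/2} (𝓕 u) (ρ / 2π)`. -/
def symbol (ξ l : ℝ) : ℂ := Complex.I * ((2 * Real.pi * ξ : ℝ) : ℂ) + (l : ℂ)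

/-- `‖u‖²_{H^s} = ∫_ℝ ∫ |iρ + l|^s d⟨E(l) û(ρ), û(ρ)⟩ dρ`, with values in `[0, ∞]`. -/
def hsEnergy (L : X →ₗ.[ℂ] X) (s : ℝ) (u : TimeL2 X) : ℝ≥0∞ :=
  ∫⁻ ξ : ℝ, ∫⁻ l, ENNReal.ofReal (‖symbol ξ l‖ ^ s)
    ∂(spectralResolution L).measure ((𝓕 u : TimeL2 X) ξ)

/-- `Dom(H^s)`. -/
def domHs (L : X →ₗ.[ℂ] X) (s : ℝ) : Set (TimeL2 X) := {u | hsEnergy L s u < ⊤}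

/-- The norm `‖u‖_{H^s}` of `u ∈ Dom(H^s)`. -/
def hsNorm (L : X →ₗ.[ℂ] X) (s : ℝ) (u : TimeL2 X) : ℝ := Real.sqrt (hsEnergy L s u).toReal

/-- `⟨H^s u, v⟩ = ∫_ℝ ∫ (iρ + l)^s d⟨E(l) û(ρ), v̂(ρ)⟩ dρ` for `u, v ∈ Dom(H^s)`, with the principal
branch of the power. For fixed `u` this is `H^s u` as an element of the dual of `Dom(H^s)`. -/
def hsForm (L : X →ₗ.[ℂ] X) (s : ℝ) (u v : TimeL2 X) : ℂ :=
  ∫ ξ : ℝ, (spectralResolution L).pairing (fun l => symbol ξ l ^ (s : ℂ))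
    ((𝓕 u : TimeL2 X) ξ) ((𝓕 v : TimeL2 X) ξ)

variable (X) in
/-- The translation `e^{-τ ∂ₜ}`, that is, `u(t) ↦ u(t - τ)`. -/
def translate (τ : ℝ) : TimeL2 X →L[ℂ] TimeL2 X :=
  (Lp.compMeasurePreservingₗᵢ ℂ (fun t : ℝ => t - τ)
    (measurePreserving_sub_right volume τ)).toContinuousLinearMap

/-- `e^{-τ H} u (t) = e^{-τ L} (u(t - τ))`. -/
def parabolicSemigroup (L : X →ₗ.[ℂ] X) (τ : ℝ) : TimeL2 X →L[ℂ] TimeL2 X :=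
  (semigroup L τ).compLpL 2 volume ∘L translate X τ

/-- `⟨e^{-r H} (H^s u), v⟩`: the operator `e^{-r H}` is extended to the dual of `Dom(H^s)` by
duality, `⟨e^{-r H} F, v⟩ = ⟨F, (e^{-r H})^* v⟩`. -/
def semigroupHsForm (L : X →ₗ.[ℂ] X) (s r : ℝ) (u v : TimeL2 X) : ℂ :=
  hsForm L s u (ContinuousLinearMap.adjoint (parabolicSemigroup L r) v)

/-- The extension
`U(y) = y^{2s} / (4^s Γ(s)) ∫₀^∞ e^{-y²/(4τ)} e^{-τ H} u τ^{-1-s} dτ` for `y > 0`, and `U(0) = u`. -/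
def extension (L : X →ₗ.[ℂ] X) (s : ℝ) (u : TimeL2 X) (y : ℝ) : TimeL2 X :=
  if y = 0 then u else
    (y ^ (2 * s) / (4 ^ s * Real.Gamma s)) •
      ∫ τ in Ioi (0 : ℝ), (Real.exp (-y ^ 2 / (4 * τ)) / τ ^ (1 + s)) • parabolicSemigroup L τ u

/-- `U ∈ L²((0,∞); Dom(H^s), y^a dy)`: `U` is almost everywhere a limit of `Dom(H^s)`-valued simple
functions (in `L²(ℝ; X)` and in the norm of `H^s`), and `∫₀^∞ y^a ‖U(y)‖²_{H^s} dy < ∞`. -/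
def MemWeightedL2DomHs (L : X →ₗ.[ℂ] X) (s a : ℝ) (U : ℝ → TimeL2 X) : Prop :=
  (∃ f : ℕ → SimpleFunc ℝ (TimeL2 X), (∀ n y, f n y ∈ domHs L s) ∧
    ∀ᵐ y ∂(volume.restrict (Ioi (0 : ℝ))),
      Tendsto (fun n => f n y) atTop (𝓝 (U y)) ∧
      Tendsto (fun n => hsEnergy L s (f n y - U y)) atTop (𝓝 0)) ∧
  ∫⁻ y in Ioi (0 : ℝ), ENNReal.ofReal (y ^ a) * hsEnergy L s (U y) < ⊤

end Parabolic

end ParabolicExtension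

end

/-! After a Fourier transform in `t` and the spectral resolution of `L`, the operator `H` becomes
multiplication by `z = iρ + λ`, where `Re z ≥ 0`. The spectral projections act fibrewise over the
frequency and form one projection-valued measure, `timeProj`, on `ℝ × ℝ`. Everything in the theorem
is then a function of `z`: with `B_a(w) = ∫₀^∞ e^{-r} r^{a-1} e^{-w/r} dr` (`besselInt`), the
extension `U(y)` has multiplier `B_s(y²z/4) / Γ(s)`. Since `‖f(H)u‖² = ∫ |f|² dμ_u` (`norm_op_sq`),
each claim reduces to a scalar estimate, uniform on the closed right half-plane, followed by
dominated convergence or Fubini.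

The scalar facts are as follows. `|B_a| ≤ Γ(a)`. Integration by parts gives `w B_a = B_{a+2} - (a+1)
B_{a+1}` (`mul_besselInt`), so `w B_a` is bounded; hence `U(y) ∈ Dom(H)`, and the multiplier decays
as `y → ∞` wherever `z ≠ 0`. Differentiation in `y` turns `B_a(y²z/4)` into `(2/y)(a B_a -
B_{a+1})`; the family is closed under it, whence smoothness, and the extension equation is the same
recurrence again. Near zero, `|B_s(w) - Γ(s)| ≤ C|w|^s` and `t^{-s}(B_s(tz) - Γ(s)) → Γ(-s) z^s`;
with `|z|^s` as dominating function this yields the bound on the weighted derivative and both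
boundary limits. Scaling gives `∫ y^{1-2s} |z| |B_s(y²z/4)|² dy ≤ C|z|^s`, which is the weighted
energy estimate.

The formula with `H^s u` is delicate because `z^s ∫₀^∞ e^{-b/r} r^{s-1} e^{-rz} dr` need not
converge absolutely on the imaginary axis. Its truncations at `R` are bounded uniformly in `R`, `b`
and `z` (direct bound up to `1/|z|`, integration by parts beyond) and tend to `B_s(bz)` for `z ≠ 0`.
The point `z = 0` forces `ρ = 0`, so it is spectrally null.

The spectral theorem for `L` is derived as well. A nonnegative normal `L` is self-adjoint and `1 +
L` is bijective; the continuous functional calculus of the bounded resolvent becomes, by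
Riesz-Markov, a projection-valued measure, and `t ↦ 1/t - 1` carries it to that of `L`. -/

noncomputable section

namespace ParabolicExtension

/-! ### Polarized integrals -/

section Pairing

variable {S X : Type*} [MeasurableSpace S] [NormedAddCommGroup X] [InnerProductSpace ℂ X]

/-- The sesquilinear integral obtained by polarization from a family of measures `ν φ`. -/
def pairing (ν : X → Measure S) (f : S → ℂ) (φ ψ : X) : ℂ :=
  (1 / 4) * ((∫ l, f l ∂ν (φ + ψ)) - (∫ l, f l ∂ν (φ - ψ))
    + Complex.I * (∫ l, f l ∂ν (φ + Complex.I • ψ))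
    - Complex.I * (∫ l, f l ∂ν (φ - Complex.I • ψ)))

/-- The four vectors that occur in the polarization identity. -/
def polSet (φ ψ : X) : Set X :=
  {φ + ψ, φ - ψ, φ + Complex.I • ψ, φ - Complex.I • ψ}

theorem add_mem_polSet (φ ψ : X) : φ + ψ ∈ polSet φ ψ := by simp [polSet]
theorem sub_mem_polSet (φ ψ : X) : φ - ψ ∈ polSet φ ψ := by simp [polSet]
theorem add_I_mem_polSet (φ ψ : X) : φ + Complex.I • ψ ∈ polSet φ ψ := by simp [polSet]
theorem sub_I_mem_polSet (φ ψ : X) : φ - Complex.I • ψ ∈ polSet φ ψ := by simp [polSet]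

/-- The coefficients of `ψ` are the fourth roots of unity, and the estimates on the four vectors use
nothing about them except modulus one. -/
theorem forall_polSet {φ ψ : X} {p : X → Prop} (h : ∀ c : ℂ, ‖c‖ = 1 → p (φ + c • ψ)) :
    ∀ w ∈ polSet φ ψ, p w := by
  rintro w (rfl | rfl | rfl | rfl)
  · simpa using h 1 (by simp)
  · simpa [sub_eq_add_neg] using h (-1) (by simp)
  · exact h _ (by simp)
  · simpa [sub_eq_add_neg] using h (-Complex.I) (by simp)

variable {ν : X → Measure S} {f g : S → ℂ} {φ ψ : X}

theorem pairing_add (hf : ∀ w ∈ polSet φ ψ, Integrable f (ν w))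
    (hg : ∀ w ∈ polSet φ ψ, Integrable g (ν w)) :
    pairing ν (fun x => f x + g x) φ ψ = pairing ν f φ ψ + pairing ν g φ ψ := by
  simp only [pairing]
  rw [integral_add (hf _ (add_mem_polSet φ ψ)) (hg _ (add_mem_polSet φ ψ)),
    integral_add (hf _ (sub_mem_polSet φ ψ)) (hg _ (sub_mem_polSet φ ψ)),
    integral_add (hf _ (add_I_mem_polSet φ ψ)) (hg _ (add_I_mem_polSet φ ψ)),
    integral_add (hf _ (sub_I_mem_polSet φ ψ)) (hg _ (sub_I_mem_polSet φ ψ))]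
  ring

theorem pairing_const_mul (ν : X → Measure S) (c : ℂ) (f : S → ℂ) (φ ψ : X) :
    pairing ν (fun x => c * f x) φ ψ = c * pairing ν f φ ψ := by
  simp only [pairing, integral_const_mul]
  ring

theorem pairing_congr_ae (h : ∀ w ∈ polSet φ ψ, f =ᵐ[ν w] g) :
    pairing ν f φ ψ = pairing ν g φ ψ := by
  simp only [pairing]
  rw [integral_congr_ae (h _ (add_mem_polSet φ ψ)), integral_congr_ae (h _ (sub_mem_polSet φ ψ)),
    integral_congr_ae (h _ (add_I_mem_polSet φ ψ)), integral_congr_ae (h _ (sub_I_mem_polSet φ ψ))]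

theorem tendsto_pairing {ι : Type*} {l : Filter ι} [l.IsCountablyGenerated] {F : ι → S → ℂ}
    (bound : S → ℝ)
    (hm : ∀ᶠ n in l, Measurable (F n))
    (hb : ∀ᶠ n in l, ∀ x, ‖F n x‖ ≤ bound x)
    (hi : ∀ w ∈ polSet φ ψ, Integrable bound (ν w))
    (hl : ∀ w ∈ polSet φ ψ, ∀ᵐ x ∂ν w, Tendsto (fun n => F n x) l (𝓝 (f x))) :
    Tendsto (fun n => pairing ν (F n) φ ψ) l (𝓝 (pairing ν f φ ψ)) := by
  have key : ∀ w ∈ polSet φ ψ,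
      Tendsto (fun n => ∫ x, F n x ∂ν w) l (𝓝 (∫ x, f x ∂ν w)) := fun w hw =>
    tendsto_integral_filter_of_dominated_convergence bound
      (hm.mono fun n hn => hn.aestronglyMeasurable)
      (hb.mono fun n hn => Eventually.of_forall hn) (hi w hw) (hl w hw)
  simp only [pairing]
  exact ((((key _ (add_mem_polSet φ ψ)).sub (key _ (sub_mem_polSet φ ψ))).add
    ((key _ (add_I_mem_polSet φ ψ)).const_mul _)).sub
    ((key _ (sub_I_mem_polSet φ ψ)).const_mul _)).const_mul _

theorem integrable_pairing {A : Type*} [MeasurableSpace A] {μ : Measure A}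
    [∀ w, SFinite (ν w)] [SFinite μ] {F : A → S → ℂ}
    (hF : ∀ w ∈ polSet φ ψ, Integrable (Function.uncurry F) (μ.prod (ν w))) :
    Integrable (fun a => pairing ν (F a) φ ψ) μ := by
  have key : ∀ w ∈ polSet φ ψ, Integrable (fun a => ∫ x, F a x ∂ν w) μ :=
    fun w hw => (hF w hw).integral_prod_left
  simp only [pairing]
  exact ((((key _ (add_mem_polSet φ ψ)).sub (key _ (sub_mem_polSet φ ψ))).add
    ((key _ (add_I_mem_polSet φ ψ)).const_mul _)).sub
    ((key _ (sub_I_mem_polSet φ ψ)).const_mul _)).const_mul _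

theorem integral_pairing {A : Type*} [MeasurableSpace A] {μ : Measure A}
    [∀ w, SFinite (ν w)] [SFinite μ] {F : A → S → ℂ}
    (hF : ∀ w ∈ polSet φ ψ, Integrable (Function.uncurry F) (μ.prod (ν w))) :
    ∫ a, pairing ν (F a) φ ψ ∂μ = pairing ν (fun x => ∫ a, F a x ∂μ) φ ψ := by
  have key : ∀ w ∈ polSet φ ψ, Integrable (fun a => ∫ x, F a x ∂ν w) μ :=
    fun w hw => (hF w hw).integral_prod_left
  have e : ∀ w ∈ polSet φ ψ, ∫ x, ∫ a, F a x ∂μ ∂ν w = ∫ a, ∫ x, F a x ∂ν w ∂μ :=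
    fun w hw => (integral_integral_swap (hF w hw)).symm
  simp only [pairing]
  rw [e _ (add_mem_polSet φ ψ), e _ (sub_mem_polSet φ ψ), e _ (add_I_mem_polSet φ ψ),
    e _ (sub_I_mem_polSet φ ψ), integral_const_mul]
  have k1 := key _ (add_mem_polSet φ ψ)
  have k2 := key _ (sub_mem_polSet φ ψ)
  have k3 := (key _ (add_I_mem_polSet φ ψ)).const_mul Complex.I
  have k4 := (key _ (sub_I_mem_polSet φ ψ)).const_mul Complex.I
  have k12 : Integrable (fun a => ∫ x, F a x ∂ν (φ + ψ) - ∫ x, F a x ∂ν (φ - ψ)) μ := k1.sub k2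
  have k123 : Integrable (fun a => ∫ x, F a x ∂ν (φ + ψ) - ∫ x, F a x ∂ν (φ - ψ)
    + Complex.I * ∫ x, F a x ∂ν (φ + Complex.I • ψ)) μ := k12.add k3
  rw [integral_sub k123 k4, integral_add k12 k3, integral_sub k1 k2,
    integral_const_mul, integral_const_mul]

theorem norm_pairing_le_of_bounded {C : ℝ} (hν : ∀ w, ν w univ = ENNReal.ofReal (‖w‖ ^ 2))
    (hf : ∀ x, ‖f x‖ ≤ C) (φ ψ : X) : ‖pairing ν f φ ψ‖ ≤ C * (‖φ‖ + ‖ψ‖) ^ 2 := by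
  have hS : ∀ w, ‖∫ x, f x ∂ν w‖ ≤ C * ‖w‖ ^ 2 := by
    intro w
    have : IsFiniteMeasure (ν w) := ⟨by rw [hν]; exact ENNReal.ofReal_lt_top⟩
    have := norm_integral_le_of_norm_le_const (μ := ν w) (f := f) (Eventually.of_forall hf)
    rwa [Measure.real, hν, ENNReal.toReal_ofReal (by positivity)] at this
  by_cases hφ : Nonempty S
  · have hC : 0 ≤ C := (norm_nonneg _).trans (hf hφ.some)
    have hS' : ∀ w ∈ polSet φ ψ, ‖∫ x, f x ∂ν w‖ ≤ C * (‖φ‖ + ‖ψ‖) ^ 2 := by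
      refine forall_polSet fun c hc => (hS _).trans ?_
      gcongr
      exact (norm_add_le _ _).trans (by rw [norm_smul, hc, one_mul])
    have h1 := hS' _ (add_mem_polSet φ ψ)
    have h2 := hS' _ (sub_mem_polSet φ ψ)
    have h3 := hS' _ (add_I_mem_polSet φ ψ)
    have h4 := hS' _ (sub_I_mem_polSet φ ψ)
    simp only [pairing]
    rw [norm_mul]
    refine (mul_le_mul_of_nonneg_left ((norm_sub_le _ _).trans (add_le_add
      ((norm_add_le _ _).trans (add_le_add (norm_sub_le _ _) le_rfl)) le_rfl))
      (norm_nonneg _)).trans ?_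
    rw [norm_mul, norm_mul, Complex.norm_I]
    norm_num
    linarith
  -- On an empty `S` the constant `C` may be negative. There the mass formula forces every vector to
  -- vanish, so the bound still holds.
  · have : IsEmpty S := not_nonempty_iff.1 hφ
    have h0 : ∀ w : X, w = 0 := by
      intro w
      have := hν w
      rw [univ_eq_empty_iff.2 ‹_›, measure_empty] at this
      have := ENNReal.ofReal_eq_zero.1 this.symm
      have h2 : ‖w‖ ^ 2 = 0 := le_antisymm this (by positivity)
      simpa using h2
    have e : ∀ w : X, ν w = 0 := fun w => Measure.eq_zero_of_isEmpty _
    simp [pairing, e, h0 φ, h0 ψ]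

/-- `T = ∫ f dE` weakly, `E` being given by its scalar measures `ν φ`. -/
def IsOp (ν : X → Measure S) (f : S → ℂ) (T : X →L[ℂ] X) : Prop :=
  ∀ φ ψ, inner ℂ ψ (T φ) = pairing ν f φ ψ

theorem IsOp.unique {T T' : X →L[ℂ] X} (h : IsOp ν f T) (h' : IsOp ν f T') : T = T' := by
  ext φ
  exact ext_inner_left ℂ fun ψ => by rw [h, h']

theorem IsOp.const_mul {T : X →L[ℂ] X} (h : IsOp ν f T) (c : ℂ) :
    IsOp ν (fun x => c * f x) (c • T) := fun φ ψ => by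
  rw [pairing_const_mul, ← h φ ψ, smul_apply, inner_smul_right]

theorem IsOp.add {T T' : X →L[ℂ] X} (h : IsOp ν f T) (h' : IsOp ν g T')
    (hf : ∀ w, Integrable f (ν w)) (hg : ∀ w, Integrable g (ν w)) :
    IsOp ν (fun x => f x + g x) (T + T') := fun φ ψ => by
  rw [pairing_add (fun w _ => hf w) (fun w _ => hg w), ← h φ ψ, ← h' φ ψ,
    add_apply, inner_add_right]

/-- A bounded pointwise limit of matrix coefficients is the matrix coefficient of an operator. -/
theorem exists_clm_of_tendsto_inner [CompleteSpace X] {T : ℕ → X →L[ℂ] X} {B : X → X → ℂ} {C : ℝ}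
    (h : ∀ φ ψ, Tendsto (fun n => inner ℂ ψ (T n φ)) atTop (𝓝 (B φ ψ)))
    (hC : ∀ φ ψ, ‖B φ ψ‖ ≤ C * (‖φ‖ + ‖ψ‖) ^ 2) :
    ∃ T' : X →L[ℂ] X, ∀ φ ψ, inner ℂ ψ (T' φ) = B φ ψ := by
  have add_l : ∀ φ φ' ψ, B (φ + φ') ψ = B φ ψ + B φ' ψ := fun φ φ' ψ =>
    tendsto_nhds_unique (h _ _) (by simpa [inner_add_right] using (h φ ψ).add (h φ' ψ))
  have smul_l : ∀ (c : ℂ) φ ψ, B (c • φ) ψ = c * B φ ψ := fun c φ ψ =>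
    tendsto_nhds_unique (h _ _) (by simpa [inner_smul_right] using (h φ ψ).const_mul c)
  have add_r : ∀ φ ψ ψ', B φ (ψ + ψ') = B φ ψ + B φ ψ' := fun φ ψ ψ' =>
    tendsto_nhds_unique (h _ _) (by simpa [inner_add_left] using (h φ ψ).add (h φ ψ'))
  have smul_r : ∀ (c : ℂ) φ ψ, B φ (c • ψ) = starRingEnd ℂ c * B φ ψ := fun c φ ψ =>
    tendsto_nhds_unique (h _ _) (by simpa [inner_smul_left, mul_comm] using (h φ ψ).const_mul (starRingEnd ℂ c))
  -- The hypothesis is not homogeneous in the two vectors; normalising both to length one turns `(1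
  -- + 1)^2` into the factor 4.
  have bound : ∀ φ ψ, ‖B φ ψ‖ ≤ (4 * C) * ‖φ‖ * ‖ψ‖ := by
    intro φ ψ
    rcases eq_or_ne φ 0 with rfl | hφ
    · simpa using (smul_l 0 0 ψ)
    rcases eq_or_ne ψ 0 with rfl | hψ
    · simpa using (smul_r 0 φ 0)
    have e : B φ ψ = (‖φ‖ : ℂ) * (‖ψ‖ * B ((‖φ‖⁻¹ : ℂ) • φ) ((‖ψ‖⁻¹ : ℂ) • ψ)) := by
      rw [smul_l, smul_r]
      have h1 : (‖φ‖ : ℂ) ≠ 0 := by simpa using hφ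
      have h2 : (‖ψ‖ : ℂ) ≠ 0 := by simpa using hψ
      simp only [map_inv₀, Complex.conj_ofReal]
      field_simp
    have h3 := hC ((‖φ‖⁻¹ : ℂ) • φ) ((‖ψ‖⁻¹ : ℂ) • ψ)
    have n1 : ‖(‖φ‖⁻¹ : ℂ) • φ‖ = 1 := by
      rw [norm_smul, norm_inv, Complex.norm_real, norm_norm, inv_mul_cancel₀ (by simpa using hφ)]
    have n2 : ‖(‖ψ‖⁻¹ : ℂ) • ψ‖ = 1 := by
      rw [norm_smul, norm_inv, Complex.norm_real, norm_norm, inv_mul_cancel₀ (by simpa using hψ)]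
    rw [n1, n2] at h3
    rw [e, norm_mul, norm_mul, Complex.norm_real, Complex.norm_real, norm_norm, norm_norm]
    calc ‖φ‖ * (‖ψ‖ * ‖B ((‖φ‖⁻¹ : ℂ) • φ) ((‖ψ‖⁻¹ : ℂ) • ψ)‖)
        ≤ ‖φ‖ * (‖ψ‖ * (C * (1 + 1) ^ 2)) := by gcongr
      _ = _ := by ring
  -- `B` is linear in its first argument and antilinear in the second. The Riesz representation used
  -- here needs the opposite, hence the conjugate.
  let B' : X →ₗ⋆[ℂ] X →ₗ[ℂ] ℂ := LinearMap.mk₂'ₛₗ _ _ (fun φ ψ => starRingEnd ℂ (B φ ψ))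
    (fun φ φ' ψ => by rw [add_l, map_add])
    (fun c φ ψ => by rw [smul_l, map_mul]; rfl)
    (fun φ ψ ψ' => by rw [add_r, map_add])
    (fun c φ ψ => by rw [smul_r, map_mul]; simp)
  have hB' : ∀ φ ψ, ‖B' φ ψ‖ ≤ (4 * C) * ‖φ‖ * ‖ψ‖ := fun φ ψ => by
    simpa [B', LinearMap.mk₂'ₛₗ_apply] using bound φ ψ
  refine ⟨InnerProductSpace.continuousLinearMapOfBilin (B'.mkContinuous₂ _ hB'), fun φ ψ => ?_⟩
  rw [← inner_conj_symm, InnerProductSpace.continuousLinearMapOfBilin_apply,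
    LinearMap.mkContinuous₂_apply]
  simp [B', LinearMap.mk₂'ₛₗ_apply]

/-- Dominated convergence against the finite measures `ν w` makes the matrix coefficients converge.
Thus the functions that possess an operator are stable under bounded pointwise limits, which is what
Borel induction needs. -/
theorem exists_isOp_of_tendsto [CompleteSpace X] {T : ℕ → X →L[ℂ] X} {F : ℕ → S → ℂ} {C : ℝ}
    (hν : ∀ w, ν w univ = ENNReal.ofReal (‖w‖ ^ 2))
    (hT : ∀ n, IsOp ν (F n) (T n)) (hm : ∀ n, Measurable (F n)) (hb : ∀ n x, ‖F n x‖ ≤ C)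
    (hl : ∀ x, Tendsto (fun n => F n x) atTop (𝓝 (f x))) :
    ∃ T', IsOp ν f T' ∧
      ∀ φ ψ, Tendsto (fun n => inner ℂ ψ (T n φ)) atTop (𝓝 (inner ℂ ψ (T' φ))) := by
  have : ∀ w, IsFiniteMeasure (ν w) := fun w => ⟨by rw [hν]; exact ENNReal.ofReal_lt_top⟩
  have key : ∀ φ ψ, Tendsto (fun n => inner ℂ ψ (T n φ)) atTop (𝓝 (pairing ν f φ ψ)) := by
    intro φ ψ
    simp only [hT _ φ ψ]
    exact tendsto_pairing (fun _ => C) (Eventually.of_forall hm) (Eventually.of_forall hb)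
      (fun w _ => integrable_const _) (fun w _ => Eventually.of_forall hl)
  obtain ⟨T', hT'⟩ := exists_clm_of_tendsto_inner key
    (norm_pairing_le_of_bounded hν fun x => le_of_tendsto (hl x).norm
      (Eventually.of_forall fun n => hb n x))
  exact ⟨T', hT', fun φ ψ => by rw [hT']; exact key φ ψ⟩

end Pairing

/-! ### Bounded Borel functional calculus of a projection-valued measure -/

/-- Bounded measurable complex functions. -/
structure BddMeas {S : Type*} [MeasurableSpace S] (f : S → ℂ) : Prop where
  measurable : Measurable f
  bdd : ∃ C, ∀ x, ‖f x‖ ≤ C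

namespace BddMeas

variable {S : Type*} [MeasurableSpace S] {f g : S → ℂ}

theorem mul (hf : BddMeas f) (hg : BddMeas g) : BddMeas fun x => f x * g x := by
  refine ⟨hf.measurable.mul hg.measurable, ?_⟩
  obtain ⟨C, hC⟩ := hf.bdd
  obtain ⟨D, hD⟩ := hg.bdd
  refine ⟨C * D, fun x => ?_⟩
  rw [norm_mul]
  exact mul_le_mul (hC x) (hD x) (norm_nonneg _) ((norm_nonneg _).trans (hC x))

theorem add (hf : BddMeas f) (hg : BddMeas g) : BddMeas fun x => f x + g x := by
  refine ⟨hf.measurable.add hg.measurable, ?_⟩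
  obtain ⟨C, hC⟩ := hf.bdd
  obtain ⟨D, hD⟩ := hg.bdd
  exact ⟨C + D, fun x => (norm_add_le _ _).trans (add_le_add (hC x) (hD x))⟩

theorem conj (hf : BddMeas f) : BddMeas fun x => starRingEnd ℂ (f x) := by
  obtain ⟨C, hC⟩ := hf.bdd
  exact ⟨Complex.continuous_conj.measurable.comp hf.measurable, C, fun x => by simpa using hC x⟩

theorem indicator {B : Set S} (hB : MeasurableSet B) (hf : BddMeas f) :
    BddMeas (B.indicator f) := by
  obtain ⟨C, hC⟩ := hf.bdd
  exact ⟨hf.measurable.indicator hB, C, fun x => (norm_indicator_le_norm_self _ _).trans (hC x)⟩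

theorem const (c : ℂ) : BddMeas fun _ : S => c := ⟨measurable_const, ‖c‖, fun _ => le_rfl⟩

theorem integrable (hf : BddMeas f) (μ : Measure S) [IsFiniteMeasure μ] : Integrable f μ := by
  obtain ⟨C, hC⟩ := hf.bdd
  exact .of_bound hf.measurable.aestronglyMeasurable C (Eventually.of_forall hC)

theorem integrable_norm_sq (hf : BddMeas f) (μ : Measure S) [IsFiniteMeasure μ] :
    Integrable (fun x => ‖f x‖ ^ 2) μ := by
  obtain ⟨C, hC⟩ := hf.bdd
  refine .of_bound (hf.measurable.norm.pow_const 2).aestronglyMeasurable (C ^ 2)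
    (Eventually.of_forall fun x => ?_)
  rw [norm_pow, norm_norm]
  exact pow_le_pow_left₀ (norm_nonneg _) (hC x) 2

/-- Simple functions are sums of constants on measurable sets, and a bounded measurable function is
a pointwise limit of simple functions with a common bound. The common bound is what dominated
convergence requires. -/
theorem induction {p : (S → ℂ) → Prop}
    (ind : ∀ (c : ℂ) (B : Set S), MeasurableSet B → p (B.indicator fun _ => c))
    (add : ∀ f g, BddMeas f → BddMeas g → p f → p g → p (fun x => f x + g x))
    (lim : ∀ (F : ℕ → S → ℂ) (f : S → ℂ) (C : ℝ), (∀ n, Measurable (F n)) →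
      (∀ n x, ‖F n x‖ ≤ C) → (∀ x, Tendsto (fun n => F n x) atTop (𝓝 (f x))) → (∀ n, p (F n)) →
      p f)
    (hf : BddMeas f) : p f := by
  obtain ⟨C, hC⟩ := hf.bdd
  have hC' : ∀ x, ‖f x‖ ≤ max C 0 := fun x => (hC x).trans (le_max_left _ _)
  have hs := hf.measurable.stronglyMeasurable
  have simple : ∀ F : SimpleFunc S ℂ, p F := by
    intro F
    induction F using SimpleFunc.induction with
    | @const c s hs =>
      have e : ⇑(SimpleFunc.piecewise s hs (SimpleFunc.const S c) (SimpleFunc.const S 0)) =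
          Set.indicator s (fun _ => c) := by
        ext x
        simp [Set.indicator, Set.piecewise]
      rw [e]
      exact ind c _ hs
    | add _ hF hG =>
      have hb : ∀ F : SimpleFunc S ℂ, BddMeas F := fun F =>
        ⟨F.measurable, F.exists_forall_norm_le⟩
      exact add _ _ (hb _) (hb _) hF hG
  exact lim (fun n => hs.approxBounded (max C 0) n) f (max C 0) (fun n => SimpleFunc.measurable _)
    (fun n x => hs.norm_approxBounded_le (le_max_right _ _) n x)
    (fun x => hs.tendsto_approxBounded_of_norm_le (hC' x)) fun n => simple _

end BddMeas

/-- A projection-valued measure on a measurable space `S`, together with its scalar measures. -/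
structure ProjMeasure (S X : Type*) [MeasurableSpace S] [NormedAddCommGroup X]
    [InnerProductSpace ℂ X] [CompleteSpace X] where
  proj : Set S → X →L[ℂ] X
  measure : X → Measure S
  isProj : ∀ B, MeasurableSet B → IsStarProjection (proj B)
  proj_univ : proj univ = 1
  proj_inter : ∀ B C, MeasurableSet B → MeasurableSet C → proj (B ∩ C) = proj B * proj C
  measure_apply : ∀ B, MeasurableSet B → ∀ φ, measure φ B = ENNReal.ofReal (‖proj B φ‖ ^ 2)

section Trunc

variable {S : Type*}

/-- Truncation of an unbounded symbol. -/
def trunc (m : S → ℂ) (n : ℕ) : S → ℂ := {x | ‖m x‖ ≤ n}.indicator m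

theorem norm_trunc_le (m : S → ℂ) (n : ℕ) (x : S) : ‖trunc m n x‖ ≤ ‖m x‖ :=
  norm_indicator_le_norm_self _ _

theorem tendsto_trunc (m : S → ℂ) (x : S) : Tendsto (fun n => trunc m n x) atTop (𝓝 (m x)) := by
  refine tendsto_const_nhds.congr' ?_
  filter_upwards [eventually_ge_atTop ⌈‖m x‖⌉₊] with n hn
  rw [trunc, indicator_of_mem]
  exact Nat.ceil_le.1 hn

end Trunc

namespace ProjMeasure

variable {S X : Type*} [MeasurableSpace S] [NormedAddCommGroup X] [InnerProductSpace ℂ X]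
  [CompleteSpace X] (P : ProjMeasure S X)

theorem measure_univ (φ : X) : P.measure φ univ = ENNReal.ofReal (‖φ‖ ^ 2) := by
  rw [P.measure_apply _ .univ, P.proj_univ]
  rfl

instance (φ : X) : IsFiniteMeasure (P.measure φ) :=
  ⟨by rw [P.measure_univ]; exact ENNReal.ofReal_lt_top⟩

theorem measure_smul (c : ℂ) (φ : X) :
    P.measure (c • φ) = ENNReal.ofReal (‖c‖ ^ 2) • P.measure φ := by
  ext B hB
  rw [Measure.smul_apply, P.measure_apply _ hB, P.measure_apply _ hB, map_smul, norm_smul, mul_pow,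
    ENNReal.ofReal_mul (by positivity), smul_eq_mul]

theorem measure_smul_of_norm_one {c : ℂ} (hc : ‖c‖ = 1) (φ : X) :
    P.measure (c • φ) = P.measure φ := by
  simp [measure_smul, hc]

/-- This is `(a + b)² ≤ 2(a² + b²)`. Through it, integrability at `φ` and `ψ` passes to the four
vectors of the polarization identity. -/
theorem measure_add_le (φ ψ : X) :
    P.measure (φ + ψ) ≤ (2 : ℝ≥0∞) • (P.measure φ + P.measure ψ) := by
  refine Measure.le_iff.2 fun B hB => ?_
  rw [Measure.smul_apply, Measure.add_apply, P.measure_apply _ hB, P.measure_apply _ hB,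
    P.measure_apply _ hB, ← ENNReal.ofReal_add (by positivity) (by positivity), smul_eq_mul,
    show (2 : ℝ≥0∞) = ENNReal.ofReal 2 by simp, ← ENNReal.ofReal_mul (by positivity)]
  refine ENNReal.ofReal_le_ofReal ?_
  rw [map_add]
  have h1 := norm_add_le (P.proj B φ) (P.proj B ψ)
  have h2 := norm_nonneg (P.proj B φ + P.proj B ψ)
  nlinarith [sq_nonneg (‖P.proj B φ‖ - ‖P.proj B ψ‖)]

theorem measure_le_of_mem_polSet (φ ψ : X) :
    ∀ w ∈ polSet φ ψ, P.measure w ≤ (2 : ℝ≥0∞) • (P.measure φ + P.measure ψ) :=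
  forall_polSet fun c hc => (P.measure_add_le _ _).trans (by rw [P.measure_smul_of_norm_one hc])

theorem integrable_of_mem_polSet {E : Type*} [NormedAddCommGroup E] {f : S → E} {φ ψ : X}
    (hφ : Integrable f (P.measure φ)) (hψ : Integrable f (P.measure ψ)) :
    ∀ w ∈ polSet φ ψ, Integrable f (P.measure w) := fun w hw =>
  ((hφ.add_measure hψ).smul_measure (by simp)).mono_measure (P.measure_le_of_mem_polSet φ ψ w hw)

theorem proj_proj {B : Set S} (hB : MeasurableSet B) (φ : X) :
    P.proj B (P.proj B φ) = P.proj B φ :=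
  congrArg (fun T : X →L[ℂ] X => T φ) (P.isProj B hB).isIdempotentElem

theorem adjoint_proj {B : Set S} (hB : MeasurableSet B) :
    ContinuousLinearMap.adjoint (P.proj B) = P.proj B := (P.isProj B hB).isSelfAdjoint

/-- For an orthogonal projection `⟨ψ, Eφ⟩ = ⟨Eψ, Eφ⟩`, and the inner product is polarized. The
library identity expands around `ψ`, so two of its vectors have to be multiplied by a unimodular
scalar, which leaves the norms unchanged. -/
theorem isOp_proj {B : Set S} (hB : MeasurableSet B) :
    IsOp P.measure (B.indicator fun _ => 1) (P.proj B) := by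
  intro φ ψ
  have h1 : inner ℂ ψ (P.proj B φ) = inner ℂ (P.proj B ψ) (P.proj B φ) := by
    conv_lhs => rw [← P.proj_proj hB, ← ContinuousLinearMap.adjoint_inner_left, P.adjoint_proj hB]
  have h2 : ∀ w, ∫ x, B.indicator (fun _ => (1 : ℂ)) x ∂P.measure w = (‖P.proj B w‖ : ℂ) ^ 2 := by
    intro w
    rw [integral_indicator_const _ hB, Measure.real, P.measure_apply _ hB,
      ENNReal.toReal_ofReal (by positivity)]
    simp
  rw [h1, inner_eq_sum_norm_sq_div_four, pairing, h2, h2, h2, h2]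
  have e1 : ‖P.proj B ψ + P.proj B φ‖ = ‖P.proj B (φ + ψ)‖ := by rw [map_add, add_comm]
  have e2 : ‖P.proj B ψ - P.proj B φ‖ = ‖P.proj B (φ - ψ)‖ := by rw [map_sub, norm_sub_rev]
  have e3 : ‖P.proj B ψ - Complex.I • P.proj B φ‖ = ‖P.proj B (φ + Complex.I • ψ)‖ := by
    have : P.proj B (φ + Complex.I • ψ) = Complex.I • (P.proj B ψ - Complex.I • P.proj B φ) := by
      rw [map_add, map_smul, smul_sub, smul_smul, Complex.I_mul_I]
      simp [add_comm]
    rw [this, norm_smul, Complex.norm_I, one_mul]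
  have e4 : ‖P.proj B ψ + Complex.I • P.proj B φ‖ = ‖P.proj B (φ - Complex.I • ψ)‖ := by
    have : P.proj B (φ - Complex.I • ψ) = -(Complex.I • (P.proj B ψ + Complex.I • P.proj B φ)) := by
      rw [map_sub, map_smul, smul_add, smul_smul, Complex.I_mul_I]
      simp [sub_eq_add_neg]
    rw [this, norm_neg, norm_smul, Complex.norm_I, one_mul]
  simp only [Complex.coe_algebraMap, RCLike.I_to_complex] at *
  rw [e1, e2, e3, e4]
  ring

theorem exists_isOp {f : S → ℂ} (hf : BddMeas f) : ∃ T, IsOp P.measure f T := by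
  refine BddMeas.induction (p := fun f => ∃ T, IsOp P.measure f T) ?_ ?_ ?_ hf
  · intro c B hB
    refine ⟨c • P.proj B, ?_⟩
    convert (P.isOp_proj hB).const_mul c using 1
    ext x
    simp [Set.indicator]
  · intro f g hf hg h1 h2
    obtain ⟨T, hT⟩ := h1
    obtain ⟨T', hT'⟩ := h2
    exact ⟨T + T', hT.add hT' (fun w => hf.integrable _) fun w => hg.integrable _⟩
  · intro F f C hm hb hl h
    choose T hT using h
    obtain ⟨T', hT', -⟩ := exists_isOp_of_tendsto P.measure_univ hT hm hb hl
    exact ⟨T', hT'⟩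

open Classical in
/-- The bounded operator `∫ f dP`. -/
def op (f : S → ℂ) : X →L[ℂ] X := if h : ∃ T, IsOp P.measure f T then h.choose else 0

theorem isOp_op {f : S → ℂ} (hf : BddMeas f) : IsOp P.measure f (P.op f) := by
  rw [op, dif_pos (P.exists_isOp hf)]
  exact (P.exists_isOp hf).choose_spec

theorem inner_op {f : S → ℂ} (hf : BddMeas f) (φ ψ : X) :
    inner ℂ ψ (P.op f φ) = pairing P.measure f φ ψ := P.isOp_op hf φ ψ

theorem op_eq_of_isOp {f : S → ℂ} {T : X →L[ℂ] X} (h : IsOp P.measure f T) : P.op f = T := by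
  have h' : ∃ T, IsOp P.measure f T := ⟨T, h⟩
  rw [op, dif_pos h']
  exact h'.choose_spec.unique h

theorem op_indicator_const (c : ℂ) {B : Set S} (hB : MeasurableSet B) :
    P.op (B.indicator fun _ => c) = c • P.proj B := by
  refine P.op_eq_of_isOp ?_
  convert (P.isOp_proj hB).const_mul c using 1
  ext x
  simp [Set.indicator]

theorem op_add {f g : S → ℂ} (hf : BddMeas f) (hg : BddMeas g) :
    P.op (fun x => f x + g x) = P.op f + P.op g :=
  P.op_eq_of_isOp ((P.isOp_op hf).add (P.isOp_op hg) (fun _ => hf.integrable _)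
    fun _ => hg.integrable _)

theorem op_const_mul {f : S → ℂ} (hf : BddMeas f) (c : ℂ) :
    P.op (fun x => c * f x) = c • P.op f :=
  P.op_eq_of_isOp ((P.isOp_op hf).const_mul c)

theorem op_const (c : ℂ) : P.op (fun _ => c) = c • 1 := by
  rw [← P.proj_univ, ← P.op_indicator_const c .univ, indicator_univ]

theorem tendsto_inner_op {F : ℕ → S → ℂ} {f : S → ℂ} {C : ℝ} (hm : ∀ n, Measurable (F n))
    (hb : ∀ n x, ‖F n x‖ ≤ C) (hl : ∀ x, Tendsto (fun n => F n x) atTop (𝓝 (f x))) (φ ψ : X) :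
    Tendsto (fun n => inner ℂ ψ (P.op (F n) φ)) atTop (𝓝 (inner ℂ ψ (P.op f φ))) := by
  have hf : BddMeas f := ⟨measurable_of_tendsto_metrizable hm (tendsto_pi_nhds.2 hl), C,
    fun x => le_of_tendsto (hl x).norm (Eventually.of_forall fun n => hb n x)⟩
  rw [P.inner_op hf]
  simp only [P.inner_op ⟨hm _, C, hb _⟩]
  exact tendsto_pairing (fun _ => C) (Eventually.of_forall hm) (Eventually.of_forall hb)
    (fun w _ => integrable_const _) fun w _ => Eventually.of_forall hl

/-- On indicators this is `proj (B ∩ C) = proj B * proj C`. It extends by sums and bounded limits in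
`g` with an indicator as first factor, and then in `f` with `g` arbitrary. -/
theorem op_mul {f g : S → ℂ} (hf : BddMeas f) (hg : BddMeas g) :
    P.op (fun x => f x * g x) = P.op f * P.op g := by
  have limit : ∀ (F : ℕ → S → ℂ) (f g : S → ℂ) (C : ℝ), BddMeas g →
      (∀ n, Measurable (F n)) → (∀ n x, ‖F n x‖ ≤ C) →
      (∀ x, Tendsto (fun n => F n x) atTop (𝓝 (f x))) → ∀ φ ψ,
      Tendsto (fun n => inner ℂ ψ (P.op (fun x => F n x * g x) φ)) atTop
        (𝓝 (inner ℂ ψ (P.op (fun x => f x * g x) φ))) := by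
    intro F f g C hg hm hb hl φ ψ
    obtain ⟨D, hD⟩ := hg.bdd
    refine P.tendsto_inner_op (C := C * D) (fun n => (hm n).mul hg.measurable)
      (fun n x => ?_) (fun x => (hl x).mul_const _) φ ψ
    rw [Pi.mul_apply, norm_mul]
    exact mul_le_mul (hb n x) (hD x) (norm_nonneg _) ((norm_nonneg _).trans (hb n x))
  have main : ∀ c B, MeasurableSet B → P.op (fun x => B.indicator (fun _ => c) x * g x) =
      P.op (B.indicator fun _ => c) * P.op g := by
    intro c B hB
    have hind : BddMeas (B.indicator fun _ => c) := (BddMeas.const c).indicator hB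
    refine BddMeas.induction (p := fun g => P.op (fun x => B.indicator (fun _ => c) x * g x) =
      P.op (B.indicator fun _ => c) * P.op g) ?_ ?_ ?_ hg
    · intro d D hD
      rw [P.op_indicator_const c hB, P.op_indicator_const d hD, smul_mul_smul_comm,
        ← P.proj_inter B D hB hD, ← P.op_indicator_const _ (hB.inter hD)]
      congr 1
      ext x
      by_cases h1 : x ∈ B <;> by_cases h2 : x ∈ D <;> simp [Set.indicator, h1, h2]
    · intro f g hf hg h1 h2
      rw [P.op_add hf hg, mul_add, ← h1, ← h2, ← P.op_add (hind.mul hf) (hind.mul hg)]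
      simp only [mul_add]
    · intro F f C hm hb hl h
      ext φ
      refine ext_inner_left ℂ fun ψ => ?_
      have h1 := limit F f _ C hind hm hb hl φ ψ
      have e : ∀ n, P.op (fun x => F n x * B.indicator (fun _ => c) x) =
          P.op (B.indicator fun _ => c) * P.op (F n) := fun n => by
        rw [← h n]; simp only [mul_comm]
      have h2 : Tendsto (fun n => inner ℂ ψ (P.op (fun x => F n x * B.indicator (fun _ => c) x) φ))
          atTop (𝓝 (inner ℂ ψ ((P.op (B.indicator fun _ => c) * P.op f) φ))) := by
        -- The fixed left factor is moved to `ψ` as an adjoint, so weak convergence of `P.op (F n)`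
        -- is enough.
        simp only [e, mul_apply_eq_comp,
          ← ContinuousLinearMap.adjoint_inner_left (P.op (B.indicator fun _ => c))]
        exact P.tendsto_inner_op hm hb hl φ _
      rw [← tendsto_nhds_unique h1 h2]
      simp only [mul_comm]
  refine BddMeas.induction (p := fun f => P.op (fun x => f x * g x) = P.op f * P.op g) main
    ?_ ?_ hf
  · intro f f' hf hf' h1 h2
    rw [P.op_add hf hf', add_mul, ← h1, ← h2, ← P.op_add (hf.mul hg) (hf'.mul hg)]
    simp only [add_mul]
  · intro F f C hm hb hl h
    ext φ
    refine ext_inner_left ℂ fun ψ => tendsto_nhds_unique (limit F f g C hg hm hb hl φ ψ) ?_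
    simp only [h, mul_apply_eq_comp]
    exact P.tendsto_inner_op hm hb hl _ ψ

theorem op_op {f g : S → ℂ} (hf : BddMeas f) (hg : BddMeas g) (φ : X) :
    P.op f (P.op g φ) = P.op (fun x => f x * g x) φ := by
  rw [P.op_mul hf hg]; rfl

/-- The measure of a vector does not see a unimodular factor, so exchanging `φ` and `ψ` only
permutes the four measures; the two with coefficient `±i` are interchanged, as conjugation requires.
-/
theorem pairing_conj (f : S → ℂ) (φ ψ : X) :
    pairing P.measure (fun x => starRingEnd ℂ (f x)) φ ψ =
      starRingEnd ℂ (pairing P.measure f ψ φ) := by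
  have e1 : P.measure (φ - ψ) = P.measure (ψ - φ) := by
    rw [← neg_sub, ← neg_one_smul ℂ, P.measure_smul_of_norm_one (by simp)]
  have e2 : P.measure (φ + Complex.I • ψ) = P.measure (ψ - Complex.I • φ) := by
    rw [← P.measure_smul_of_norm_one Complex.norm_I (ψ - Complex.I • φ), smul_sub, smul_smul,
      Complex.I_mul_I]
    simp [add_comm]
  have e3 : P.measure (φ - Complex.I • ψ) = P.measure (ψ + Complex.I • φ) := by
    rw [← P.measure_smul_of_norm_one (c := -Complex.I) (by simp) (ψ + Complex.I • φ), smul_add,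
      smul_smul, neg_mul, Complex.I_mul_I]
    simp [add_comm, sub_eq_add_neg]
  simp only [pairing, integral_conj, e1, e2, e3, add_comm φ ψ, map_mul, map_add, map_sub,
    Complex.conj_I, map_div₀, map_one, map_ofNat]
  ring

theorem adjoint_op {f : S → ℂ} (hf : BddMeas f) :
    ContinuousLinearMap.adjoint (P.op f) = P.op fun x => starRingEnd ℂ (f x) := by
  symm
  refine P.op_eq_of_isOp fun φ ψ => ?_
  rw [P.pairing_conj, ← P.inner_op hf, ContinuousLinearMap.adjoint_inner_right, inner_conj_symm]

/-- With `ψ = φ` the four measures are `4, 0, 2, 2` times `μ_φ`; the two imaginary terms cancel and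
the factor `1/4` remains. -/
theorem pairing_self (f : S → ℂ) (φ : X) :
    pairing P.measure f φ φ = ∫ x, f x ∂P.measure φ := by
  have e0 : P.measure (φ - φ) = 0 := by
    rw [sub_self, ← zero_smul ℂ (0 : X), P.measure_smul]; simp
  have e1 : P.measure (φ + φ) = ENNReal.ofReal 4 • P.measure φ := by
    rw [← two_smul ℂ, P.measure_smul]; norm_num
  have n1 : ‖(1 + Complex.I : ℂ)‖ ^ 2 = 2 := by
    rw [Complex.sq_norm, Complex.normSq_apply]; norm_num
  have n2 : ‖(1 - Complex.I : ℂ)‖ ^ 2 = 2 := by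
    rw [Complex.sq_norm, Complex.normSq_apply]; norm_num
  have e2 : P.measure (φ + Complex.I • φ) = ENNReal.ofReal 2 • P.measure φ := by
    rw [← n1, ← P.measure_smul, add_smul, one_smul]
  have e3 : P.measure (φ - Complex.I • φ) = ENNReal.ofReal 2 • P.measure φ := by
    rw [← n2, ← P.measure_smul, sub_smul, one_smul]
  rw [pairing, e0, e1, e2, e3]
  simp only [integral_smul_measure, integral_zero_measure, ENNReal.toReal_ofReal, Nat.ofNat_nonneg]
  simp

/-- The adjoint of `op f` times `op f` is `op |f|²`, read on the diagonal. Strong convergence and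
energy estimates rest on this identity. -/
theorem norm_op_sq {f : S → ℂ} (hf : BddMeas f) (φ : X) :
    ‖P.op f φ‖ ^ 2 = ∫ x, ‖f x‖ ^ 2 ∂P.measure φ := by
  have h : inner ℂ (P.op f φ) (P.op f φ) = ((∫ x, ‖f x‖ ^ 2 ∂P.measure φ : ℝ) : ℂ) := by
    rw [← ContinuousLinearMap.adjoint_inner_right, P.adjoint_op hf, P.op_op hf.conj hf,
      P.inner_op (hf.conj.mul hf), P.pairing_self, ← integral_complex_ofReal]
    congr 1
    ext x
    rw [Complex.conj_mul']
    simp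
  rw [inner_self_eq_norm_sq_to_K] at h
  exact Complex.ofReal_injective (by rw [Complex.ofReal_pow]; exact h)

theorem norm_op_le {f : S → ℂ} (hf : Measurable f) {C : ℝ} (hC0 : 0 ≤ C) (hC : ∀ x, ‖f x‖ ≤ C)
    (φ : X) : ‖P.op f φ‖ ≤ C * ‖φ‖ := by
  refine le_of_sq_le_sq ?_ (by positivity) |> fun h => h
  rw [P.norm_op_sq ⟨hf, C, hC⟩]
  refine (integral_mono (BddMeas.integrable_norm_sq ⟨hf, C, hC⟩ _) (integrable_const (C ^ 2))
    fun x => pow_le_pow_left₀ (norm_nonneg _) (hC x) 2).trans_eq ?_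
  rw [integral_const, Measure.real, P.measure_univ, ENNReal.toReal_ofReal (by positivity),
    smul_eq_mul]
  ring

theorem measure_op {f : S → ℂ} (hf : BddMeas f) (φ : X) :
    P.measure (P.op f φ) = (P.measure φ).withDensity fun x => ENNReal.ofReal (‖f x‖ ^ 2) := by
  ext B hB
  have e : P.proj B = P.op (B.indicator fun _ => 1) := by rw [P.op_indicator_const _ hB, one_smul]
  have hi : BddMeas (B.indicator fun _ : S => (1 : ℂ)) := (BddMeas.const 1).indicator hB
  rw [P.measure_apply _ hB, withDensity_apply _ hB, e, P.op_op hi hf, P.norm_op_sq (hi.mul hf),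
    ofReal_integral_eq_lintegral_ofReal ((hi.mul hf).integrable_norm_sq _)
      (Eventually.of_forall fun _ => by positivity), ← lintegral_indicator hB]
  congr 1
  ext x
  by_cases hx : x ∈ B <;> simp [Set.indicator, hx]

/-- The density of the new measure is `|f|²`, and `|m| |f|² ≤ C |m f|`. Hence an unbounded `m` is
allowed as soon as `f` compensates its growth. -/
theorem integrable_measure_op {m f : S → ℂ} (hf : BddMeas f) {φ : X} (hm : Measurable m)
    (h : Integrable (fun x => m x * f x) (P.measure φ)) : Integrable m (P.measure (P.op f φ)) := by
  rw [P.measure_op hf]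
  have hd : (fun x => ENNReal.ofReal (‖f x‖ ^ 2)) = fun x => ((‖f x‖₊ ^ 2 : NNReal) : ℝ≥0∞) := by
    ext x
    rw [← ENNReal.ofReal_coe_nnreal]; simp
  rw [hd, integrable_withDensity_iff_integrable_smul (by exact (hf.measurable.nnnorm.pow_const 2))]
  obtain ⟨C, hC⟩ := hf.bdd
  refine (h.norm.const_mul C).mono' (by
    exact ((hf.measurable.nnnorm.pow_const 2).smul hm).aestronglyMeasurable)
    (Eventually.of_forall fun x => ?_)
  rw [NNReal.smul_def, norm_smul, norm_mul]
  simp only [NNReal.coe_pow, coe_nnnorm, norm_pow, norm_norm]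
  have := mul_le_mul_of_nonneg_right (hC x) (mul_nonneg (norm_nonneg (m x)) (norm_nonneg (f x)))
  nlinarith

/-! ### Unbounded symbols -/

theorem bddMeas_trunc {m : S → ℂ} (hm : Measurable m) (n : ℕ) : BddMeas (trunc m n) := by
  refine ⟨hm.indicator (measurableSet_le hm.norm measurable_const), n, fun x => ?_⟩
  by_cases h : ‖m x‖ ≤ n <;> simp [trunc, Set.indicator, h]

/-- Identities proved for bounded symbols are carried to unbounded ones through this limit; `|m f|`
dominates every truncation. -/
theorem tendsto_pairing_trunc {m f : S → ℂ} {φ ψ : X} (hm : Measurable m) (hf : Measurable f)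
    (hφ : Integrable (fun x => m x * f x) (P.measure φ))
    (hψ : Integrable (fun x => m x * f x) (P.measure ψ)) :
    Tendsto (fun n => pairing P.measure (fun x => trunc m n x * f x) φ ψ) atTop
      (𝓝 (pairing P.measure (fun x => m x * f x) φ ψ)) := by
  refine tendsto_pairing (fun x => ‖m x * f x‖)
    (Eventually.of_forall fun n => (bddMeas_trunc hm n).measurable.mul hf)
    (Eventually.of_forall fun n x => ?_) (P.integrable_of_mem_polSet hφ.norm hψ.norm)
    fun w _ => Eventually.of_forall fun x => (tendsto_trunc m x).mul_const _
  rw [norm_mul, norm_mul]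
  exact mul_le_mul_of_nonneg_right (norm_trunc_le m n x) (norm_nonneg _)

/-- Cauchy-Schwarz inequality for `∫ m d⟨Eφ, ψ⟩`. -/
theorem norm_pairing_le {m : S → ℂ} {φ ψ : X} (hm : Measurable m)
    (hφ : Integrable m (P.measure φ)) (hψ : Integrable m (P.measure ψ)) :
    ‖pairing P.measure m φ ψ‖ ≤
      Real.sqrt (∫ x, ‖m x‖ ∂P.measure φ) * Real.sqrt (∫ x, ‖m x‖ ∂P.measure ψ) := by
  have bounded : ∀ m : S → ℂ, BddMeas m → ‖pairing P.measure m φ ψ‖ ≤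
      Real.sqrt (∫ x, ‖m x‖ ∂P.measure φ) * Real.sqrt (∫ x, ‖m x‖ ∂P.measure ψ) := by
    intro m hm
    obtain ⟨C, hC⟩ := hm.bdd
    -- The symbol is factored as `m = b a` with `|a|² = |b|² = |m|`, where `b` is zero at the zeros
    -- of `m` by the convention for division. The pairing is then an inner product of `op a φ` with
    -- `op (conj b) ψ`.
    set a : S → ℂ := fun x => (Real.sqrt ‖m x‖ : ℂ) with ha
    set b : S → ℂ := fun x => m x / (Real.sqrt ‖m x‖ : ℂ) with hb
    have ham : Measurable a :=
      Complex.measurable_ofReal.comp hm.measurable.norm.sqrt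
    have hna : ∀ x, ‖a x‖ ^ 2 = ‖m x‖ := fun x => by
      rw [ha, Complex.norm_real, Real.norm_of_nonneg (Real.sqrt_nonneg _),
        Real.sq_sqrt (norm_nonneg _)]
    have hnb : ∀ x, ‖b x‖ ^ 2 = ‖m x‖ := fun x => by
      rcases eq_or_ne (m x) 0 with h0 | h0
      · simp [hb, h0]
      · have : ‖m x‖ ≠ 0 := by simpa using h0
        rw [hb, norm_div, div_pow, hna x]
        field_simp
    have hbd : ∀ c : S → ℂ, Measurable c → (∀ x, ‖c x‖ ^ 2 = ‖m x‖) → BddMeas c :=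
      fun c hc h => ⟨hc, Real.sqrt C, fun x => Real.le_sqrt_of_sq_le ((h x).trans_le (hC x))⟩
    have hab := hbd a ham hna
    have hbb := hbd b (hm.measurable.div ham) hnb
    have e : m = fun x => b x * a x := by
      ext x
      rcases eq_or_ne (m x) 0 with h0 | h0
      · simp [ha, hb, h0]
      · have : (Real.sqrt ‖m x‖ : ℂ) ≠ 0 := by
          simpa [Real.sqrt_eq_zero'] using h0
        simp only [ha, hb]
        field_simp
    have e1 : pairing P.measure m φ ψ = inner ℂ (P.op (fun x => starRingEnd ℂ (b x)) ψ)
        (P.op a φ) := by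
      rw [← P.adjoint_op hbb, ContinuousLinearMap.adjoint_inner_left, P.op_op hbb hab, ← e,
        P.inner_op hm]
    rw [e1]
    refine (norm_inner_le_norm _ _).trans (le_of_eq ?_)
    rw [mul_comm]
    congr 1
    · rw [← Real.sqrt_sq (norm_nonneg (P.op a φ)), P.norm_op_sq hab]
      simp only [hna]
    · rw [← Real.sqrt_sq (norm_nonneg (P.op _ ψ)), P.norm_op_sq hbb.conj]
      simp only [RCLike.norm_conj, hnb]
  have hlim := P.tendsto_pairing_trunc (f := fun _ => 1) hm measurable_const
    (by simpa using hφ) (by simpa using hψ)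
  simp only [mul_one] at hlim
  refine le_of_tendsto hlim.norm (Eventually.of_forall fun n => (bounded _ (bddMeas_trunc hm n)).trans ?_)
  gcongr
  · exact ((bddMeas_trunc hm n).integrable _).norm
  · exact hφ.norm
  · exact fun x => norm_trunc_le m n x
  · exact ((bddMeas_trunc hm n).integrable _).norm
  · exact hψ.norm
  · exact fun x => norm_trunc_le m n x

theorem pairing_op_left {m f : S → ℂ} {φ ψ : X} (hm : Measurable m) (hf : BddMeas f)
    (hφ : Integrable (fun x => m x * f x) (P.measure φ)) (hψ : Integrable m (P.measure ψ)) :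
    pairing P.measure m (P.op f φ) ψ = pairing P.measure (fun x => m x * f x) φ ψ := by
  have hψ' : Integrable (fun x => m x * f x) (P.measure ψ) := by
    obtain ⟨C, hC⟩ := hf.bdd
    exact hψ.mul_bdd hf.measurable.aestronglyMeasurable (Eventually.of_forall hC)
  have h1 := P.tendsto_pairing_trunc (f := fun _ => 1) hm measurable_const
    (by simpa using P.integrable_measure_op hf hm hφ) (by simpa using hψ)
  have h2 := P.tendsto_pairing_trunc hm hf.measurable hφ hψ'
  simp only [mul_one] at h1
  refine tendsto_nhds_unique h1 (h2.congr fun n => ?_)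
  rw [← P.inner_op (bddMeas_trunc hm n), P.op_op (bddMeas_trunc hm n) hf,
    P.inner_op ((bddMeas_trunc hm n).mul hf)]

theorem pairing_adjoint_op_right {m f : S → ℂ} {φ ψ : X} (hm : Measurable m) (hf : BddMeas f)
    (hφ : Integrable m (P.measure φ)) (hψ : Integrable m (P.measure ψ)) :
    pairing P.measure m φ (ContinuousLinearMap.adjoint (P.op f) ψ) =
      pairing P.measure (fun x => m x * f x) φ ψ := by
  obtain ⟨C, hC⟩ := hf.bdd
  have hint : ∀ w, Integrable m (P.measure w) → Integrable (fun x => m x * f x) (P.measure w) :=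
    fun w hw => hw.mul_bdd hf.measurable.aestronglyMeasurable (Eventually.of_forall hC)
  have hψ' : Integrable m (P.measure (P.op (fun x => starRingEnd ℂ (f x)) ψ)) := by
    refine P.integrable_measure_op hf.conj hm ?_
    exact hψ.mul_bdd hf.conj.measurable.aestronglyMeasurable
      (Eventually.of_forall fun x => by simpa using hC x)
  have h1 := P.tendsto_pairing_trunc (f := fun _ => 1) hm measurable_const
    (by simpa using hφ) (by simpa using hψ')
  have h2 := P.tendsto_pairing_trunc hm hf.measurable (hint _ hφ) (hint _ hψ)
  simp only [mul_one] at h1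
  rw [P.adjoint_op hf]
  refine tendsto_nhds_unique h1 (h2.congr fun n => ?_)
  have hb := bddMeas_trunc hm n
  rw [← P.inner_op hb, ← P.adjoint_op hf, ContinuousLinearMap.adjoint_inner_left, P.op_op hf hb,
    ← P.inner_op (hb.mul hf)]
  simp only [mul_comm]

end ProjMeasure

/-! ### A Bessel-type integral on the closed right half-plane -/

/-- The integrand of `besselInt`. -/
def besselKer (a : ℝ) (w : ℂ) (r : ℝ) : ℂ :=
  ((Real.exp (-r) * r ^ (a - 1) : ℝ) : ℂ) * Complex.exp (-(w / r))

/-- `∫₀^∞ e^{-r} r^{a-1} e^{-w/r} dr`, a multiple of `w^{a/2} K_a(2√w)`. -/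
def besselInt (a : ℝ) (w : ℂ) : ℂ := ∫ r in Ioi (0 : ℝ), besselKer a w r

theorem norm_exp_neg_div_le {w : ℂ} (hw : 0 ≤ w.re) {r : ℝ} (hr : 0 < r) :
    ‖Complex.exp (-(w / r))‖ ≤ 1 := by
  rw [Complex.norm_exp, Real.exp_le_one_iff, Complex.neg_re, Complex.div_ofReal_re]
  exact neg_nonpos.2 (div_nonneg hw hr.le)

/-- Mean value inequality on the convex half-plane, where the derivative of `e^{-w}` has modulus at
most one. -/
theorem norm_exp_neg_sub_one_le {w : ℂ} (hw : 0 ≤ w.re) :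
    ‖Complex.exp (-w) - 1‖ ≤ ‖w‖ := by
  have h := (convex_halfSpace_re_ge 0).norm_image_sub_le_of_norm_hasDerivWithin_le
    (f := fun x : ℂ => Complex.exp (-x)) (f' := fun x => -Complex.exp (-x)) (C := 1)
    (fun x _ => by
      have := ((hasDerivAt_id x).neg.cexp).hasDerivWithinAt (s := {c : ℂ | 0 ≤ c.re})
      simpa using this)
    (fun x hx => by
      rw [norm_neg, Complex.norm_exp, Real.exp_le_one_iff]
      simpa using hx) (x := 0) (y := w) (by simp) hw
  simpa using h

theorem norm_exp_neg_sub_one_le_two {w : ℂ} (hw : 0 ≤ w.re) :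
    ‖Complex.exp (-w) - 1‖ ≤ 2 := by
  refine (norm_sub_le _ _).trans ?_
  rw [Complex.norm_exp, norm_one]
  have : Real.exp (-w).re ≤ 1 := by rw [Real.exp_le_one_iff]; simpa using hw
  linarith

theorem measurable_besselKer (a : ℝ) :
    Measurable fun p : ℂ × ℝ => besselKer a p.1 p.2 := by
  unfold besselKer
  fun_prop

theorem norm_besselKer_le {a : ℝ} {w : ℂ} (hw : 0 ≤ w.re) {r : ℝ} (hr : 0 < r) :
    ‖besselKer a w r‖ ≤ Real.exp (-r) * r ^ (a - 1) := by
  rw [besselKer, norm_mul, Complex.norm_real, Real.norm_of_nonneg (by positivity)]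
  exact mul_le_of_le_one_right (by positivity) (norm_exp_neg_div_le hw hr)

theorem integrableOn_besselKer {a : ℝ} (ha : 0 < a) {w : ℂ} (hw : 0 ≤ w.re) :
    IntegrableOn (besselKer a w) (Ioi 0) := by
  refine (Real.GammaIntegral_convergent ha).mono'
    ((measurable_besselKer a).comp measurable_prodMk_left).aestronglyMeasurable ?_
  exact (ae_restrict_mem measurableSet_Ioi).mono fun r hr => norm_besselKer_le hw hr

theorem measurable_besselInt (a : ℝ) : Measurable (besselInt a) :=
  ((measurable_besselKer a).stronglyMeasurable.integral_prod_right'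
    (ν := volume.restrict (Ioi (0 : ℝ)))).measurable

theorem norm_besselInt_le {a : ℝ} (ha : 0 < a) {w : ℂ} (hw : 0 ≤ w.re) :
    ‖besselInt a w‖ ≤ Real.Gamma a := by
  rw [Real.Gamma_eq_integral ha]
  refine norm_integral_le_of_norm_le (Real.GammaIntegral_convergent ha) ?_
  exact (ae_restrict_mem measurableSet_Ioi).mono fun r hr => norm_besselKer_le hw hr

theorem besselInt_zero {a : ℝ} (ha : 0 < a) : besselInt a 0 = Real.Gamma a := by
  rw [besselInt, Real.Gamma_eq_integral ha, ← integral_complex_ofReal]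
  simp [besselKer]

theorem continuousWithinAt_besselInt {a : ℝ} (ha : 0 < a) (w : ℂ) :
    ContinuousWithinAt (besselInt a) {w | 0 ≤ w.re} w := by
  refine tendsto_integral_filter_of_dominated_convergence
    (fun r => Real.exp (-r) * r ^ (a - 1)) (Eventually.of_forall fun w =>
      ((measurable_besselKer a).comp measurable_prodMk_left).aestronglyMeasurable) ?_
    (Real.GammaIntegral_convergent ha) ?_
  · filter_upwards [self_mem_nhdsWithin] with w hw
    exact (ae_restrict_mem measurableSet_Ioi).mono fun r hr => norm_besselKer_le hw hr
  · refine Eventually.of_forall fun r => ?_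
    have : Continuous fun w : ℂ => besselKer a w r := by unfold besselKer; fun_prop
    exact (this.tendsto w).mono_left nhdsWithin_le_nhds

/-- The derivative in `r` of `e^{-r} r^{a+1} e^{-w/r}` is the combination of the three kernels
occurring here, and this function vanishes at `0` and at infinity. Only `Re w ≥ 0` is used, so the
imaginary axis is included. -/
theorem mul_besselInt {a : ℝ} (ha : 0 < a) {w : ℂ} (hw : 0 ≤ w.re) :
    w * besselInt a w = besselInt (a + 2) w - (a + 1) * besselInt (a + 1) w := by
  have i0 := (integrableOn_besselKer ha hw).const_mul w
  have i1 := (integrableOn_besselKer (a := a + 1) (by linarith) hw).const_mul ((a : ℂ) + 1)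
  have i2 := integrableOn_besselKer (a := a + 2) (by linarith) hw
  have bound : ∀ r : ℝ, 0 ≤ r →
      ‖besselKer (a + 2) w r‖ ≤ Real.exp (-r) * r ^ (a + 1) := by
    intro r hr
    rcases hr.eq_or_lt with rfl | hr
    · have h1 : a + 2 - 1 ≠ 0 := by linarith
      simp [besselKer, Real.zero_rpow h1, Real.zero_rpow (show a + 1 ≠ 0 by linarith)]
    · simpa [show a + 2 - 1 = a + 1 by ring] using norm_besselKer_le (a := a + 2) hw hr
  have key := integral_Ioi_of_hasDerivAt_of_tendsto (a := (0 : ℝ)) (f := besselKer (a + 2) w)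
    (f' := fun r => w * besselKer a w r + (a + 1) * besselKer (a + 1) w r - besselKer (a + 2) w r)
    (m := 0) ?_ ?_ ((i0.add i1).sub i2) ?_
  · have h0 : besselKer (a + 2) w 0 = 0 := by
      have h1 : a + 2 - 1 ≠ 0 := by linarith
      simp [besselKer, Real.zero_rpow h1]
    have i01 : Integrable (fun r => w * besselKer a w r + (a + 1) * besselKer (a + 1) w r)
      (volume.restrict (Ioi 0)) := i0.add i1
    rw [h0, sub_zero, integral_sub i01 i2, integral_add i0 i1, integral_const_mul,
      integral_const_mul] at key
    simp only [besselInt]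
    linear_combination key
  · have h0 : besselKer (a + 2) w 0 = 0 := by
      have h1 : a + 2 - 1 ≠ 0 := by linarith
      simp [besselKer, Real.zero_rpow h1]
    rw [ContinuousWithinAt, h0]
    refine squeeze_zero_norm' (a := fun r : ℝ => Real.exp (-r) * r ^ (a + 1)) ?_ ?_
    · filter_upwards [self_mem_nhdsWithin] with r hr using bound r hr
    · have : Continuous fun r : ℝ => Real.exp (-r) * r ^ (a + 1) :=
        (Real.continuous_exp.comp continuous_neg).mul
          (Real.continuous_rpow_const (by linarith))
      have h := (this.tendsto 0).mono_left (nhdsWithin_le_nhds (s := Ici 0))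
      simpa [Real.zero_rpow (show a + 1 ≠ 0 by linarith)] using h
  · intro r hr
    have hr0 : (r : ℝ) ≠ 0 := (ne_of_gt hr)
    have hrc : (r : ℂ) ≠ 0 := by exact_mod_cast hr0
    have d1 : HasDerivAt (fun r : ℝ => ((Real.exp (-r) * r ^ (a + 2 - 1) : ℝ) : ℂ))
        ((Real.exp (-r) * (-1) * r ^ (a + 2 - 1) +
          Real.exp (-r) * ((a + 2 - 1) * r ^ (a + 2 - 1 - 1)) : ℝ) : ℂ) r :=
      (((hasDerivAt_neg r).exp).mul
        (Real.hasDerivAt_rpow_const (Or.inl hr0))).ofReal_comp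
    have d2 : HasDerivAt (fun r : ℝ => Complex.exp (-(w / r)))
        (Complex.exp (-(w / r)) * (w / (r : ℂ) ^ 2)) r := by
      have h1 : HasDerivAt (fun r : ℝ => (r : ℂ)) 1 r := (hasDerivAt_id r).ofReal_comp
      have h2 : HasDerivAt (fun r : ℝ => -(w / (r : ℂ))) (w / (r : ℂ) ^ 2) r := by
        convert! ((hasDerivAt_const r w).div h1 hrc).neg using 1
        ring
      exact h2.cexp
    convert! d1.mul d2 using 1
    have e1 : (r : ℝ) ^ (a + 2 - 1) = r ^ (a - 1) * r ^ 2 := by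
      rw [← Real.rpow_natCast, ← Real.rpow_add hr]; congr 1; push_cast; ring
    have e2 : (r : ℝ) ^ (a + 2 - 1 - 1) = r ^ (a - 1) * r := by
      rw [← Real.rpow_add_one hr0]; ring_nf
    have e3 : (r : ℝ) ^ (a + 1 - 1) = r ^ (a - 1) * r := by
      rw [← Real.rpow_add_one hr0]; ring_nf
    simp only [besselKer, e1, e2, e3]
    push_cast
    field_simp
    ring
  · refine squeeze_zero_norm' (a := fun r : ℝ => Real.exp (-r) * r ^ (a + 1)) ?_ ?_
    · filter_upwards [eventually_ge_atTop 0] with r hr using bound r hr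
    · have := tendsto_rpow_mul_exp_neg_mul_atTop_nhds_zero (a + 1) 1 one_pos
      simpa [mul_comm] using this

/-- The two terms of the recurrence contribute `Γ(a+2)` each, since `(a+1) Γ(a+1) = Γ(a+2)`. This
decay places the extension in `Dom(H)` and makes it vanish weakly at infinity. -/
theorem norm_mul_besselInt_le {a : ℝ} (ha : 0 < a) {w : ℂ} (hw : 0 ≤ w.re) :
    ‖w * besselInt a w‖ ≤ 2 * Real.Gamma (a + 2) := by
  rw [mul_besselInt ha hw]
  refine (norm_sub_le _ _).trans ?_
  have h1 := norm_besselInt_le (a := a + 2) (by linarith) hw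
  have h2 := norm_besselInt_le (a := a + 1) (by linarith) hw
  have h3 : Real.Gamma (a + 2) = (a + 1) * Real.Gamma (a + 1) := by
    rw [← Real.Gamma_add_one (by linarith)]; ring_nf
  have h4 : ‖(a : ℂ) + 1‖ = a + 1 := by
    rw [← Complex.ofReal_one, ← Complex.ofReal_add, Complex.norm_real,
      Real.norm_of_nonneg (by linarith)]
  rw [norm_mul, h4]
  nlinarith

theorem besselInt_sub_gamma {a : ℝ} (ha : 0 < a) {w : ℂ} (hw : 0 ≤ w.re) :
    besselInt a w - Real.Gamma a = ∫ r in Ioi (0 : ℝ),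
      ((Real.exp (-r) * r ^ (a - 1) : ℝ) : ℂ) * (Complex.exp (-(w / r)) - 1) := by
  rw [← besselInt_zero ha, besselInt, besselInt, ← integral_sub (integrableOn_besselKer ha hw)
    (integrableOn_besselKer ha (by simp))]
  simp [besselKer, mul_sub]

/-- The factor `1/r` in `|e^{-w/r} - 1| ≤ |w|/r` is absorbed by the extra power of `r`. The error is
therefore linear in `w`, hence negligible against `|w|^s` near zero. -/
theorem norm_besselInt_add_one_sub_gamma_le {a : ℝ} (ha : 0 < a) {w : ℂ} (hw : 0 ≤ w.re) :
    ‖besselInt (a + 1) w - Real.Gamma (a + 1)‖ ≤ ‖w‖ * Real.Gamma a := by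
  rw [besselInt_sub_gamma (by linarith) hw, Real.Gamma_eq_integral ha, ← integral_const_mul]
  refine norm_integral_le_of_norm_le ((Real.GammaIntegral_convergent ha).const_mul _) ?_
  refine (ae_restrict_mem measurableSet_Ioi).mono fun r hr => ?_
  have hr : (0 : ℝ) < r := hr
  rw [norm_mul, Complex.norm_real, Real.norm_of_nonneg (by positivity)]
  have h1 := norm_exp_neg_sub_one_le (w := w / r)
    (by rw [Complex.div_ofReal_re]; exact div_nonneg hw hr.le)
  rw [norm_div, Complex.norm_real, Real.norm_of_nonneg hr.le] at h1
  have e : (r : ℝ) ^ (a + 1 - 1) = r ^ (a - 1) * r := by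
    rw [← Real.rpow_add_one hr.ne']; ring_nf
  calc _ ≤ Real.exp (-r) * r ^ (a + 1 - 1) * (‖w‖ / r) := by gcongr
    _ = _ := by rw [e]; field_simp

/-! ### Behaviour of the Bessel-type integral at the origin -/

/-- A majorant for `r^{s-1}(e^{-z/r} - 1)`: the constant 2 serves near `0`, where `s > 0` is needed,
and `c/r` serves at infinity, where `s < 1` is needed. -/
theorem integrableOn_rpow_mul_min {s : ℝ} (hs0 : 0 < s) (hs1 : s < 1) {c : ℝ} (hc : 0 ≤ c) :
    IntegrableOn (fun r : ℝ => r ^ (s - 1) * min 2 (c / r)) (Ioi 0) := by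
  have hm : Measurable fun r : ℝ => r ^ (s - 1) * min 2 (c / r) := by fun_prop
  have hn : ∀ r : ℝ, 0 < r → 0 ≤ min 2 (c / r) := fun r hr => le_min zero_le_two (by positivity)
  rw [← Ioc_union_Ioi_eq_Ioi zero_le_one]
  refine IntegrableOn.union ?_ ?_
  · have h0 : IntegrableOn (fun r : ℝ => r ^ (s - 1) * 2) (Ioc 0 1) :=
      ((intervalIntegrable_iff_integrableOn_Ioc_of_le zero_le_one).1
        (intervalIntegral.intervalIntegrable_rpow' (by linarith))).mul_const _
    refine h0.mono' hm.aestronglyMeasurable ?_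
    refine (ae_restrict_mem measurableSet_Ioc).mono fun r hr => ?_
    have hr0 : 0 < r := hr.1
    rw [Real.norm_of_nonneg (mul_nonneg (by positivity) (hn r hr0))]
    gcongr
    exact min_le_left _ _
  · have h0 : IntegrableOn (fun r : ℝ => c * r ^ (s - 2)) (Ioi 1) :=
      (integrableOn_Ioi_rpow_of_lt (by linarith) one_pos).const_mul _
    refine h0.mono' hm.aestronglyMeasurable ?_
    refine (ae_restrict_mem measurableSet_Ioi).mono fun r hr => ?_
    have hr0 : 0 < r := one_pos.trans hr
    rw [Real.norm_of_nonneg (mul_nonneg (by positivity) (hn r hr0))]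
    have e : r ^ (s - 1) = r ^ (s - 2) * r := by
      rw [← Real.rpow_add_one hr0.ne']; congr 1; ring
    calc r ^ (s - 1) * min 2 (c / r) ≤ r ^ (s - 1) * (c / r) := by
          gcongr; exact min_le_right _ _
      _ = c * r ^ (s - 2) := by rw [e]; field_simp

theorem norm_exp_neg_div_sub_one_le {w : ℂ} (hw : 0 ≤ w.re) {r c : ℝ} (hr : 0 < r)
    (hc : ‖w‖ ≤ c) : ‖Complex.exp (-(w / r)) - 1‖ ≤ min 2 (c / r) := by
  have hre : 0 ≤ (w / r).re := by rw [Complex.div_ofReal_re]; exact div_nonneg hw hr.le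
  refine le_min (norm_exp_neg_sub_one_le_two hre) ((norm_exp_neg_sub_one_le hre).trans ?_)
  rw [norm_div, Complex.norm_real, Real.norm_of_nonneg hr.le]
  gcongr

/-- Rescaling of `besselInt s - Γ(s)`. -/
theorem besselInt_sub_gamma_scale {s : ℝ} (hs : 0 < s) {z : ℂ} (hz : 0 ≤ z.re) {t : ℝ}
    (ht : 0 < t) : besselInt s (t * z) - Real.Gamma s = ((t ^ s : ℝ) : ℂ) *
      ∫ r in Ioi (0 : ℝ), ((Real.exp (-(t * r)) * r ^ (s - 1) : ℝ) : ℂ) *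
        (Complex.exp (-(z / r)) - 1) := by
  rw [besselInt_sub_gamma hs (by simpa using mul_nonneg ht.le hz)]
  have h := integral_comp_mul_left_Ioi (fun r : ℝ =>
    ((Real.exp (-r) * r ^ (s - 1) : ℝ) : ℂ) * (Complex.exp (-(t * z / r)) - 1)) 0 ht
  rw [mul_zero] at h
  have htc : (t : ℂ) ≠ 0 := by exact_mod_cast ht.ne'
  rw [eq_inv_smul_iff₀ ht.ne'] at h
  rw [← h, Complex.real_smul, ← integral_const_mul, ← integral_const_mul]
  refine setIntegral_congr_fun measurableSet_Ioi fun r hr => ?_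
  have hr : (0 : ℝ) < r := hr
  have hrc : (r : ℂ) ≠ 0 := by exact_mod_cast hr.ne'
  have e : (t : ℂ) * z / ((t * r : ℝ) : ℂ) = z / r := by
    push_cast; field_simp
  have e2 : t * (Real.exp (-(t * r)) * (t * r) ^ (s - 1)) =
      t ^ s * (Real.exp (-(t * r)) * r ^ (s - 1)) := by
    rw [Real.mul_rpow ht.le hr.le, Real.rpow_sub_one ht.ne']; field_simp
  simp only [e]
  rw [← mul_assoc, ← mul_assoc, ← Complex.ofReal_mul, ← Complex.ofReal_mul, e2]

/-- Rescaling by `‖w‖` leaves a symbol of modulus one and extracts the factor `‖w‖^s`. The weight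
`e^{-‖w‖r}` is then dropped, and the remaining integral depends on `s` alone. -/
theorem exists_norm_besselInt_sub_gamma_le {s : ℝ} (hs0 : 0 < s) (hs1 : s < 1) :
    ∃ C, 0 ≤ C ∧ ∀ w : ℂ, 0 ≤ w.re → ‖besselInt s w - Real.Gamma s‖ ≤ C * ‖w‖ ^ s := by
  refine ⟨∫ r in Ioi (0 : ℝ), r ^ (s - 1) * min 2 (1 / r), ?_, fun w hw => ?_⟩
  · refine setIntegral_nonneg measurableSet_Ioi fun r hr => ?_
    have hr : (0 : ℝ) < r := hr
    positivity
  rcases eq_or_ne w 0 with rfl | h0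
  · simp [besselInt_zero hs0, Real.zero_rpow hs0.ne']
  have hn : 0 < ‖w‖ := norm_pos_iff.2 h0
  have hnc : (‖w‖ : ℂ) ≠ 0 := by exact_mod_cast hn.ne'
  have hre : 0 ≤ (w / ‖w‖).re := by rw [Complex.div_ofReal_re]; positivity
  have e : w = ‖w‖ * (w / ‖w‖) := by field_simp
  have h := besselInt_sub_gamma_scale hs0 hre hn
  rw [← e] at h
  rw [h, norm_mul, Complex.norm_real, Real.norm_of_nonneg (by positivity), mul_comm]
  gcongr
  refine norm_integral_le_of_norm_le (integrableOn_rpow_mul_min hs0 hs1 zero_le_one) ?_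
  refine (ae_restrict_mem measurableSet_Ioi).mono fun r hr => ?_
  have hr : (0 : ℝ) < r := hr
  rw [norm_mul, Complex.norm_real, Real.norm_of_nonneg (by positivity)]
  have h1 : Real.exp (-(‖w‖ * r)) ≤ 1 := Real.exp_le_one_iff.2 (by
    have := mul_pos hn hr; linarith)
  have h2 := norm_exp_neg_div_sub_one_le hre hr (c := 1)
    (by rw [norm_div, Complex.norm_real, norm_norm, div_self hn.ne'])
  calc _ ≤ (1 * r ^ (s - 1)) * min 2 (1 / r) := by gcongr
    _ = _ := by rw [one_mul]

theorem tendsto_besselInt_sub_gamma_div {s : ℝ} (hs0 : 0 < s) (hs1 : s < 1) {z : ℂ}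
    (hz : 0 ≤ z.re) :
    Tendsto (fun t : ℝ => (besselInt s (t * z) - Real.Gamma s) / ((t ^ s : ℝ) : ℂ)) (𝓝[>] 0)
      (𝓝 (∫ r in Ioi (0 : ℝ), ((r ^ (s - 1) : ℝ) : ℂ) * (Complex.exp (-(z / r)) - 1))) := by
  have h : Tendsto (fun t : ℝ => ∫ r in Ioi (0 : ℝ),
      ((Real.exp (-(t * r)) * r ^ (s - 1) : ℝ) : ℂ) * (Complex.exp (-(z / r)) - 1)) (𝓝[>] 0)
      (𝓝 (∫ r in Ioi (0 : ℝ), ((r ^ (s - 1) : ℝ) : ℂ) * (Complex.exp (-(z / r)) - 1))) := by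
    refine tendsto_integral_filter_of_dominated_convergence
      (fun r : ℝ => r ^ (s - 1) * min 2 (‖z‖ / r)) (Eventually.of_forall fun t => ?_) ?_
      (integrableOn_rpow_mul_min hs0 hs1 (norm_nonneg z)) (Eventually.of_forall fun r => ?_)
    · exact Measurable.aestronglyMeasurable (by fun_prop)
    · filter_upwards [self_mem_nhdsWithin] with t ht
      refine (ae_restrict_mem measurableSet_Ioi).mono fun r hr => ?_
      have hr : (0 : ℝ) < r := hr
      rw [norm_mul, Complex.norm_real, Real.norm_of_nonneg (by positivity)]
      have h1 : Real.exp (-(t * r)) ≤ 1 := Real.exp_le_one_iff.2 (by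
        have := mul_pos ht hr; linarith)
      have h2 := norm_exp_neg_div_sub_one_le hz hr le_rfl
      calc _ ≤ (1 * r ^ (s - 1)) * min 2 (‖z‖ / r) := by gcongr
        _ = _ := by rw [one_mul]
    · have hc : Continuous fun t : ℝ => ((Real.exp (-(t * r)) * r ^ (s - 1) : ℝ) : ℂ) *
          (Complex.exp (-(z / r)) - 1) := by fun_prop
      have := (hc.tendsto 0).mono_left (nhdsWithin_le_nhds (s := Ioi 0))
      simpa using this
  refine h.congr' ?_
  filter_upwards [self_mem_nhdsWithin] with t ht
  have ht : (0 : ℝ) < t := ht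
  have : ((t ^ s : ℝ) : ℂ) ≠ 0 := by exact_mod_cast (Real.rpow_pos_of_pos ht s).ne'
  rw [besselInt_sub_gamma_scale hs0 hz ht, mul_div_cancel_left₀ _ this]

/-! ### Laplace-type integrals are holomorphic on the right half-plane -/

/-- Such integrals are evaluated on the positive axis by real substitutions; holomorphy is what
allows the formulas to be continued to the half-plane. -/
theorem differentiableOn_laplace {α : Type*} [MeasurableSpace α] {μ : Measure α} {φ q : α → ℝ}
    (hφ : Measurable φ) (hqm : Measurable q) (hq : ∀ᵐ r ∂μ, 0 ≤ q r)
    (hint : ∀ δ : ℝ, 0 < δ → Integrable (fun r => φ r * Real.exp (-(δ * q r))) μ) :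
    DifferentiableOn ℂ (fun z : ℂ => ∫ r, (φ r : ℂ) * Complex.exp (-(z * q r)) ∂μ)
      {z | 0 < z.re} := by
  intro z hz
  have hz : 0 < z.re := hz
  -- On the ball of radius `δ` the real part stays above `2δ`. One factor `e^{-δq}` absorbs the `q`
  -- produced by differentiation, the other keeps the bound integrable.
  set δ := z.re / 4 with hδ
  have hδ0 : 0 < δ := by positivity
  have hm : ∀ z : ℂ, AEStronglyMeasurable (fun r => (φ r : ℂ) * Complex.exp (-(z * q r))) μ :=
    fun z => Measurable.aestronglyMeasurable (by fun_prop)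
  have hn : ∀ (w : ℂ) (r : α), ‖(φ r : ℂ) * Complex.exp (-(w * q r))‖ =
      |φ r| * Real.exp (-(w.re * q r)) := by
    intro w r
    rw [norm_mul, Complex.norm_real, Complex.norm_exp]
    simp
  have key := hasDerivAt_integral_of_dominated_loc_of_deriv_le (μ := μ) (𝕜 := ℂ)
    (F := fun (z : ℂ) r => (φ r : ℂ) * Complex.exp (-(z * q r)))
    (F' := fun (z : ℂ) r => (φ r : ℂ) * (Complex.exp (-(z * q r)) * (-(q r : ℂ))))
    (x₀ := z) (s := Metric.ball z δ) (bound := fun r => δ⁻¹ * ‖φ r * Real.exp (-(δ * q r))‖)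
    (Metric.ball_mem_nhds z hδ0) (Eventually.of_forall hm) ?_ ?_ ?_ ?_ ?_
  · exact key.2.differentiableAt.differentiableWithinAt
  · refine (hint z.re hz).norm.mono' (hm z) (Eventually.of_forall fun r => ?_)
    rw [hn, norm_mul, Real.norm_eq_abs, Real.norm_of_nonneg (Real.exp_pos _).le]
  · exact Measurable.aestronglyMeasurable (by fun_prop)
  · filter_upwards [hq] with r hr w hw
    have hw1 : 2 * δ ≤ w.re := by
      have h1 : |(w - z).re| ≤ ‖w - z‖ := Complex.abs_re_le_norm _
      rw [mem_ball_iff_norm] at hw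
      rw [Complex.sub_re] at h1
      have := abs_le.1 (h1.trans hw.le)
      linarith [this.1]
    rw [← mul_assoc, norm_mul, hn, norm_neg, Complex.norm_real, Real.norm_of_nonneg hr, norm_mul,
      Real.norm_eq_abs, Real.norm_of_nonneg (Real.exp_pos _).le]
    have h1 : q r ≤ δ⁻¹ * Real.exp (δ * q r) := by
      rw [inv_mul_eq_div, le_div_iff₀ hδ0]
      linarith [Real.add_one_le_exp (δ * q r)]
    have h2 : Real.exp (-(w.re * q r)) ≤ Real.exp (-(2 * δ * q r)) := by
      gcongr
    calc |φ r| * Real.exp (-(w.re * q r)) * q r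
        ≤ |φ r| * Real.exp (-(2 * δ * q r)) * (δ⁻¹ * Real.exp (δ * q r)) := by gcongr
      _ = δ⁻¹ * (|φ r| * (Real.exp (-(2 * δ * q r)) * Real.exp (δ * q r))) := by ring
      _ = _ := by rw [← Real.exp_add]; ring_nf
  · exact (hint δ hδ0).norm.const_mul _
  · refine Eventually.of_forall fun r w _ => ?_
    have h1 : HasDerivAt (fun w : ℂ => -(w * (q r : ℂ))) (-(q r : ℂ)) w := by
      simpa using! ((hasDerivAt_id w).mul_const (q r : ℂ)).neg
    exact (h1.cexp).const_mul _

/-- Identity theorem: the half-plane is connected and the real points `1 + 1/(n+1)` accumulate at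
`1` inside it. -/
theorem eq_of_eq_ofReal {f g : ℂ → ℂ} (hf : DifferentiableOn ℂ f {z | 0 < z.re})
    (hg : DifferentiableOn ℂ g {z | 0 < z.re}) (h : ∀ x : ℝ, 0 < x → f x = g x) {z : ℂ}
    (hz : 0 < z.re) : f z = g z := by
  have ho : IsOpen {z : ℂ | 0 < z.re} := isOpen_lt continuous_const Complex.continuous_re
  refine AnalyticOnNhd.eqOn_of_preconnected_of_frequently_eq (hf.analyticOnNhd ho)
    (hg.analyticOnNhd ho) (convex_halfSpace_re_gt 0).isPreconnected (z₀ := 1) (by simp) ?_ hz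
  have ht : Tendsto (fun n : ℕ => ((1 + 1 / ((n : ℝ) + 1) : ℝ) : ℂ)) atTop (𝓝[≠] 1) := by
    refine tendsto_nhdsWithin_iff.2 ⟨?_, Eventually.of_forall fun n => ?_⟩
    · have := (tendsto_one_div_add_atTop_nhds_zero_nat (𝕜 := ℝ)).const_add 1
      rw [add_zero] at this
      exact (Complex.continuous_ofReal.tendsto _).comp this
    · have : (0 : ℝ) < 1 / ((n : ℝ) + 1) := by positivity
      simp only [mem_compl_iff, mem_singleton_iff]
      intro h
      have h' : (1 + 1 / ((n : ℝ) + 1) : ℝ) = 1 := by exact_mod_cast h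
      linarith
  exact ht.frequently (Frequently.of_forall fun n => h _ (by positivity))

theorem mem_slitPlane_of_re_nonneg {z : ℂ} (hz : 0 ≤ z.re) (h0 : z ≠ 0) : z ∈ Complex.slitPlane := by
  rw [Complex.mem_slitPlane_iff]
  by_contra h
  push Not at h
  exact h0 (Complex.ext (le_antisymm h.1 hz) h.2)

theorem differentiableOn_cpow_const (c : ℂ) :
    DifferentiableOn ℂ (fun z : ℂ => z ^ c) {z | 0 < z.re} := fun _ hz =>
  (differentiableAt_id.cpow_const (Or.inl hz)).differentiableWithinAt

theorem integral_comp_inv_Ioi {E : Type*} [NormedAddCommGroup E] [NormedSpace ℝ E] (g : ℝ → E) :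
    ∫ x in Ioi (0 : ℝ), (x ^ (-2 : ℝ)) • g x⁻¹ = ∫ x in Ioi (0 : ℝ), g x := by
  rw [← integral_comp_rpow_Ioi g (p := -1) (by norm_num)]
  refine setIntegral_congr_fun measurableSet_Ioi fun x hx => ?_
  simp only [Real.rpow_neg_one]
  norm_num

theorem integrableOn_comp_inv_Ioi_iff {E : Type*} [NormedAddCommGroup E] [NormedSpace ℝ E]
    (g : ℝ → E) :
    IntegrableOn (fun x : ℝ => (x ^ (-2 : ℝ)) • g x⁻¹) (Ioi 0) ↔ IntegrableOn g (Ioi 0) := by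
  rw [← integrableOn_Ioi_comp_rpow_iff g (p := -1) (by norm_num)]
  refine integrableOn_congr_fun (fun x hx => ?_) measurableSet_Ioi
  simp only [Real.rpow_neg_one]
  norm_num

/-- For `z > 0` the substitution `r ↦ 1/r` gives a Gamma integral; both sides are holomorphic in `Re
z > 0`. -/
theorem integral_rpow_mul_exp_neg_div {s : ℝ} (hs1 : s < 1) {z : ℂ} (hz : 0 < z.re) :
    ∫ r in Ioi (0 : ℝ), ((r ^ (s - 2) : ℝ) : ℂ) * Complex.exp (-(z / r)) =
      Real.Gamma (1 - s) * z ^ ((s : ℂ) - 1) := by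
  have e : ∀ x : ℝ, 0 < x → ∀ r ∈ Ioi (0 : ℝ), r ^ (s - 2) * Real.exp (-(x * r⁻¹)) =
      (r ^ (-2 : ℝ)) • (r⁻¹ ^ (1 - s - 1) * Real.exp (-(x * r⁻¹))) := by
    intro x hx r hr
    have hr : (0 : ℝ) < r := hr
    rw [Real.inv_rpow hr.le, ← Real.rpow_neg hr.le, smul_eq_mul, ← mul_assoc, ← Real.rpow_add hr]
    congr 2
    ring
  have hd := differentiableOn_laplace (μ := volume.restrict (Ioi (0 : ℝ)))
    (φ := fun r => r ^ (s - 2)) (q := fun r => r⁻¹) (by fun_prop) (by fun_prop)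
    ((ae_restrict_mem measurableSet_Ioi).mono fun r hr => inv_nonneg.2 (le_of_lt hr))
    (fun δ hδ => by
      refine (integrableOn_congr_fun (e δ hδ) measurableSet_Ioi).2 ?_
      refine (integrableOn_comp_inv_Ioi_iff fun x => x ^ (1 - s - 1) * Real.exp (-(δ * x))).2 ?_
      have := integrableOn_rpow_mul_exp_neg_mul_rpow (s := 1 - s - 1) (p := 1) (by linarith)
        one_pos hδ
      simpa using this)
  have := eq_of_eq_ofReal hd ((differentiableOn_cpow_const ((s : ℂ) - 1)).const_mul
    (Real.Gamma (1 - s) : ℂ)) (fun x hx => ?_) hz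
  · simpa only [Complex.ofReal_inv, div_eq_mul_inv] using this
  · have h1 := Real.integral_rpow_mul_exp_neg_mul_Ioi (a := 1 - s) (by linarith) hx
    rw [← integral_comp_inv_Ioi, ← setIntegral_congr_fun measurableSet_Ioi (e x hx)] at h1
    have h2 := congrArg (fun y : ℝ => (y : ℂ)) h1
    simp only [← integral_complex_ofReal] at h2
    push_cast at h2 ⊢
    rw [h2, mul_comm]
    congr 1
    have hxc : (x : ℂ) ≠ 0 := by exact_mod_cast hx.ne'
    rw [Complex.ofReal_cpow (by positivity), one_div, Complex.ofReal_inv, Complex.inv_cpow]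
    · rw [← Complex.cpow_neg]; push_cast; ring_nf
    · rw [Complex.arg_ofReal_of_nonneg hx.le]; exact Real.pi_pos.ne

theorem tendsto_add_inv_nat (z : ℂ) :
    Tendsto (fun n : ℕ => z + ((1 / ((n : ℝ) + 1) : ℝ) : ℂ)) atTop (𝓝 z) := by
  have h := (Complex.continuous_ofReal.tendsto _).comp
    (tendsto_one_div_add_atTop_nhds_zero_nat (𝕜 := ℝ))
  simpa using! h.const_add z

theorem re_add_inv_nat_pos {z : ℂ} (hz : 0 ≤ z.re) (n : ℕ) :
    0 < (z + ((1 / ((n : ℝ) + 1) : ℝ) : ℂ)).re := by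
  have : (0 : ℝ) < 1 / ((n : ℝ) + 1) := by positivity
  rw [Complex.add_re, Complex.ofReal_re]
  linarith

theorem norm_rpow_mul_exp_sub_one_le {s : ℝ} {z : ℂ} (hz : 0 ≤ z.re) {r c : ℝ} (hr : 0 < r)
    (hc : ‖z‖ ≤ c) : ‖((r ^ (s - 1) : ℝ) : ℂ) * (Complex.exp (-(z / r)) - 1)‖ ≤
      r ^ (s - 1) * min 2 (c / r) := by
  rw [norm_mul, Complex.norm_real, Real.norm_of_nonneg (by positivity)]
  gcongr
  exact norm_exp_neg_div_sub_one_le hz hr hc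

/-- The integral of a non-integrable function is zero by convention, whereas the value computed in
`integral_rpow_mul_exp_neg_div` is not. -/
theorem integrableOn_rpow_mul_exp_neg_div {s : ℝ} (hs1 : s < 1) {z : ℂ} (hz : 0 < z.re) :
    IntegrableOn (fun r : ℝ => ((r ^ (s - 2) : ℝ) : ℂ) * Complex.exp (-(z / r))) (Ioi 0) := by
  by_contra h
  have h1 := integral_rpow_mul_exp_neg_div hs1 hz
  rw [integral_undef h] at h1
  have hz0 : z ≠ 0 := by rintro rfl; simp at hz
  have h2 : (Real.Gamma (1 - s) : ℂ) ≠ 0 := by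
    exact_mod_cast (Real.Gamma_pos_of_pos (by linarith)).ne'
  exact mul_ne_zero h2 (by simp [Complex.cpow_eq_zero_iff, hz0]) h1.symm

/-- Integration by parts with the primitive `r^s / s` reduces to the preceding Gamma-type integral,
and `Γ(1-s) = -s Γ(-s)`. The boundary terms are at most `2 r^s / s` near `0` and `‖z‖ r^{s-1} / s`
at infinity. -/
theorem integral_rpow_mul_exp_sub_one_of_pos {s : ℝ} (hs0 : 0 < s) (hs1 : s < 1) {z : ℂ}
    (hz : 0 < z.re) :
    ∫ r in Ioi (0 : ℝ), ((r ^ (s - 1) : ℝ) : ℂ) * (Complex.exp (-(z / r)) - 1) =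
      Real.Gamma (-s) * z ^ (s : ℂ) := by
  have hz0 : z ≠ 0 := by rintro rfl; simp at hz
  have hsc : (s : ℂ) ≠ 0 := by exact_mod_cast hs0.ne'
  have i1 : IntegrableOn (fun r : ℝ => ((r ^ (s - 1) : ℝ) : ℂ) * (Complex.exp (-(z / r)) - 1))
      (Ioi 0) := by
    refine (integrableOn_rpow_mul_min hs0 hs1 (norm_nonneg z)).mono'
      (Measurable.aestronglyMeasurable (by fun_prop)) ?_
    exact (ae_restrict_mem measurableSet_Ioi).mono fun r hr =>
      norm_rpow_mul_exp_sub_one_le hz.le hr le_rfl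
  have i2 := (integrableOn_rpow_mul_exp_neg_div hs1 hz).const_mul (z / s)
  have bound : ∀ r : ℝ, 0 < r → ‖((r ^ s / s : ℝ) : ℂ) * (Complex.exp (-(z / r)) - 1)‖ ≤
      r ^ s / s * min 2 (‖z‖ / r) := by
    intro r hr
    rw [norm_mul, Complex.norm_real, Real.norm_of_nonneg (by positivity)]
    gcongr
    exact norm_exp_neg_div_sub_one_le hz.le hr le_rfl
  have key := integral_Ioi_of_hasDerivAt_of_tendsto (a := (0 : ℝ))
    (f := fun r : ℝ => ((r ^ s / s : ℝ) : ℂ) * (Complex.exp (-(z / r)) - 1))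
    (f' := fun r => ((r ^ (s - 1) : ℝ) : ℂ) * (Complex.exp (-(z / r)) - 1) +
      z / s * (((r ^ (s - 2) : ℝ) : ℂ) * Complex.exp (-(z / r))))
    (m := 0) ?_ ?_ (i1.add i2) ?_
  · rw [integral_add i1 i2, integral_const_mul, integral_rpow_mul_exp_neg_div hs1 hz] at key
    have hG : Real.Gamma (1 - s) = -s * Real.Gamma (-s) := by
      rw [← Real.Gamma_add_one (by linarith : -s ≠ 0)]; ring_nf
    have hp : z ^ (s : ℂ) = z ^ ((s : ℂ) - 1) * z := by
      rw [Complex.cpow_sub _ _ hz0, Complex.cpow_one]; field_simp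
    rw [hG] at key
    simp only [Real.zero_rpow hs0.ne', zero_div, Complex.ofReal_zero, zero_mul, sub_zero] at key
    rw [hp]
    push_cast at key
    have e : z / s * (-(s : ℂ) * Real.Gamma (-s) * z ^ ((s : ℂ) - 1)) =
        -(Real.Gamma (-s) * (z ^ ((s : ℂ) - 1) * z)) := by field_simp
    rw [e] at key
    linear_combination key
  · have hb : ∀ r ∈ Ici (0 : ℝ), ‖((r ^ s / s : ℝ) : ℂ) * (Complex.exp (-(z / r)) - 1)‖ ≤
        r ^ s / s * 2 := by
      intro r hr
      rcases (mem_Ici.1 hr).eq_or_lt with rfl | hr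
      · simp [Real.zero_rpow hs0.ne']
      · exact (bound r hr).trans (by gcongr; exact min_le_left _ _)
    rw [ContinuousWithinAt]
    simp only [Real.zero_rpow hs0.ne', zero_div, Complex.ofReal_zero, zero_mul]
    refine squeeze_zero_norm' (a := fun r : ℝ => r ^ s / s * 2)
      (eventually_of_mem self_mem_nhdsWithin hb) ?_
    have : Continuous fun r : ℝ => r ^ s / s * 2 :=
      ((Real.continuous_rpow_const hs0.le).div_const _).mul_const _
    have h := (this.tendsto 0).mono_left (nhdsWithin_le_nhds (s := Ici 0))
    simpa [Real.zero_rpow hs0.ne'] using h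
  · intro r hr
    have hr : (0 : ℝ) < r := hr
    have hrc : (r : ℂ) ≠ 0 := by exact_mod_cast hr.ne'
    have d1 : HasDerivAt (fun r : ℝ => ((r ^ s / s : ℝ) : ℂ)) ((s * r ^ (s - 1) / s : ℝ) : ℂ) r :=
      ((Real.hasDerivAt_rpow_const (Or.inl hr.ne')).div_const s).ofReal_comp
    have d2 : HasDerivAt (fun r : ℝ => Complex.exp (-(z / r)) - 1)
        (Complex.exp (-(z / r)) * (z / (r : ℂ) ^ 2)) r := by
      have h1 : HasDerivAt (fun r : ℝ => (r : ℂ)) 1 r := (hasDerivAt_id r).ofReal_comp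
      have h2 : HasDerivAt (fun r : ℝ => -(z / (r : ℂ))) (z / (r : ℂ) ^ 2) r := by
        convert! ((hasDerivAt_const r z).div h1 hrc).neg using 1
        ring
      exact h2.cexp.sub_const 1
    convert! d1.mul d2 using 1
    have e1 : r ^ s = r ^ (s - 2) * r ^ 2 := by
      rw [← Real.rpow_natCast, ← Real.rpow_add hr]; congr 1; push_cast; ring
    rw [mul_div_cancel_left₀ _ hs0.ne', e1]
    push_cast
    field_simp
  · refine squeeze_zero_norm' (a := fun r : ℝ => ‖z‖ / s * r ^ (s - 1)) ?_ ?_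
    · filter_upwards [eventually_gt_atTop 0] with r hr
      refine (bound r hr).trans ((mul_le_mul_of_nonneg_left (min_le_right _ _)
        (by positivity)).trans_eq ?_)
      rw [Real.rpow_sub_one hr.ne']
      field_simp
    · have h := (tendsto_rpow_neg_atTop (y := 1 - s) (by linarith)).const_mul (‖z‖ / s)
      simpa using h

/-- On the imaginary axis the formula is the limit of the one at `z + 1/(n+1)`. The point `z = 0`,
where continuity of the principal power is not available, is treated by hand. -/
theorem integral_rpow_mul_exp_sub_one {s : ℝ} (hs0 : 0 < s) (hs1 : s < 1) {z : ℂ}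
    (hz : 0 ≤ z.re) :
    ∫ r in Ioi (0 : ℝ), ((r ^ (s - 1) : ℝ) : ℂ) * (Complex.exp (-(z / r)) - 1) =
      Real.Gamma (-s) * z ^ (s : ℂ) := by
  rcases eq_or_ne z 0 with rfl | h0
  · simp [hs0.ne']
  have hl := tendsto_add_inv_nat z
  have h1 : Tendsto (fun n : ℕ => ∫ r in Ioi (0 : ℝ), ((r ^ (s - 1) : ℝ) : ℂ) *
      (Complex.exp (-((z + ((1 / ((n : ℝ) + 1) : ℝ) : ℂ)) / r)) - 1)) atTop
      (𝓝 (∫ r in Ioi (0 : ℝ), ((r ^ (s - 1) : ℝ) : ℂ) * (Complex.exp (-(z / r)) - 1))) := by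
    refine tendsto_integral_of_dominated_convergence
      (fun r : ℝ => r ^ (s - 1) * min 2 ((‖z‖ + 1) / r))
      (fun n => Measurable.aestronglyMeasurable (by fun_prop))
      (integrableOn_rpow_mul_min hs0 hs1 (by positivity)) (fun n => ?_)
      (Eventually.of_forall fun r => ?_)
    · refine (ae_restrict_mem measurableSet_Ioi).mono fun r hr =>
        norm_rpow_mul_exp_sub_one_le (re_add_inv_nat_pos hz n).le hr ?_
      refine (norm_add_le _ _).trans ?_
      gcongr
      rw [Complex.norm_real, Real.norm_of_nonneg (by positivity)]
      exact div_le_one_of_le₀ (by simp) (by positivity)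
    · have hc : Continuous fun z : ℂ => ((r ^ (s - 1) : ℝ) : ℂ) *
          (Complex.exp (-(z / r)) - 1) := by fun_prop
      exact (hc.tendsto z).comp hl
  have h2 : Tendsto (fun n : ℕ => (Real.Gamma (-s) : ℂ) *
      (z + ((1 / ((n : ℝ) + 1) : ℝ) : ℂ)) ^ (s : ℂ)) atTop
      (𝓝 (Real.Gamma (-s) * z ^ (s : ℂ))) :=
    (((continuousAt_id.cpow continuousAt_const (mem_slitPlane_of_re_nonneg hz h0)).tendsto).comp
      hl).const_mul _
  refine tendsto_nhds_unique h1 (h2.congr fun n => ?_)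
  rw [integral_rpow_mul_exp_sub_one_of_pos hs0 hs1 (re_add_inv_nat_pos hz n)]

/-! ### Truncated Laplace integrals with weight `e^{-b/r} r^{s-1}` -/

/-- The weight `e^{-b/r} r^{s-1}`. -/
def lapWeight (s b r : ℝ) : ℝ := Real.exp (-(b / r)) / r ^ (1 - s)

/-- `∫₀^R e^{-b/r} r^{s-1} e^{-rz} dr`. -/
def truncLaplace (s b : ℝ) (z : ℂ) (R : ℝ) : ℂ :=
  ∫ r in Ioc 0 R, (lapWeight s b r : ℂ) * Complex.exp (-(r * z))

section TruncLaplace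

variable {s b : ℝ} {z : ℂ}

theorem measurable_lapWeight : Measurable (lapWeight s b) := by
  unfold lapWeight; fun_prop

theorem measurable_lapKer (s b : ℝ) : Measurable fun p : ℂ × ℝ =>
    (lapWeight s b p.2 : ℂ) * Complex.exp (-(p.2 * p.1)) := by
  have := measurable_lapWeight (s := s) (b := b)
  fun_prop

theorem lapWeight_nonneg {r : ℝ} (hr : 0 < r) : 0 ≤ lapWeight s b r := by
  unfold lapWeight; positivity

theorem lapWeight_le (hb : 0 ≤ b) {r : ℝ} (hr : 0 < r) : lapWeight s b r ≤ r ^ (s - 1) := by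
  rw [lapWeight, show s - 1 = -(1 - s) by ring, Real.rpow_neg hr.le, div_eq_mul_inv]
  refine mul_le_of_le_one_left (by positivity) (Real.exp_le_one_iff.2 ?_)
  exact neg_nonpos.2 (by positivity)

theorem norm_exp_neg_mul_le_one (hz : 0 ≤ z.re) {r : ℝ} (hr : 0 ≤ r) :
    ‖Complex.exp (-(r * z))‖ ≤ 1 := by
  rw [Complex.norm_exp, Real.exp_le_one_iff, Complex.neg_re, Complex.re_ofReal_mul]
  exact neg_nonpos.2 (mul_nonneg hr hz)

theorem norm_lapKer_le (hb : 0 ≤ b) (hz : 0 ≤ z.re) {r : ℝ} (hr : 0 < r) :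
    ‖(lapWeight s b r : ℂ) * Complex.exp (-(r * z))‖ ≤ r ^ (s - 1) := by
  rw [norm_mul, Complex.norm_real, Real.norm_of_nonneg (lapWeight_nonneg hr)]
  exact (mul_le_of_le_one_right (lapWeight_nonneg hr) (norm_exp_neg_mul_le_one hz hr.le)).trans
    (lapWeight_le hb hr)

theorem integrableOn_rpow_sub_one (hs0 : 0 < s) (R : ℝ) (hR : 0 ≤ R) :
    IntegrableOn (fun r : ℝ => r ^ (s - 1)) (Ioc 0 R) :=
  (intervalIntegrable_iff_integrableOn_Ioc_of_le hR).1
    (intervalIntegral.intervalIntegrable_rpow' (by linarith))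

theorem integrableOn_lapKer (hs0 : 0 < s) (hb : 0 ≤ b) (hz : 0 ≤ z.re) {R : ℝ} (hR : 0 ≤ R) :
    IntegrableOn (fun r : ℝ => (lapWeight s b r : ℂ) * Complex.exp (-(r * z))) (Ioc 0 R) := by
  refine (integrableOn_rpow_sub_one hs0 R hR).mono'
    ((measurable_lapKer s b).comp measurable_prodMk_left).aestronglyMeasurable ?_
  exact (ae_restrict_mem measurableSet_Ioc).mono fun r hr => norm_lapKer_le hb hz hr.1

theorem norm_truncLaplace_le (hs0 : 0 < s) (hb : 0 ≤ b) (hz : 0 ≤ z.re) {R : ℝ} (hR : 0 ≤ R) :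
    ‖truncLaplace s b z R‖ ≤ R ^ s / s := by
  have h : ∫ r in Ioc 0 R, r ^ (s - 1) = R ^ s / s := by
    rw [← intervalIntegral.integral_of_le hR, integral_rpow (Or.inl (by linarith))]
    simp [Real.zero_rpow hs0.ne']
  rw [← h]
  exact norm_integral_le_of_norm_le (integrableOn_rpow_sub_one hs0 R hR)
    ((ae_restrict_mem measurableSet_Ioc).mono fun r hr => norm_lapKer_le hb hz hr.1)

theorem hasDerivAt_lapWeight {r : ℝ} (hr : 0 < r) :
    HasDerivAt (lapWeight s b)
      (r ^ (s - 2) * (Real.exp (-(b / r)) * (b / r + (s - 1)))) r := by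
  have h1 : HasDerivAt (fun r : ℝ => -(b / r)) (b / r ^ 2) r := by
    convert! ((hasDerivAt_const r b).div (hasDerivAt_id r) hr.ne').neg using 1
    simp; ring
  have h2 : HasDerivAt (fun r : ℝ => r ^ (s - 1)) ((s - 1) * r ^ (s - 1 - 1)) r :=
    Real.hasDerivAt_rpow_const (Or.inl hr.ne')
  have h3 := h1.exp.mul h2
  have e : lapWeight s b =ᶠ[𝓝 r] (fun r => Real.exp (-(b / r))) * fun r => r ^ (s - 1) := by
    filter_upwards [lt_mem_nhds hr] with x hx
    rw [lapWeight, Pi.mul_apply, show s - 1 = -(1 - s) by ring, Real.rpow_neg hx.le,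
      div_eq_mul_inv]
  refine (h3.congr_of_eventuallyEq e).congr_deriv ?_
  have e1 : r ^ (s - 1) = r ^ (s - 2) * r := by
    rw [← Real.rpow_add_one hr.ne']; congr 1; ring
  rw [show s - 1 - 1 = s - 2 by ring, e1]
  field_simp

/-- Integration by parts against `e^{-rz}` gains `1/‖z‖` from oscillation even when `Re z = 0`. In
the constant, 2 accounts for the two boundary terms and `2/(1-s)` for the integral of the
differentiated weight. -/
theorem norm_integral_lapKer_le (hs0 : 0 < s) (hs1 : s < 1) (hb : 0 ≤ b) (hz : 0 ≤ z.re)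
    (h0 : z ≠ 0) {R R' : ℝ} (hR : 0 < R) (hRR : R ≤ R') :
    ‖∫ r in R..R', (lapWeight s b r : ℂ) * Complex.exp (-(r * z))‖ ≤
      (2 + 2 / (1 - s)) * (R ^ (s - 1) / ‖z‖) := by
  have hpos : ∀ r ∈ uIcc R R', 0 < r := fun r hr => by
    rw [uIcc_of_le hRR] at hr; exact hR.trans_le hr.1
  set d : ℝ → ℝ := fun r => r ^ (s - 2) * (Real.exp (-(b / r)) * (b / r + (s - 1))) with hd
  -- The factor 2 comes from `x e^{-x} ≤ 1` with `x = b/r`, together with `|s - 1| ≤ 1`; it does not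
  -- depend on `b`.
  have hdb : ∀ r : ℝ, 0 < r → |d r| ≤ 2 * r ^ (s - 2) := by
    intro r hr
    have h1 : 0 ≤ b / r := by positivity
    have h2 : Real.exp (-(b / r)) * (b / r) ≤ 1 := by
      rw [Real.exp_neg, inv_mul_le_one₀ (Real.exp_pos _)]
      linarith [Real.add_one_le_exp (b / r)]
    have h3 : Real.exp (-(b / r)) ≤ 1 := Real.exp_le_one_iff.2 (by linarith)
    have h4 := Real.exp_pos (-(b / r))
    have h5 : |Real.exp (-(b / r)) * (b / r + (s - 1))| ≤ 2 := by
      rw [abs_le]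
      constructor <;> nlinarith [mul_nonneg h4.le h1]
    rw [hd, abs_mul, abs_of_nonneg (by positivity), mul_comm]
    gcongr
  set G : ℝ → ℂ := fun r => (lapWeight s b r : ℂ) * (-(Complex.exp (-(r * z)) / z)) with hG
  have hGd : ∀ r ∈ uIcc R R', HasDerivAt G ((lapWeight s b r : ℂ) * Complex.exp (-(r * z)) +
      (d r : ℂ) * (-(Complex.exp (-(r * z)) / z))) r := by
    intro r hr
    have h1 := (hasDerivAt_lapWeight (s := s) (b := b) (hpos r hr)).ofReal_comp
    have h2 : HasDerivAt (fun r : ℝ => -((r : ℂ) * z)) (-z) r := by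
      have := ((hasDerivAt_id r).ofReal_comp.mul_const z).neg
      simpa using! this
    have h3 : HasDerivAt (fun r : ℝ => -(Complex.exp (-((r : ℂ) * z)) / z))
        (Complex.exp (-(r * z))) r := by
      convert! (h2.cexp.div_const z).neg using 1
      field_simp
    convert! h1.mul h3 using 1
    ring
  have c1 : ContinuousOn (fun r : ℝ => (lapWeight s b r : ℂ) * Complex.exp (-(r * z)))
      (uIcc R R') := by
    have : ContinuousOn (lapWeight s b) (uIcc R R') := fun r hr =>
      (hasDerivAt_lapWeight (hpos r hr)).continuousAt.continuousWithinAt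
    exact (Complex.continuous_ofReal.comp_continuousOn this).mul
      (Continuous.continuousOn (by fun_prop))
  have cd : ContinuousOn d (uIcc R R') := fun r hr => by
    have := (hpos r hr).ne'
    exact ContinuousAt.continuousWithinAt (by
      refine (Real.continuousAt_rpow_const _ _ (Or.inl this)).mul ?_
      fun_prop (disch := assumption))
  have c2 : ContinuousOn (fun r : ℝ => (d r : ℂ) * (-(Complex.exp (-(r * z)) / z)))
      (uIcc R R') :=
    (Complex.continuous_ofReal.comp_continuousOn cd).mul (Continuous.continuousOn (by fun_prop))
  have key := intervalIntegral.integral_eq_sub_of_hasDerivAt hGd (c1.add c2).intervalIntegrable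
  rw [intervalIntegral.integral_add c1.intervalIntegrable c2.intervalIntegrable] at key
  have hn : 0 < ‖z‖ := norm_pos_iff.2 h0
  have hGb : ∀ r, R ≤ r → ‖G r‖ ≤ R ^ (s - 1) / ‖z‖ := by
    intro r hr
    have hr0 := hR.trans_le hr
    have h1 := norm_lapKer_le (s := s) hb hz hr0
    have h2 : r ^ (s - 1) ≤ R ^ (s - 1) := Real.rpow_le_rpow_of_nonpos hR hr (by linarith)
    rw [hG]
    simp only
    rw [mul_neg, norm_neg, ← mul_div_assoc, norm_div]
    gcongr
    exact h1.trans h2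
  have hI : ‖∫ r in R..R', (d r : ℂ) * (-(Complex.exp (-(r * z)) / z))‖ ≤
      2 / (1 - s) * (R ^ (s - 1) / ‖z‖) := by
    have hi : IntervalIntegrable (fun r : ℝ => 2 / ‖z‖ * r ^ (s - 2)) volume R R' :=
      (intervalIntegral.intervalIntegrable_rpow (Or.inr (fun h => by
        have := hpos 0 h; exact lt_irrefl _ this))).const_mul _
    refine (intervalIntegral.norm_integral_le_of_norm_le hRR (Eventually.of_forall
      fun r hr => ?_) hi).trans ?_
    · have hr0 : 0 < r := hR.trans hr.1
      rw [norm_mul, norm_neg, norm_div, Complex.norm_real, Real.norm_eq_abs]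
      have h1 := norm_exp_neg_mul_le_one hz hr0.le
      calc |d r| * (‖Complex.exp (-(r * z))‖ / ‖z‖) ≤ 2 * r ^ (s - 2) * (1 / ‖z‖) := by
            gcongr; exact hdb r hr0
        _ = _ := by ring
    · rw [intervalIntegral.integral_const_mul, integral_rpow (Or.inr ⟨by linarith, fun h => by
        have := hpos 0 h; exact lt_irrefl _ this⟩)]
      have h1 : 0 ≤ R' ^ (s - 1) := by have := hR.trans_le hRR; positivity
      have h2 : 0 < 1 - s := by linarith
      rw [show s - 2 + 1 = -(1 - s) by ring, div_neg, ← neg_div, neg_sub,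
        show -(1 - s) = s - 1 by ring]
      calc 2 / ‖z‖ * ((R ^ (s - 1) - R' ^ (s - 1)) / (1 - s))
          ≤ 2 / ‖z‖ * (R ^ (s - 1) / (1 - s)) := by gcongr; linarith
        _ = _ := by field_simp
  have e : ∫ r in R..R', (lapWeight s b r : ℂ) * Complex.exp (-(r * z)) =
      G R' - G R - ∫ r in R..R', (d r : ℂ) * (-(Complex.exp (-(r * z)) / z)) := by
    rw [← key]; ring
  rw [e]
  have g1 := hGb R le_rfl
  have g2 := hGb R' hRR
  have := norm_sub_le (G R' - G R) (∫ r in R..R', (d r : ℂ) * (-(Complex.exp (-(r * z)) / z)))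
  have := norm_sub_le (G R') (G R)
  linarith

theorem truncLaplace_sub (hs0 : 0 < s) (hb : 0 ≤ b) (hz : 0 ≤ z.re) {R R' : ℝ} (hR : 0 ≤ R)
    (hRR : R ≤ R') : truncLaplace s b z R' - truncLaplace s b z R =
      ∫ r in R..R', (lapWeight s b r : ℂ) * Complex.exp (-(r * z)) := by
  rw [truncLaplace, truncLaplace, ← intervalIntegral.integral_of_le hR,
    ← intervalIntegral.integral_of_le (hR.trans hRR), intervalIntegral.integral_interval_sub_left]
  · exact (intervalIntegrable_iff_integrableOn_Ioc_of_le (hR.trans hRR)).2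
      (integrableOn_lapKer hs0 hb hz (hR.trans hRR))
  · exact (intervalIntegrable_iff_integrableOn_Ioc_of_le hR).2 (integrableOn_lapKer hs0 hb hz hR)

/-- The integral is split at `r = 1/‖z‖`: absolute values before, oscillation after. Both parts
scale like `‖z‖^{-s}`, so the bound depends neither on `R` nor on `z` nor on `b`, and a constant can
dominate the weak limit. -/
theorem norm_cpow_mul_truncLaplace_le (hs0 : 0 < s) (hs1 : s < 1) (hb : 0 ≤ b) (hz : 0 ≤ z.re)
    {R : ℝ} (hR : 0 ≤ R) :
    ‖z ^ (s : ℂ) * truncLaplace s b z R‖ ≤ 1 / s + (2 + 2 / (1 - s)) := by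
  have hc : 0 ≤ 2 + 2 / (1 - s) := by
    have : 0 < 1 - s := by linarith
    positivity
  rcases eq_or_ne z 0 with rfl | h0
  · rw [Complex.zero_cpow (by exact_mod_cast hs0.ne'), zero_mul, norm_zero]
    positivity
  have hn : 0 < ‖z‖ := norm_pos_iff.2 h0
  have e1 : ‖z‖ ^ s * ((‖z‖⁻¹) ^ s / s) = 1 / s := by
    rw [Real.inv_rpow hn.le]; field_simp
  rw [norm_mul, Complex.norm_cpow_real]
  rcases le_total R ‖z‖⁻¹ with h | h
  · calc ‖z‖ ^ s * ‖truncLaplace s b z R‖ ≤ ‖z‖ ^ s * (‖z‖⁻¹ ^ s / s) := by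
          gcongr
          exact (norm_truncLaplace_le hs0 hb hz hR).trans (by gcongr)
      _ = 1 / s := e1
      _ ≤ _ := by linarith
  · have h1 := norm_integral_lapKer_le hs0 hs1 hb hz h0 (inv_pos.2 hn) h
    rw [← truncLaplace_sub hs0 hb hz (by positivity) h] at h1
    have h2 := norm_truncLaplace_le hs0 hb hz (inv_pos.2 hn).le
    have h3 : ‖truncLaplace s b z R‖ ≤ ‖z‖⁻¹ ^ s / s +
        (2 + 2 / (1 - s)) * (‖z‖⁻¹ ^ (s - 1) / ‖z‖) := by
      have := norm_add_le (truncLaplace s b z ‖z‖⁻¹)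
        (truncLaplace s b z R - truncLaplace s b z ‖z‖⁻¹)
      rw [add_sub_cancel] at this
      linarith
    have e2 : ‖z‖ ^ s * (‖z‖⁻¹ ^ (s - 1) / ‖z‖) = 1 := by
      rw [Real.inv_rpow hn.le, Real.rpow_sub_one hn.ne']; field_simp
    calc ‖z‖ ^ s * ‖truncLaplace s b z R‖ ≤ ‖z‖ ^ s * (‖z‖⁻¹ ^ s / s +
          (2 + 2 / (1 - s)) * (‖z‖⁻¹ ^ (s - 1) / ‖z‖)) := by gcongr
      _ = ‖z‖ ^ s * (‖z‖⁻¹ ^ s / s) + (2 + 2 / (1 - s)) *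
          (‖z‖ ^ s * (‖z‖⁻¹ ^ (s - 1) / ‖z‖)) := by ring
      _ = _ := by rw [e1, e2, mul_one]

theorem integrableOn_rpow_mul_exp (hs0 : 0 < s) {δ : ℝ} (hδ : 0 < δ) :
    IntegrableOn (fun r : ℝ => r ^ (s - 1) * Real.exp (-(δ * r))) (Ioi 0) := by
  have := integrableOn_rpow_mul_exp_neg_mul_rpow (s := s - 1) (p := 1) (by linarith) one_pos hδ
  simpa using this

theorem integrableOn_lapWeight_mul_exp (hs0 : 0 < s) (hb : 0 ≤ b) {δ : ℝ} (hδ : 0 < δ) :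
    IntegrableOn (fun r : ℝ => lapWeight s b r * Real.exp (-(δ * r))) (Ioi 0) := by
  have := measurable_lapWeight (s := s) (b := b)
  refine (integrableOn_rpow_mul_exp hs0 hδ).mono' (Measurable.aestronglyMeasurable (by fun_prop)) ?_
  refine (ae_restrict_mem measurableSet_Ioi).mono fun r hr => ?_
  have hr : (0 : ℝ) < r := hr
  rw [Real.norm_of_nonneg (mul_nonneg (lapWeight_nonneg hr) (Real.exp_pos _).le)]
  gcongr
  exact lapWeight_le hb hr

/-- For `z = x > 0` this is the substitution `r ↦ x r`; both sides are holomorphic in the open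
half-plane. -/
theorem cpow_mul_integral_lapKer (hs0 : 0 < s) (hb : 0 ≤ b) (hz : 0 < z.re) :
    z ^ (s : ℂ) * ∫ r in Ioi (0 : ℝ), (lapWeight s b r : ℂ) * Complex.exp (-(r * z)) =
      besselInt s (b * z) := by
  have d1 := differentiableOn_laplace (μ := volume.restrict (Ioi (0 : ℝ)))
    (φ := lapWeight s b) (q := fun r => r) measurable_lapWeight measurable_id
    ((ae_restrict_mem measurableSet_Ioi).mono fun r hr => le_of_lt hr)
    (fun δ hδ => integrableOn_lapWeight_mul_exp hs0 hb hδ)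
  have d2 := differentiableOn_laplace (μ := volume.restrict (Ioi (0 : ℝ)))
    (φ := fun r => Real.exp (-r) * r ^ (s - 1)) (q := fun r => b / r) (by fun_prop) (by fun_prop)
    ((ae_restrict_mem measurableSet_Ioi).mono fun r hr => div_nonneg hb (le_of_lt hr))
    (fun δ hδ => by
      refine (Real.GammaIntegral_convergent hs0).mono'
        (Measurable.aestronglyMeasurable (by fun_prop)) ?_
      refine (ae_restrict_mem measurableSet_Ioi).mono fun r hr => ?_
      have hr : (0 : ℝ) < r := hr
      rw [Real.norm_of_nonneg (by positivity)]
      exact mul_le_of_le_one_right (by positivity)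
        (Real.exp_le_one_iff.2 (neg_nonpos.2 (by positivity))))
  have e1 : ∀ z : ℂ, ∫ r in Ioi (0 : ℝ), (lapWeight s b r : ℂ) * Complex.exp (-(r * z)) =
      ∫ r in Ioi (0 : ℝ), (lapWeight s b r : ℂ) * Complex.exp (-(z * r)) := fun z => by
    simp only [mul_comm]
  have e2 : ∀ z : ℂ, besselInt s (b * z) = ∫ r in Ioi (0 : ℝ),
      ((Real.exp (-r) * r ^ (s - 1) : ℝ) : ℂ) * Complex.exp (-(z * (b / r : ℝ))) := fun z => by
    simp only [besselInt, besselKer]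
    congr 1
    ext r
    push_cast
    ring_nf
  rw [e1, e2]
  refine eq_of_eq_ofReal ((differentiableOn_cpow_const (s : ℂ)).mul d1) d2 (fun x hx => ?_) hz
  have h := integral_comp_mul_left_Ioi (fun r : ℝ =>
    ((Real.exp (-r) * r ^ (s - 1) : ℝ) : ℂ) * Complex.exp (-(x * (b / r : ℝ)))) 0 hx
  rw [mul_zero, eq_inv_smul_iff₀ hx.ne'] at h
  rw [← h, Complex.real_smul, ← integral_const_mul, Pi.mul_apply, ← integral_const_mul]
  refine setIntegral_congr_fun measurableSet_Ioi fun r hr => ?_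
  have hr : (0 : ℝ) < r := hr
  have hxc : (x : ℂ) ≠ 0 := by exact_mod_cast hx.ne'
  have hrc : (r : ℂ) ≠ 0 := by exact_mod_cast hr.ne'
  have e3 : x * (Real.exp (-(x * r)) * (x * r) ^ (s - 1)) =
      x ^ s * Real.exp (-(x * r)) / r ^ (1 - s) := by
    rw [Real.mul_rpow hx.le hr.le, Real.rpow_sub_one hx.ne', show s - 1 = -(1 - s) by ring,
      Real.rpow_neg hr.le]
    field_simp
  have e4 : (x : ℂ) * ((b / (x * r) : ℝ) : ℂ) = ((b / r : ℝ) : ℂ) := by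
    push_cast; field_simp
  have e5 : (x : ℂ) * ((Real.exp (-(x * r)) * (x * r) ^ (s - 1) : ℝ) : ℂ) =
      ((x ^ s * Real.exp (-(x * r)) / r ^ (1 - s) : ℝ) : ℂ) := by
    rw [← Complex.ofReal_mul, e3]
  simp only [e4]
  rw [← mul_assoc (x : ℂ), e5, lapWeight, ← Complex.ofReal_cpow hx.le]
  push_cast
  ring

theorem tendsto_truncLaplace (hs0 : 0 < s) (hb : 0 ≤ b) (hz : 0 < z.re) :
    Tendsto (truncLaplace s b z) atTop
      (𝓝 (∫ r in Ioi (0 : ℝ), (lapWeight s b r : ℂ) * Complex.exp (-(r * z)))) := by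
  have hi : IntegrableOn (fun r : ℝ => (lapWeight s b r : ℂ) * Complex.exp (-(r * z))) (Ioi 0) := by
    refine (integrableOn_lapWeight_mul_exp hs0 hb hz).mono'
      ((measurable_lapKer s b).comp measurable_prodMk_left).aestronglyMeasurable ?_
    refine (ae_restrict_mem measurableSet_Ioi).mono fun r hr => ?_
    rw [norm_mul, Complex.norm_real, Real.norm_of_nonneg (lapWeight_nonneg hr), Complex.norm_exp,
      Complex.neg_re, Complex.re_ofReal_mul, mul_comm r]
  refine (intervalIntegral_tendsto_integral_Ioi 0 hi tendsto_id).congr' ?_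
  filter_upwards [eventually_ge_atTop 0] with R hR
  rw [truncLaplace, id, intervalIntegral.integral_of_le hR]

/-- In the open half-plane this is the oscillation bound with upper limit tending to infinity. The
full Laplace integral need not converge absolutely on the axis, but the truncated one and
`besselInt` are continuous up to it, so the estimate, free of `Re z`, passes to the boundary. -/
theorem norm_besselInt_sub_truncLaplace_le (hs0 : 0 < s) (hs1 : s < 1) (hb : 0 ≤ b)
    (hz : 0 ≤ z.re) (h0 : z ≠ 0) {R : ℝ} (hR : 0 < R) :
    ‖besselInt s (b * z) - z ^ (s : ℂ) * truncLaplace s b z R‖ ≤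
      ‖z‖ ^ s * ((2 + 2 / (1 - s)) * (R ^ (s - 1) / ‖z‖)) := by
  have pos : ∀ z : ℂ, 0 < z.re → ‖besselInt s (b * z) - z ^ (s : ℂ) * truncLaplace s b z R‖ ≤
      ‖z‖ ^ s * ((2 + 2 / (1 - s)) * (R ^ (s - 1) / ‖z‖)) := by
    intro z hz
    have h0 : z ≠ 0 := by rintro rfl; simp at hz
    rw [← cpow_mul_integral_lapKer hs0 hb hz, ← mul_sub, norm_mul, Complex.norm_cpow_real]
    gcongr
    refine le_of_tendsto ((tendsto_truncLaplace hs0 hb hz).sub_const _).norm ?_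
    filter_upwards [eventually_ge_atTop R] with R' hR'
    rw [truncLaplace_sub hs0 hb hz.le hR.le hR']
    exact norm_integral_lapKer_le hs0 hs1 hb hz.le h0 hR hR'
  have hl := tendsto_add_inv_nat z
  have hn : ‖z‖ ≠ 0 := by simpa using h0
  have c1 : Tendsto (fun n : ℕ => besselInt s (b * (z + ((1 / ((n : ℝ) + 1) : ℝ) : ℂ)))) atTop
      (𝓝 (besselInt s (b * z))) := by
    refine (continuousWithinAt_besselInt hs0 (b * z)).tendsto.comp ?_
    refine tendsto_nhdsWithin_iff.2 ⟨hl.const_mul _, Eventually.of_forall fun n => ?_⟩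
    rw [mem_ofPred_eq, Complex.re_ofReal_mul]
    exact mul_nonneg hb (re_add_inv_nat_pos hz n).le
  have c2 : Tendsto (fun n : ℕ => (z + ((1 / ((n : ℝ) + 1) : ℝ) : ℂ)) ^ (s : ℂ)) atTop
      (𝓝 (z ^ (s : ℂ))) :=
    ((continuousAt_id.cpow continuousAt_const (mem_slitPlane_of_re_nonneg hz h0)).tendsto).comp hl
  have c3 : Tendsto (fun n : ℕ => truncLaplace s b (z + ((1 / ((n : ℝ) + 1) : ℝ) : ℂ)) R) atTop
      (𝓝 (truncLaplace s b z R)) := by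
    refine tendsto_integral_of_dominated_convergence (fun r : ℝ => r ^ (s - 1))
      (fun n => ((measurable_lapKer s b).comp measurable_prodMk_left).aestronglyMeasurable)
      (integrableOn_rpow_sub_one hs0 R hR.le) (fun n => ?_) (Eventually.of_forall fun r => ?_)
    · exact (ae_restrict_mem measurableSet_Ioc).mono fun r hr =>
        norm_lapKer_le hb (re_add_inv_nat_pos hz n).le hr.1
    · have hc : Continuous fun z : ℂ => (lapWeight s b r : ℂ) * Complex.exp (-(r * z)) := by
        fun_prop
      exact (hc.tendsto z).comp hl
  have c4 := (hl.norm.rpow_const (p := s) (Or.inl hn)).mul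
    (((tendsto_const_nhds (x := R ^ (s - 1))).div hl.norm hn).const_mul (2 + 2 / (1 - s)))
  exact le_of_tendsto_of_tendsto' (c1.sub (c2.mul c3)).norm c4
    fun n => pos _ (re_add_inv_nat_pos hz n)

theorem tendsto_cpow_mul_truncLaplace (hs0 : 0 < s) (hs1 : s < 1) (hb : 0 ≤ b)
    (hz : 0 ≤ z.re) (h0 : z ≠ 0) :
    Tendsto (fun R => z ^ (s : ℂ) * truncLaplace s b z R) atTop (𝓝 (besselInt s (b * z))) := by
  rw [tendsto_iff_norm_sub_tendsto_zero]
  refine squeeze_zero' (g := fun R : ℝ => ‖z‖ ^ s * ((2 + 2 / (1 - s)) * (R ^ (s - 1) / ‖z‖)))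
    (Eventually.of_forall fun _ => norm_nonneg _) ?_ ?_
  · filter_upwards [eventually_gt_atTop 0] with R hR
    rw [norm_sub_rev]
    exact norm_besselInt_sub_truncLaplace_le hs0 hs1 hb hz h0 hR
  · have h := (((tendsto_rpow_neg_atTop (y := 1 - s) (by linarith)).div_const ‖z‖).const_mul
      (2 + 2 / (1 - s))).const_mul (‖z‖ ^ s)
    simpa using h

end TruncLaplace

/-! ### The weighted energy of the Bessel-type integral -/

/-- The substitution `t = ‖z‖^{1/2} y` turns the integral into `‖z‖^s` times a universal one. That
one converges because the Bessel integral is bounded near `0`, where `1 - 2s > -1`, and decays like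
`t^{-2}` at infinity. -/
theorem exists_lintegral_besselInt_le {s : ℝ} (hs0 : 0 < s) (hs1 : s < 1) :
    ∃ C : ℝ, ∀ z : ℂ, 0 ≤ z.re →
      ∫⁻ y in Ioi (0 : ℝ), ENNReal.ofReal (y ^ (1 - 2 * s)) *
        ENNReal.ofReal (‖z‖ * ‖besselInt s ((y ^ 2 / 4 : ℝ) * z)‖ ^ 2) ≤
      ENNReal.ofReal (C * ‖z‖ ^ s) := by
  set A := Real.Gamma s with hA
  set B := 8 * Real.Gamma (s + 2) with hB
  have hA0 : 0 < A := Real.Gamma_pos_of_pos hs0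
  have hB0 : 0 < B := mul_pos (by norm_num) (Real.Gamma_pos_of_pos (by linarith))
  set h : ℝ → ℝ := fun t => (min A (B / t ^ 2)) ^ 2 with hh
  set g : ℝ → ℝ := fun t => t ^ (1 - 2 * s) * h t with hg
  have hgm : Measurable g := by fun_prop
  have hmin : ∀ t : ℝ, 0 < t → 0 ≤ min A (B / t ^ 2) := fun t ht => le_min hA0.le (by positivity)
  have hg0 : ∀ t : ℝ, 0 < t → 0 ≤ g t := fun t ht => by
    have := hmin t ht; positivity
  have hgi : IntegrableOn g (Ioi 0) := by
    rw [← Ioc_union_Ioi_eq_Ioi zero_le_one]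
    refine IntegrableOn.union ?_ ?_
    · have i1 : IntegrableOn (fun r : ℝ => r ^ (1 - 2 * s) * A ^ 2) (Ioc 0 1) :=
        ((intervalIntegrable_iff_integrableOn_Ioc_of_le zero_le_one).1
          (intervalIntegral.intervalIntegrable_rpow' (by linarith))).mul_const _
      refine i1.mono' hgm.aestronglyMeasurable ?_
      refine (ae_restrict_mem measurableSet_Ioc).mono fun t ht => ?_
      rw [Real.norm_of_nonneg (hg0 t ht.1)]
      have ht0 : 0 < t := ht.1
      have := hmin t ht.1
      simp only [hg, hh]
      gcongr
      exact min_le_left _ _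
    · have i1 : IntegrableOn (fun r : ℝ => A * B * r ^ (-1 - 2 * s)) (Ioi 1) :=
        (integrableOn_Ioi_rpow_of_lt (by linarith) one_pos).const_mul _
      refine i1.mono' hgm.aestronglyMeasurable ?_
      refine (ae_restrict_mem measurableSet_Ioi).mono fun t ht => ?_
      have ht0 : (0 : ℝ) < t := one_pos.trans ht
      rw [Real.norm_of_nonneg (hg0 t ht0)]
      have h1 := hmin t ht0
      have e : t ^ (1 - 2 * s) = t ^ (-1 - 2 * s) * t ^ 2 := by
        rw [← Real.rpow_natCast, ← Real.rpow_add ht0]; congr 1; push_cast; ring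
      -- Decay of one of the two factors suffices: it leaves `t^{-1-2s}`, integrable at infinity.
      have h2 : h t ≤ A * (B / t ^ 2) := by
        simp only [hh]
        rw [pow_two]
        gcongr
        · exact min_le_left _ _
        · exact min_le_right _ _
      calc g t ≤ t ^ (1 - 2 * s) * (A * (B / t ^ 2)) := by simp only [hg]; gcongr
        _ = _ := by rw [e]; field_simp
  refine ⟨∫ t in Ioi (0 : ℝ), g t, fun z hz => ?_⟩
  rcases eq_or_ne z 0 with rfl | h0
  · simp
  have hn : 0 < ‖z‖ := norm_pos_iff.2 h0
  set c := ‖z‖ ^ (1 / 2 : ℝ) with hc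
  have hc0 : 0 < c := by positivity
  have hc2 : c ^ 2 = ‖z‖ := by
    rw [hc, ← Real.rpow_natCast, ← Real.rpow_mul hn.le]; norm_num
  have hcp : ‖z‖ ^ s = c ^ (2 * s) := by
    rw [hc, ← Real.rpow_mul hn.le]; congr 1; ring
  have hb : ∀ y : ℝ, 0 < y → ‖besselInt s ((y ^ 2 / 4 : ℝ) * z)‖ ≤ min A (B / (c * y) ^ 2) := by
    intro y hy
    have hre : 0 ≤ (((y ^ 2 / 4 : ℝ) : ℂ) * z).re := by
      rw [Complex.re_ofReal_mul]; positivity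
    refine le_min (norm_besselInt_le hs0 hre) ?_
    have h1 := norm_mul_besselInt_le hs0 hre
    rw [norm_mul, norm_mul, Complex.norm_real, Real.norm_of_nonneg (by positivity)] at h1
    rw [le_div_iff₀ (by positivity), mul_pow, hc2]
    simp only [hB]
    linarith
  have hgc : ∀ y : ℝ, 0 < y → y ^ (1 - 2 * s) * (‖z‖ * h (c * y)) =
      c ^ (2 * s) * (c * g (c * y)) := by
    intro y hy
    simp only [hg]
    rw [Real.mul_rpow hc0.le hy.le, Real.rpow_sub hc0, Real.rpow_one, ← hc2]
    field_simp
  calc ∫⁻ y in Ioi (0 : ℝ), ENNReal.ofReal (y ^ (1 - 2 * s)) *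
        ENNReal.ofReal (‖z‖ * ‖besselInt s ((y ^ 2 / 4 : ℝ) * z)‖ ^ 2)
      ≤ ∫⁻ y in Ioi (0 : ℝ), ENNReal.ofReal (c ^ (2 * s) * (c * g (c * y))) := by
        refine setLIntegral_mono' measurableSet_Ioi fun y hy => ?_
        have hy : (0 : ℝ) < y := hy
        rw [← ENNReal.ofReal_mul (by positivity), ← hgc y hy]
        refine ENNReal.ofReal_le_ofReal ?_
        simp only [hh]
        gcongr
        exact hb y hy
    _ = ENNReal.ofReal (∫ y in Ioi (0 : ℝ), c ^ (2 * s) * (c * g (c * y))) := by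
        rw [ofReal_integral_eq_lintegral_ofReal]
        · refine Integrable.const_mul (Integrable.const_mul ?_ _) _
          have := (integrableOn_Ioi_comp_mul_left_iff g 0 hc0).2 (by simpa using hgi)
          exact this
        · refine (ae_restrict_mem measurableSet_Ioi).mono fun y hy => ?_
          have hy : (0 : ℝ) < y := hy
          have := hg0 (c * y) (mul_pos hc0 hy)
          simp only [Pi.zero_apply]
          positivity
    _ = _ := by
        rw [integral_const_mul, integral_const_mul, integral_comp_mul_left_Ioi g 0 hc0, mul_zero,
          smul_eq_mul, mul_inv_cancel_left₀ hc0.ne', hcp, mul_comm]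

/-! ### Multipliers depending on a parameter -/

namespace ProjMeasure

variable {S Y : Type*} [MeasurableSpace S] [NormedAddCommGroup Y] [InnerProductSpace ℂ Y]
  [CompleteSpace Y] (P : ProjMeasure S Y)

theorem op_sub {f g : S → ℂ} (hf : BddMeas f) (hg : BddMeas g) :
    P.op (fun x => f x - g x) = P.op f - P.op g := by
  have h := P.op_add hf ((BddMeas.const (-1)).mul hg)
  rw [P.op_const_mul hg] at h
  simpa [sub_eq_add_neg] using h

/-- The squared norm of the difference is `∫ |F_i - f|² dμ_u`, so bounded convergence almost
everywhere gives strong convergence, not merely weak. -/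
theorem tendsto_op {ι : Type*} {l : Filter ι} [l.IsCountablyGenerated] {F : ι → S → ℂ} {f : S → ℂ}
    {C : ℝ} (hm : ∀ᶠ i in l, Measurable (F i)) (hb : ∀ᶠ i in l, ∀ x, ‖F i x‖ ≤ C)
    (hf : Measurable f) (hfb : ∀ x, ‖f x‖ ≤ C) (u : Y)
    (hl : ∀ᵐ x ∂P.measure u, Tendsto (fun i => F i x) l (𝓝 (f x))) :
    Tendsto (fun i => P.op (F i) u) l (𝓝 (P.op f u)) := by
  rw [tendsto_iff_norm_sub_tendsto_zero]
  have hF : BddMeas f := ⟨hf, C, hfb⟩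
  have h : Tendsto (fun i => ∫ x, ‖F i x - f x‖ ^ 2 ∂P.measure u) l
      (𝓝 (∫ _, (0 : ℝ) ∂P.measure u)) := by
    refine tendsto_integral_filter_of_dominated_convergence (fun _ => (C + C) ^ 2)
      (hm.mono fun i hi => ((hi.sub hf).norm.pow_const 2).aestronglyMeasurable)
      (hb.mono fun i hi => Eventually.of_forall fun x => ?_) (integrable_const _)
      (hl.mono fun x hx => ?_)
    · rw [norm_pow, norm_norm]
      exact pow_le_pow_left₀ (norm_nonneg _)
        ((norm_sub_le _ _).trans (add_le_add (hi x) (hfb x))) 2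
    · simpa using ((hx.sub_const (f x)).norm.pow 2)
  rw [integral_zero] at h
  have h2 := h.sqrt
  rw [Real.sqrt_zero] at h2
  refine h2.congr' ?_
  filter_upwards [hm, hb] with i hi hbi
  have hFi : BddMeas (F i) := ⟨hi, C, hbi⟩
  rw [← sub_apply, ← P.op_sub hFi hF, ← P.norm_op_sq, Real.sqrt_sq (norm_nonneg _)]
  simpa [sub_eq_add_neg] using hFi.add ((BddMeas.const (-1)).mul hF)

variable {A : Type*} [MeasurableSpace A] {μ : Measure A} {F : A → S → ℂ} {φ : A → ℝ} {u : Y}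

theorem integrable_smul_op (hφ : Integrable φ μ) (hF : Measurable (Function.uncurry F))
    (hb : ∀ᵐ r ∂μ, ∀ x, ‖F r x‖ ≤ 1) (hm : AEStronglyMeasurable (fun r => P.op (F r) u) μ) :
    Integrable (fun r => φ r • P.op (F r) u) μ := by
  refine (hφ.norm.mul_const ‖u‖).mono' (hφ.aestronglyMeasurable.smul hm) ?_
  filter_upwards [hb] with r hr
  rw [norm_smul]
  gcongr
  have hFm : Measurable (F r) := hF.comp measurable_prodMk_left
  simpa using P.norm_op_le hFm zero_le_one hr u

/-- Fubini applied to matrix coefficients: an integral of operators has the integrated symbol. -/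
theorem integral_smul_op [SFinite μ] (hφ : Integrable φ μ) (hF : Measurable (Function.uncurry F))
    (hb : ∀ᵐ r ∂μ, ∀ x, ‖F r x‖ ≤ 1) (hm : AEStronglyMeasurable (fun r => P.op (F r) u) μ) :
    ∫ r, φ r • P.op (F r) u ∂μ = P.op (fun x => ∫ r, (φ r : ℂ) * F r x ∂μ) u := by
  have hFm : ∀ r, Measurable (F r) := fun r => hF.comp measurable_prodMk_left
  have hφ' := hφ.ofReal (𝕜 := ℂ)
  have hint : ∀ w, Integrable (Function.uncurry fun r x => (φ r : ℂ) * F r x)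
      (μ.prod (P.measure w)) := by
    intro w
    have h1 : Integrable (fun p : A × S => (φ p.1 : ℂ)) (μ.prod (P.measure w)) := hφ'.comp_fst _
    refine h1.mul_bdd (c := 1) hF.aestronglyMeasurable ?_
    have := (Measure.quasiMeasurePreserving_fst (μ := μ) (ν := P.measure w)).ae hb
    exact this.mono fun p hp => hp p.2
  have hbdd : BddMeas fun x => ∫ r, (φ r : ℂ) * F r x ∂μ := by
    -- The weight is only almost everywhere measurable; a measurable representative makes the
    -- integrated symbol measurable in `x` without changing it.
    obtain ⟨φ', hφm, hφe⟩ := hφ'.aestronglyMeasurable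
    have e : (fun x => ∫ r, (φ r : ℂ) * F r x ∂μ) = fun x => ∫ r, φ' r * F r x ∂μ := by
      ext x
      exact integral_congr_ae (hφe.mono fun r hr => congrArg (· * F r x) hr)
    refine ⟨?_, ∫ r, ‖φ r‖ ∂μ, fun x => ?_⟩
    · rw [e]
      have hjm : StronglyMeasurable fun p : S × A => φ' p.2 * F p.2 p.1 :=
        (hφm.comp_measurable measurable_snd).mul
          (hF.comp measurable_swap).stronglyMeasurable
      exact hjm.integral_prod_right'.measurable
    · refine norm_integral_le_of_norm_le hφ.norm (hb.mono fun r hr => ?_)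
      rw [norm_mul, Complex.norm_real]
      exact mul_le_of_le_one_right (norm_nonneg _) (hr x)
  refine ext_inner_left ℂ fun v => ?_
  have h1 := (innerSL ℂ v).integral_comp_comm (P.integrable_smul_op hφ hF hb hm)
  simp only [innerSL_apply_apply] at h1
  rw [← h1, P.inner_op hbdd, ← integral_pairing fun w _ => hint w]
  refine integral_congr_ae (hb.mono fun r hr => ?_)
  simp only
  rw [pairing_const_mul, ← P.inner_op ⟨hFm r, 1, hr⟩, ← Complex.coe_smul, inner_smul_right]

/-! ### The semigroup generated by a symbol -/

/-- The operator `e^{-τ z}` for a symbol `z`. -/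
def expOp (z : S → ℂ) (τ : ℝ) : Y →L[ℂ] Y := P.op fun x => Complex.exp (-(τ * z x))

variable {z : S → ℂ}

theorem bddMeas_exp (hzm : Measurable z) (hz : ∀ x, 0 ≤ (z x).re)
    {τ : ℝ} (hτ : 0 ≤ τ) : BddMeas fun x => Complex.exp (-(τ * z x)) :=
  ⟨by fun_prop, 1, fun x => norm_exp_neg_mul_le_one (hz x) hτ⟩

theorem continuousOn_expOp (hzm : Measurable z) (hz : ∀ x, 0 ≤ (z x).re)
    (u : Y) : ContinuousOn (fun τ => P.expOp z τ u) (Ici 0) := by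
  intro τ hτ
  rw [ContinuousWithinAt]
  refine P.tendsto_op (l := 𝓝[Ici 0] τ) (F := fun (τ : ℝ) x => Complex.exp (-(τ * z x)))
    (f := fun x => Complex.exp (-(τ * z x))) (C := 1) (Eventually.of_forall fun τ => by fun_prop)
    (eventually_of_mem self_mem_nhdsWithin fun σ hσ x => norm_exp_neg_mul_le_one (hz x) hσ)
    (by fun_prop) (fun x => norm_exp_neg_mul_le_one (hz x) hτ) u
    (Eventually.of_forall fun x => ?_)
  have : Continuous fun τ : ℝ => Complex.exp (-(τ * z x)) := by fun_prop
  exact (this.tendsto τ).mono_left nhdsWithin_le_nhds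

theorem bddMeas_besselInt (hzm : Measurable z) (hz : ∀ x, 0 ≤ (z x).re)
    {a : ℝ} (ha : 0 < a) {b : ℝ} (hb : 0 ≤ b) :
    BddMeas fun x => besselInt a (b * z x) :=
  ⟨(measurable_besselInt a).comp (by fun_prop), Real.Gamma a, fun x =>
    norm_besselInt_le ha (by rw [Complex.re_ofReal_mul]; exact mul_nonneg hb (hz x))⟩

/-- The operator obtained from the symbol `y²z/4` through `besselInt a`. -/
def besselOp (z : S → ℂ) (a y : ℝ) : Y →L[ℂ] Y :=
  P.op fun x => besselInt a ((y ^ 2 / 4 : ℝ) * z x)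

theorem besselOp_zero {a : ℝ} (ha : 0 < a) (u : Y) :
    P.besselOp z a 0 u = (Real.Gamma a : ℂ) • u := by
  simp [besselOp, besselInt_zero ha, P.op_const]

theorem continuous_besselOp (hzm : Measurable z) (hz : ∀ x, 0 ≤ (z x).re)
    {a : ℝ} (ha : 0 < a) (u : Y) :
    Continuous fun y => P.besselOp z a y u := by
  rw [continuous_iff_continuousAt]
  intro y
  have hre : ∀ (y : ℝ) (x : S), 0 ≤ (((y ^ 2 / 4 : ℝ) : ℂ) * z x).re := fun y x => by
    rw [Complex.re_ofReal_mul]; exact mul_nonneg (by positivity) (hz x)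
  refine P.tendsto_op (F := fun (y : ℝ) x => besselInt a ((y ^ 2 / 4 : ℝ) * z x))
    (f := fun x => besselInt a ((y ^ 2 / 4 : ℝ) * z x)) (C := Real.Gamma a) (Eventually.of_forall fun y =>
    (bddMeas_besselInt hzm hz ha (by positivity)).measurable)
    (Eventually.of_forall fun y x => norm_besselInt_le ha (hre y x))
    (bddMeas_besselInt hzm hz ha (by positivity)).measurable
    (fun x => norm_besselInt_le ha (hre y x)) u (Eventually.of_forall fun x => ?_)
  refine (continuousWithinAt_besselInt ha _).tendsto.comp ?_
  refine tendsto_nhdsWithin_iff.2 ⟨?_, Eventually.of_forall fun y => hre y x⟩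
  have : Continuous fun y : ℝ => ((y ^ 2 / 4 : ℝ) : ℂ) * z x := by fun_prop
  exact this.tendsto y

/-- Subordination formula with the Gamma density. -/
theorem integral_gamma_expOp (hzm : Measurable z) (hz : ∀ x, 0 ≤ (z x).re)
    {a : ℝ} (ha : 0 < a) {y : ℝ} (u : Y) :
    IntegrableOn (fun r : ℝ => (Real.exp (-r) / r ^ (1 - a)) • P.expOp z (y ^ 2 / (4 * r)) u)
        (Ioi 0) ∧
      ∫ r in Ioi (0 : ℝ), (Real.exp (-r) / r ^ (1 - a)) • P.expOp z (y ^ 2 / (4 * r)) u =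
        P.besselOp z a y u := by
  have hw : ∀ r ∈ Ioi (0 : ℝ), Real.exp (-r) * r ^ (a - 1) = Real.exp (-r) / r ^ (1 - a) := by
    intro r hr
    rw [show a - 1 = -(1 - a) by ring, Real.rpow_neg (le_of_lt hr), div_eq_mul_inv]
  have hφ : IntegrableOn (fun r : ℝ => Real.exp (-r) / r ^ (1 - a)) (Ioi 0) :=
    (integrableOn_congr_fun hw measurableSet_Ioi).1 (Real.GammaIntegral_convergent ha)
  have hF : Measurable (Function.uncurry fun (r : ℝ) (x : S) =>
      Complex.exp (-(((y ^ 2 / (4 * r) : ℝ) : ℂ) * z x))) := by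
    have h1 : Measurable fun p : ℝ × S => z p.2 := hzm.comp measurable_snd
    have h2 : Measurable fun p : ℝ × S => ((y ^ 2 / (4 * p.1) : ℝ) : ℂ) := by fun_prop
    exact ((h2.mul h1).neg).cexp
  have hb : ∀ᵐ r : ℝ ∂(volume.restrict (Ioi 0)), ∀ x : S,
      ‖Complex.exp (-(((y ^ 2 / (4 * r) : ℝ) : ℂ) * z x))‖ ≤ 1 :=
    (ae_restrict_mem measurableSet_Ioi).mono fun r hr x => by
      have hr : (0 : ℝ) < r := hr
      exact norm_exp_neg_mul_le_one (hz x) (by positivity)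
  have hm : AEStronglyMeasurable (fun r : ℝ => P.expOp z (y ^ 2 / (4 * r)) u)
      (volume.restrict (Ioi 0)) := by
    refine ContinuousOn.aestronglyMeasurable ?_ measurableSet_Ioi
    refine (P.continuousOn_expOp hzm hz u).comp (fun r hr => ?_) fun r hr => ?_
    · have hr : (0 : ℝ) < r := hr
      exact ContinuousAt.continuousWithinAt (by fun_prop (disch := positivity))
    · have hr : (0 : ℝ) < r := hr
      exact mem_Ici.2 (by positivity)
  refine ⟨P.integrable_smul_op hφ hF hb hm, (P.integral_smul_op hφ hF hb hm).trans ?_⟩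
  rw [besselOp]
  congr 2
  ext x
  refine setIntegral_congr_fun measurableSet_Ioi fun r hr => ?_
  have hr0 : (0 : ℝ) < r := hr
  simp only [besselKer]
  rw [hw r hr]
  congr 3
  have : (r : ℂ) ≠ 0 := by exact_mod_cast hr0.ne'
  push_cast
  field_simp

/-- The substitution `r = y²/(4τ)` between the two subordination densities, with its Jacobian. -/
theorem weight_comp_inv {a y τ : ℝ} (hy : 0 < y) (hτ : 0 < τ) :
    y ^ 2 / 4 * (τ ^ (-2 : ℝ) * (Real.exp (-(y ^ 2 / 4 * τ⁻¹)) * (y ^ 2 / 4 * τ⁻¹) ^ (a - 1))) =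
      (y ^ 2 / 4) ^ a * (Real.exp (-y ^ 2 / (4 * τ)) / τ ^ (1 + a)) := by
  have h1 : -y ^ 2 / (4 * τ) = -(y ^ 2 / 4 * τ⁻¹) := by field_simp
  have hb : 0 < y ^ 2 / 4 := by positivity
  have h2 : τ ^ (1 + a) = τ ^ 2 * (τ ^ (a - 1)) := by
    rw [← Real.rpow_natCast, ← Real.rpow_add hτ]; congr 1; push_cast; ring
  have h3 : τ ^ (-2 : ℝ) = (τ ^ 2)⁻¹ := by
    rw [Real.rpow_neg hτ.le]; norm_cast
  rw [h1, Real.mul_rpow hb.le (by positivity), Real.inv_rpow hτ.le, h2, h3,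
    Real.rpow_sub_one hb.ne']
  field_simp

theorem integrableOn_weight {a y : ℝ} (ha : 0 < a) (hy : 0 < y) :
    IntegrableOn (fun τ : ℝ => Real.exp (-y ^ 2 / (4 * τ)) / τ ^ (1 + a)) (Ioi 0) := by
  have hb : 0 < y ^ 2 / 4 := by positivity
  have h1 := (integrableOn_Ioi_comp_mul_left_iff _ 0 hb).2
    (by simpa using Real.GammaIntegral_convergent ha)
  have h2 := ((integrableOn_comp_inv_Ioi_iff _).2 h1).const_mul (y ^ 2 / 4)
  have h3 : IntegrableOn (fun τ : ℝ => (y ^ 2 / 4) ^ a *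
      (Real.exp (-y ^ 2 / (4 * τ)) / τ ^ (1 + a))) (Ioi 0) :=
    (integrableOn_congr_fun (fun τ hτ => by
      rw [← weight_comp_inv hy hτ]; rfl) measurableSet_Ioi).1 h2
  have h4 := h3.const_mul ((y ^ 2 / 4) ^ a)⁻¹
  have h5 : (y ^ 2 / 4) ^ a ≠ 0 := (Real.rpow_pos_of_pos hb a).ne'
  simpa only [inv_mul_cancel_left₀ h5] using! h4

theorem integral_weight_mul_exp {a y : ℝ} (hy : 0 < y) (w : ℂ) :
    ∫ τ in Ioi (0 : ℝ), ((Real.exp (-y ^ 2 / (4 * τ)) / τ ^ (1 + a) : ℝ) : ℂ) *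
      Complex.exp (-(τ * w)) =
    ((((y ^ 2 / 4) ^ a)⁻¹ : ℝ) : ℂ) * besselInt a ((y ^ 2 / 4 : ℝ) * w) := by
  have hb : 0 < y ^ 2 / 4 := by positivity
  have h5 : (((y ^ 2 / 4) ^ a : ℝ) : ℂ) ≠ 0 := by
    exact_mod_cast (Real.rpow_pos_of_pos hb a).ne'
  have h1 := integral_comp_mul_left_Ioi (besselKer a ((y ^ 2 / 4 : ℝ) * w)) 0 hb
  rw [mul_zero, eq_inv_smul_iff₀ hb.ne', ← integral_comp_inv_Ioi] at h1
  rw [Complex.ofReal_inv, eq_inv_mul_iff_mul_eq₀ h5, besselInt, ← h1, Complex.real_smul,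
    ← integral_const_mul, ← integral_const_mul]
  refine setIntegral_congr_fun measurableSet_Ioi fun τ hτ => ?_
  have hτ0 : (0 : ℝ) < τ := hτ
  have hτc : (τ : ℂ) ≠ 0 := by exact_mod_cast hτ0.ne'
  have hbc : ((y ^ 2 / 4 : ℝ) : ℂ) ≠ 0 := by exact_mod_cast hb.ne'
  have e : ((y ^ 2 / 4 : ℝ) : ℂ) * w / ((y ^ 2 / 4 * τ⁻¹ : ℝ) : ℂ) = τ * w := by
    rw [Complex.ofReal_mul, Complex.ofReal_inv]; field_simp
  simp only [besselKer, e]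
  rw [← mul_assoc, ← Complex.ofReal_mul, ← weight_comp_inv hy hτ0, Complex.real_smul]
  simp only [Complex.ofReal_mul]
  ring

/-- Subordination formula with the density `e^{-y²/(4τ)} τ^{-1-a}`. -/
theorem integral_weight_expOp (hzm : Measurable z) (hz : ∀ x, 0 ≤ (z x).re) {a : ℝ} (ha : 0 < a)
    {y : ℝ} (hy : 0 < y) (u : Y) :
    IntegrableOn (fun τ : ℝ => (Real.exp (-y ^ 2 / (4 * τ)) / τ ^ (1 + a)) • P.expOp z τ u)
        (Ioi 0) ∧
      ∫ τ in Ioi (0 : ℝ), (Real.exp (-y ^ 2 / (4 * τ)) / τ ^ (1 + a)) • P.expOp z τ u =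
        ((y ^ 2 / 4) ^ a)⁻¹ • P.besselOp z a y u := by
  have hφ := integrableOn_weight ha hy
  have hF : Measurable (Function.uncurry fun (τ : ℝ) (x : S) =>
      Complex.exp (-((τ : ℂ) * z x))) := by
    have h1 : Measurable fun p : ℝ × S => z p.2 := hzm.comp measurable_snd
    have h2 : Measurable fun p : ℝ × S => (p.1 : ℂ) := by fun_prop
    exact ((h2.mul h1).neg).cexp
  have hb : ∀ᵐ τ : ℝ ∂(volume.restrict (Ioi 0)), ∀ x : S,
      ‖Complex.exp (-((τ : ℂ) * z x))‖ ≤ 1 :=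
    (ae_restrict_mem measurableSet_Ioi).mono fun τ hτ x =>
      norm_exp_neg_mul_le_one (hz x) (le_of_lt hτ)
  have hm : AEStronglyMeasurable (fun τ : ℝ => P.expOp z τ u) (volume.restrict (Ioi 0)) :=
    ((P.continuousOn_expOp hzm hz u).mono Ioi_subset_Ici_self).aestronglyMeasurable
      measurableSet_Ioi
  refine ⟨P.integrable_smul_op hφ hF hb hm, (P.integral_smul_op hφ hF hb hm).trans ?_⟩
  rw [besselOp, ← Complex.coe_smul, ← smul_apply,
    ← P.op_const_mul (bddMeas_besselInt hzm hz ha (by positivity))]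
  congr 2
  ext x
  exact integral_weight_mul_exp hy (z x)

/-! ### Differentiation in the extension variable -/

/-- In the `τ`-integral the variable `y` sits only in the scalar weight, so no unbounded operator is
differentiated. Differentiating `e^{-y²/(4τ)}` raises `a` by one, and the prefactor `(y²/4)^a` gives
the other term. -/
theorem hasDerivAt_besselOp (hzm : Measurable z) (hz : ∀ x, 0 ≤ (z x).re) {a : ℝ} (ha : 0 < a)
    {y : ℝ} (hy : 0 < y) (u : Y) :
    HasDerivAt (fun y => P.besselOp z a y u)
      ((2 / y) • (a • P.besselOp z a y u - P.besselOp z (a + 1) y u)) y := by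
  set G : ℝ → Y := fun y =>
    ∫ τ in Ioi (0 : ℝ), (Real.exp (-y ^ 2 / (4 * τ)) / τ ^ (1 + a)) • P.expOp z τ u with hG
  have hGd : HasDerivAt G (∫ τ in Ioi (0 : ℝ),
      (-(y / 2) * (Real.exp (-y ^ 2 / (4 * τ)) / τ ^ (1 + (a + 1)))) • P.expOp z τ u) y := by
    have hball : ∀ x ∈ Metric.ball y (y / 2), y / 2 ≤ x ∧ x ≤ 2 * y := by
      intro x hx
      rw [Metric.mem_ball, Real.dist_eq] at hx
      have := abs_lt.1 hx
      constructor <;> linarith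
    have hmeas : AEStronglyMeasurable (fun τ : ℝ => P.expOp z τ u) (volume.restrict (Ioi 0)) :=
      ((P.continuousOn_expOp hzm hz u).mono Ioi_subset_Ici_self).aestronglyMeasurable
        measurableSet_Ioi
    refine (hasDerivAt_integral_of_dominated_loc_of_deriv_le (𝕜 := ℝ)
      (μ := volume.restrict (Ioi (0 : ℝ)))
      (F := fun y τ => (Real.exp (-y ^ 2 / (4 * τ)) / τ ^ (1 + a)) • P.expOp z τ u)
      (F' := fun y τ => (-(y / 2) * (Real.exp (-y ^ 2 / (4 * τ)) / τ ^ (1 + (a + 1)))) •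
        P.expOp z τ u) (x₀ := y) (s := Metric.ball y (y / 2))
      -- On the ball of radius `y/2` one has `x ≥ y/2` in the exponent and `x/2 ≤ y` in front.
      (bound := fun τ => y * (Real.exp (-(y / 2) ^ 2 / (4 * τ)) / τ ^ (1 + (a + 1))) * ‖u‖)
      (Metric.ball_mem_nhds y (by positivity)) (Eventually.of_forall fun x => ?_)
      (P.integral_weight_expOp hzm hz ha hy u).1 ?_ ?_ ?_ ?_).2
    · exact (Measurable.aestronglyMeasurable (f := fun τ : ℝ =>
        Real.exp (-x ^ 2 / (4 * τ)) / τ ^ (1 + a)) (by fun_prop)).smul hmeas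
    · exact (Measurable.aestronglyMeasurable (f := fun τ : ℝ =>
        -(y / 2) * (Real.exp (-y ^ 2 / (4 * τ)) / τ ^ (1 + (a + 1)))) (by fun_prop)).smul hmeas
    · refine (ae_restrict_mem measurableSet_Ioi).mono fun τ hτ x hx => ?_
      have hτ : (0 : ℝ) < τ := hτ
      obtain ⟨h1, h2⟩ := hball x hx
      have hx0 : 0 < x := by linarith
      rw [norm_smul, norm_mul, norm_neg, Real.norm_of_nonneg (by positivity),
        Real.norm_of_nonneg (by positivity)]
      have h3 : ‖P.expOp z τ u‖ ≤ ‖u‖ := by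
        rw [expOp]
        simpa using P.norm_op_le (f := fun x => Complex.exp (-(τ * z x))) (by fun_prop)
          zero_le_one (fun x => norm_exp_neg_mul_le_one (hz x) hτ.le) u
      have h4 : -x ^ 2 / (4 * τ) ≤ -(y / 2) ^ 2 / (4 * τ) := by gcongr
      gcongr
      linarith
    · exact ((integrableOn_weight (a := a + 1) (by linarith) (by positivity)).const_mul _).mul_const _
    · refine (ae_restrict_mem measurableSet_Ioi).mono fun τ hτ x hx => ?_
      have hτ : (0 : ℝ) < τ := hτ
      refine HasDerivAt.smul_const ?_ _
      have h1 : HasDerivAt (fun y : ℝ => -y ^ 2 / (4 * τ)) (-(2 * x) / (4 * τ)) x := by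
        simpa using! ((hasDerivAt_pow 2 x).neg).div_const (4 * τ)
      refine (h1.exp.div_const (τ ^ (1 + a))).congr_deriv ?_
      have h2 : τ ^ (1 + (a + 1)) = τ ^ (1 + a) * τ := by
        rw [← Real.rpow_add_one hτ.ne']; congr 1; ring
      rw [h2]
      field_simp
      norm_num
  have e1 : ∫ τ in Ioi (0 : ℝ),
      (-(y / 2) * (Real.exp (-y ^ 2 / (4 * τ)) / τ ^ (1 + (a + 1)))) • P.expOp z τ u =
      (-(y / 2) * ((y ^ 2 / 4) ^ (a + 1))⁻¹) • P.besselOp z (a + 1) y u := by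
    simp only [mul_smul]
    rw [integral_smul, (P.integral_weight_expOp hzm hz (a := a + 1) (by linarith) hy u).2]
  rw [e1] at hGd
  have hp : HasDerivAt (fun y : ℝ => (y ^ 2 / 4) ^ a)
      (2 * y / 4 * a * (y ^ 2 / 4) ^ (a - 1)) y := by
    have h1 : HasDerivAt (fun y : ℝ => y ^ 2 / 4) (2 * y / 4) y := by
      simpa using! (hasDerivAt_pow 2 y).div_const 4
    exact h1.rpow_const (Or.inl (by positivity))
  have hb : 0 < y ^ 2 / 4 := by positivity
  have hev : (fun y => P.besselOp z a y u) =ᶠ[𝓝 y] fun y => (y ^ 2 / 4) ^ a • G y := by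
    filter_upwards [lt_mem_nhds hy] with x hx
    have : (x ^ 2 / 4) ^ a ≠ 0 := (Real.rpow_pos_of_pos (by positivity) a).ne'
    simp only [hG]
    rw [(P.integral_weight_expOp hzm hz ha hx u).2, smul_inv_smul₀ this]
  refine ((hp.smul hGd).congr_of_eventuallyEq hev).congr_deriv ?_
  simp only [hG]
  rw [(P.integral_weight_expOp hzm hz ha hy u).2, smul_smul, smul_smul, smul_sub, smul_smul,
    add_comm, sub_eq_add_neg ((2 / y * a) • P.besselOp z a y u), ← neg_smul]
  have h1 : (y ^ 2 / 4) ^ (a + 1) = (y ^ 2 / 4) ^ a * (y ^ 2 / 4) := Real.rpow_add_one hb.ne' a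
  have h2 : (y ^ 2 / 4) ^ (a - 1) = (y ^ 2 / 4) ^ a / (y ^ 2 / 4) := Real.rpow_sub_one hb.ne' a
  have h3 : (y ^ 2 / 4) ^ a ≠ 0 := (Real.rpow_pos_of_pos hb a).ne'
  rw [h1, h2]
  congr 2
  · field_simp
  · field_simp
    norm_num

/-- The derivative involves only the indices `a` and `a + 1`, so the induction on the order runs
with `a` arbitrary. -/
theorem contDiffOn_besselOp (hzm : Measurable z) (hz : ∀ x, 0 ≤ (z x).re) {a : ℝ} (ha : 0 < a)
    (u : Y) : ContDiffOn ℝ ∞ (fun y => P.besselOp z a y u) (Ioi 0) := by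
  refine contDiffOn_infty.2 fun n => ?_
  induction n generalizing a with
  | zero =>
    exact contDiffOn_zero.2 (P.continuous_besselOp hzm hz ha u).continuousOn
  | succ n ih =>
    have h : ContDiffOn ℝ ((n : ℕ∞) + 1) (fun y => P.besselOp z a y u) (Ioi 0) := by
      refine (contDiffOn_succ_iff_deriv_of_isOpen isOpen_Ioi).2 ⟨fun y hy =>
        (P.hasDerivAt_besselOp hzm hz ha hy u).differentiableAt.differentiableWithinAt,
        by simp, ?_⟩
      have h1 : ContDiffOn ℝ n (fun y : ℝ =>
          (2 / y) • (a • P.besselOp z a y u - P.besselOp z (a + 1) y u)) (Ioi 0) := by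
        have h2 : ContDiffOn ℝ n (fun y : ℝ => 2 / y) (Ioi 0) :=
          contDiffOn_const.div contDiffOn_id fun y hy => ne_of_gt hy
        refine h2.smul ?_
        exact ((ih ha).const_smul a).sub (ih (by linarith))
      exact h1.congr fun y hy => (P.hasDerivAt_besselOp hzm hz ha hy u).deriv
    exact_mod_cast h

end ProjMeasure

/-! ### Scaled increments of the Bessel-type integral -/

/-- The multiplier of the weighted derivative of the extension, up to a constant. -/
def derivMult (s t : ℝ) (z : ℂ) : ℂ :=
  (s * besselInt s (t * z) - besselInt (s + 1) (t * z)) / ((t ^ s : ℝ) : ℂ)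

/-- The multiplier of the incremental quotient of the extension, up to a constant. -/
def incrMult (s t : ℝ) (z : ℂ) : ℂ :=
  (besselInt s (t * z) - Real.Gamma s) / ((t ^ s : ℝ) : ℂ)

section Mult

variable {s : ℝ}

theorem exists_norm_incrMult_le (hs0 : 0 < s) (hs1 : s < 1) :
    ∃ C, 0 ≤ C ∧ ∀ t : ℝ, 0 < t → ∀ z : ℂ, 0 ≤ z.re → ‖incrMult s t z‖ ≤ C * ‖z‖ ^ s := by
  obtain ⟨C, hC0, hC⟩ := exists_norm_besselInt_sub_gamma_le hs0 hs1
  refine ⟨C, hC0, fun t ht z hz => ?_⟩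
  have hp : 0 < t ^ s := Real.rpow_pos_of_pos ht s
  rw [incrMult, norm_div, Complex.norm_real, Real.norm_of_nonneg hp.le, div_le_iff₀ hp]
  have h := hC (t * z) (by rw [Complex.re_ofReal_mul]; positivity)
  rw [norm_mul, Complex.norm_real, Real.norm_of_nonneg ht.le,
    Real.mul_rpow ht.le (norm_nonneg z)] at h
  linarith

/-- Because `Γ(s+1) = s Γ(s)` the constant terms cancel, which leaves increments that are small near
zero. -/
theorem derivMult_eq (hs0 : 0 < s) (t : ℝ) (z : ℂ) :
    derivMult s t z = s * incrMult s t z -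
      (besselInt (s + 1) (t * z) - Real.Gamma (s + 1)) / ((t ^ s : ℝ) : ℂ) := by
  rw [derivMult, incrMult, Real.Gamma_add_one hs0.ne']
  push_cast
  ring

/-- The increment with index `s + 1` is linear in `w = tz` for `‖w‖ ≤ 1`, where `‖w‖ ≤ ‖w‖^s`, and
bounded for `‖w‖ ≥ 1`, where `1 ≤ ‖w‖^s`. The remaining part is covered by
`exists_norm_incrMult_le`. -/
theorem exists_norm_derivMult_le (hs0 : 0 < s) (hs1 : s < 1) :
    ∃ C, 0 ≤ C ∧ ∀ t : ℝ, 0 < t → ∀ z : ℂ, 0 ≤ z.re → ‖derivMult s t z‖ ≤ C * ‖z‖ ^ s := by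
  obtain ⟨C, hC0, hC⟩ := exists_norm_incrMult_le hs0 hs1
  have hG := Real.Gamma_pos_of_pos hs0
  have hG1 := Real.Gamma_pos_of_pos (show 0 < s + 1 by linarith)
  refine ⟨s * C + (Real.Gamma s + 2 * Real.Gamma (s + 1)), by positivity, fun t ht z hz => ?_⟩
  have hp : 0 < t ^ s := Real.rpow_pos_of_pos ht s
  have hre : 0 ≤ ((t : ℂ) * z).re := by rw [Complex.re_ofReal_mul]; positivity
  have hE : ‖besselInt (s + 1) (t * z) - Real.Gamma (s + 1)‖ ≤
      (Real.Gamma s + 2 * Real.Gamma (s + 1)) * ‖(t : ℂ) * z‖ ^ s := by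
    rcases le_total ‖(t : ℂ) * z‖ 1 with h | h
    · have h1 := norm_besselInt_add_one_sub_gamma_le hs0 hre
      have h2 : ‖(t : ℂ) * z‖ ≤ ‖(t : ℂ) * z‖ ^ s :=
        Real.self_le_rpow_of_le_one (norm_nonneg _) h hs1.le
      have h3 := mul_le_mul_of_nonneg_right h2 hG.le
      have h4 : 0 ≤ Real.Gamma (s + 1) * ‖(t : ℂ) * z‖ ^ s := by positivity
      linarith
    · have h1 := norm_besselInt_le (a := s + 1) (by linarith) hre
      have h2 : 1 ≤ ‖(t : ℂ) * z‖ ^ s := Real.one_le_rpow h hs0.le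
      have h3 := norm_sub_le (besselInt (s + 1) (t * z)) (Real.Gamma (s + 1) : ℂ)
      rw [Complex.norm_real, Real.norm_of_nonneg hG1.le] at h3
      nlinarith
  rw [norm_mul, Complex.norm_real, Real.norm_of_nonneg ht.le,
    Real.mul_rpow ht.le (norm_nonneg z)] at hE
  rw [derivMult_eq hs0]
  refine (norm_sub_le _ _).trans ?_
  rw [norm_mul, norm_div, Complex.norm_real, Complex.norm_real, Real.norm_of_nonneg hp.le,
    Real.norm_of_nonneg hs0.le, add_mul, mul_assoc]
  refine add_le_add (mul_le_mul_of_nonneg_left (hC t ht z hz) hs0.le) ?_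
  rw [div_le_iff₀ hp]
  linarith

theorem tendsto_incrMult (hs0 : 0 < s) (hs1 : s < 1) {z : ℂ} (hz : 0 ≤ z.re) :
    Tendsto (fun t : ℝ => incrMult s t z) (𝓝[>] 0) (𝓝 (Real.Gamma (-s) * z ^ (s : ℂ))) := by
  rw [← integral_rpow_mul_exp_sub_one hs0 hs1 hz]
  exact tendsto_besselInt_sub_gamma_div hs0 hs1 hz

/-- After division by `t^s` the increment with index `s + 1` is of order `t^{1-s}` and disappears.
-/
theorem tendsto_derivMult (hs0 : 0 < s) (hs1 : s < 1) {z : ℂ} (hz : 0 ≤ z.re) :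
    Tendsto (fun t : ℝ => derivMult s t z) (𝓝[>] 0)
      (𝓝 (s * (Real.Gamma (-s) * z ^ (s : ℂ)))) := by
  have h1 : Tendsto (fun t : ℝ => (besselInt (s + 1) (t * z) - Real.Gamma (s + 1)) /
      ((t ^ s : ℝ) : ℂ)) (𝓝[>] 0) (𝓝 0) := by
    refine squeeze_zero_norm' (a := fun t : ℝ => t ^ (1 - s) * (‖z‖ * Real.Gamma s)) ?_ ?_
    · filter_upwards [self_mem_nhdsWithin] with t ht
      have ht : (0 : ℝ) < t := ht
      have hp : 0 < t ^ s := Real.rpow_pos_of_pos ht s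
      have h := norm_besselInt_add_one_sub_gamma_le hs0 (w := (t : ℂ) * z)
        (by rw [Complex.re_ofReal_mul]; positivity)
      rw [norm_mul, Complex.norm_real, Real.norm_of_nonneg ht.le] at h
      rw [norm_div, Complex.norm_real, Real.norm_of_nonneg hp.le, div_le_iff₀ hp,
        Real.rpow_sub ht, Real.rpow_one]
      refine h.trans_eq ?_
      field_simp
    · have hc : Continuous fun t : ℝ => t ^ (1 - s) * (‖z‖ * Real.Gamma s) :=
        (Real.continuous_rpow_const (by linarith)).mul_const _
      have := (hc.tendsto 0).mono_left (nhdsWithin_le_nhds (s := Ioi 0))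
      simpa [Real.zero_rpow (show 1 - s ≠ 0 by linarith)] using this
  have h2 := ((tendsto_incrMult hs0 hs1 hz).const_mul (s : ℂ)).sub h1
  rw [sub_zero] at h2
  exact h2.congr fun t => (derivMult_eq hs0 t z).symm

end Mult

/-! ### The extension problem for a symbol -/

theorem measurable_pairing_param {S A Y : Type*} [MeasurableSpace S] [MeasurableSpace A]
    [NormedAddCommGroup Y] [InnerProductSpace ℂ Y] {ν : Y → Measure S} [∀ w, SFinite (ν w)]
    {F : A → S → ℂ} (hF : Measurable (Function.uncurry F)) (u v : Y) :
    Measurable fun a => pairing ν (F a) u v := by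
  have h : ∀ w, Measurable fun a => ∫ x, F a x ∂ν w := fun w =>
    (hF.stronglyMeasurable.integral_prod_right' (ν := ν w)).measurable
  unfold pairing
  have h1 := h (u + v)
  have h2 := h (u - v)
  have h3 := h (u + Complex.I • v)
  have h4 := h (u - Complex.I • v)
  fun_prop

namespace ProjMeasure

variable {S Y : Type*} [MeasurableSpace S] [NormedAddCommGroup Y] [InnerProductSpace ℂ Y]
  [CompleteSpace Y] (P : ProjMeasure S Y) {z : S → ℂ} {s : ℝ} {u v : Y}

/-- The energy `∫ |z|^σ d⟨Pu, u⟩`. -/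
def energy (z : S → ℂ) (σ : ℝ) (u : Y) : ℝ≥0∞ := ∫⁻ x, ENNReal.ofReal (‖z x‖ ^ σ) ∂P.measure u

theorem integrable_norm_rpow (hzm : Measurable z) (hu : P.energy z s u < ⊤) :
    Integrable (fun x => ‖z x‖ ^ s) (P.measure u) :=
  ⟨(hzm.norm.pow_const s).aestronglyMeasurable, by
    rw [hasFiniteIntegral_iff_ofReal (Eventually.of_forall fun x => by positivity)]
    exact hu⟩

theorem integrable_of_norm_le (hzm : Measurable z) (hu : P.energy z s u < ⊤) {m : S → ℂ}
    (hm : Measurable m) {C : ℝ} (hC : ∀ x, ‖m x‖ ≤ C * ‖z x‖ ^ s) : Integrable m (P.measure u) :=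
  ((P.integrable_norm_rpow hzm hu).const_mul C).mono' hm.aestronglyMeasurable
    (Eventually.of_forall hC)

theorem norm_pairing_le_energy (hzm : Measurable z) (hu : P.energy z s u < ⊤)
    (hv : P.energy z s v < ⊤) {m : S → ℂ} (hm : Measurable m) {C : ℝ} (hC0 : 0 ≤ C)
    (hC : ∀ x, ‖m x‖ ≤ C * ‖z x‖ ^ s) :
    ‖pairing P.measure m u v‖ ≤
      C * Real.sqrt (P.energy z s u).toReal * Real.sqrt (P.energy z s v).toReal := by
  have key : ∀ w, P.energy z s w < ⊤ →
      Real.sqrt (∫ x, ‖m x‖ ∂P.measure w) ≤ Real.sqrt C * Real.sqrt (P.energy z s w).toReal := by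
    intro w hw
    rw [← Real.sqrt_mul hC0]
    refine Real.sqrt_le_sqrt ?_
    have h1 : ∫ x, ‖z x‖ ^ s ∂P.measure w = (P.energy z s w).toReal :=
      integral_eq_lintegral_of_nonneg_ae (Eventually.of_forall fun x => by positivity)
        (hzm.norm.pow_const s).aestronglyMeasurable
    rw [← h1, ← integral_const_mul]
    exact integral_mono (P.integrable_of_norm_le hzm hw hm hC).norm
      ((P.integrable_norm_rpow hzm hw).const_mul C) hC
  refine (P.norm_pairing_le hm (P.integrable_of_norm_le hzm hu hm hC)
    (P.integrable_of_norm_le hzm hv hm hC)).trans ?_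
  calc _ ≤ (Real.sqrt C * Real.sqrt (P.energy z s u).toReal) *
        (Real.sqrt C * Real.sqrt (P.energy z s v).toReal) := by
          gcongr
          · exact key u hu
          · exact key v hv
    _ = (Real.sqrt C * Real.sqrt C) * Real.sqrt (P.energy z s u).toReal *
        Real.sqrt (P.energy z s v).toReal := by ring
    _ = _ := by rw [Real.mul_self_sqrt hC0]

theorem norm_cpow_ofReal_le (s : ℝ) (x : S) : ‖z x ^ (s : ℂ)‖ ≤ 1 * ‖z x‖ ^ s := by
  rw [Complex.norm_cpow_real, one_mul]

/-- A limit of bounded multipliers controlled by `|z|^s`. -/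
theorem tendsto_inner_op_of_norm_le {ι : Type*} {l : Filter ι} [l.IsCountablyGenerated]
    (hzm : Measurable z) (hu : P.energy z s u < ⊤) (hv : P.energy z s v < ⊤)
    {m : ι → S → ℂ} {f : S → ℂ} {C : ℝ} (hm : ∀ᶠ i in l, BddMeas (m i))
    (hC : ∀ᶠ i in l, ∀ x, ‖m i x‖ ≤ C * ‖z x‖ ^ s)
    (hl : ∀ x, Tendsto (fun i => m i x) l (𝓝 (f x))) :
    Tendsto (fun i => inner ℂ v (P.op (m i) u)) l (𝓝 (pairing P.measure f u v)) := by
  have h : Tendsto (fun i => pairing P.measure (m i) u v) l (𝓝 (pairing P.measure f u v)) :=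
    tendsto_pairing (fun x => C * ‖z x‖ ^ s) (hm.mono fun i hi => hi.measurable) hC
      (P.integrable_of_mem_polSet ((P.integrable_norm_rpow hzm hu).const_mul C)
        ((P.integrable_norm_rpow hzm hv).const_mul C)) fun w _ => Eventually.of_forall hl
  exact h.congr' (hm.mono fun i hi => (P.inner_op hi u v).symm)

variable (u) in
/-- The extension of `u`. -/
def ext (z : S → ℂ) (s y : ℝ) : Y := (1 / Real.Gamma s) • P.besselOp z s y u

theorem ext_zero (hs0 : 0 < s) : P.ext u z s 0 = u := by
  have h := (Real.Gamma_pos_of_pos hs0).ne'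
  rw [ext, P.besselOp_zero hs0, Complex.coe_smul, smul_smul, one_div_mul_cancel h, one_smul]

theorem continuous_ext (hzm : Measurable z) (hz : ∀ x, 0 ≤ (z x).re) (hs0 : 0 < s) :
    Continuous (P.ext u z s) := (P.continuous_besselOp hzm hz hs0 u).const_smul _

theorem contDiffOn_ext (hzm : Measurable z) (hz : ∀ x, 0 ≤ (z x).re) (hs0 : 0 < s) :
    ContDiffOn ℝ ∞ (P.ext u z s) (Ioi 0) := (P.contDiffOn_besselOp hzm hz hs0 u).const_smul _

theorem hasDerivAt_ext (hzm : Measurable z) (hz : ∀ x, 0 ≤ (z x).re) (hs0 : 0 < s) {y : ℝ}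
    (hy : 0 < y) : HasDerivAt (P.ext u z s) ((1 / Real.Gamma s) •
      ((2 / y) • (s • P.besselOp z s y u - P.besselOp z (s + 1) y u))) y :=
  (P.hasDerivAt_besselOp hzm hz hs0 hy u).const_smul _

theorem hasDerivAt_deriv_ext (hzm : Measurable z) (hz : ∀ x, 0 ≤ (z x).re) (hs0 : 0 < s) {y : ℝ}
    (hy : 0 < y) : HasDerivAt (deriv (P.ext u z s)) ((1 / Real.Gamma s) •
      ((2 / y) • (s • ((2 / y) • (s • P.besselOp z s y u - P.besselOp z (s + 1) y u)) -
          (2 / y) • ((s + 1) • P.besselOp z (s + 1) y u - P.besselOp z (s + 2) y u)) +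
        (-2 / y ^ 2) • (s • P.besselOp z s y u - P.besselOp z (s + 1) y u))) y := by
  have h1 := P.hasDerivAt_besselOp hzm hz hs0 hy u
  have h2 := P.hasDerivAt_besselOp hzm hz (a := s + 1) (by linarith) hy u
  rw [show s + 1 + 1 = s + 2 by ring] at h2
  have h3 : HasDerivAt (fun y : ℝ => 2 / y) (-2 / y ^ 2) y := by
    convert! (hasDerivAt_const y (2 : ℝ)).div (hasDerivAt_id y) hy.ne' using 1
    simp
  have h4 := (h3.smul ((h1.const_smul s).sub h2)).const_smul (1 / Real.Gamma s)
  refine h4.congr_of_eventuallyEq ?_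
  filter_upwards [lt_mem_nhds hy] with x hx
  exact (P.hasDerivAt_ext hzm hz hs0 hx).deriv

/-- The exponent `1 - 2s` is the one for which the terms in `besselOp z s` cancel. The rest is the
right side of `mul_besselInt`, that is, `z` applied to the extension. -/
theorem ext_ode (hzm : Measurable z) (hz : ∀ x, 0 ≤ (z x).re) (hs0 : 0 < s) {y : ℝ}
    (hy : 0 < y) : ((1 - 2 * s) / y) • deriv (P.ext u z s) y + deriv (deriv (P.ext u z s)) y =
      (4 / y ^ 2 / Real.Gamma s) •
        (P.besselOp z (s + 2) y u - (s + 1) • P.besselOp z (s + 1) y u) := by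
  rw [(P.hasDerivAt_ext hzm hz hs0 hy).deriv, (P.hasDerivAt_deriv_ext hzm hz hs0 hy).deriv]
  have hy' := hy.ne'
  have hG := (Real.Gamma_pos_of_pos hs0).ne'
  match_scalars <;> field_simp <;> ring

theorem besselOp_recurrence (hzm : Measurable z) (hz : ∀ x, 0 ≤ (z x).re) (hs0 : 0 < s) {y : ℝ} :
    P.besselOp z (s + 2) y u - (s + 1) • P.besselOp z (s + 1) y u =
      P.op (fun x => ((y ^ 2 / 4 : ℝ) * z x) * besselInt s ((y ^ 2 / 4 : ℝ) * z x)) u := by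
  have hb : 0 ≤ y ^ 2 / 4 := by positivity
  have e : (fun x => ((y ^ 2 / 4 : ℝ) * z x) * besselInt s ((y ^ 2 / 4 : ℝ) * z x)) =
      fun x => besselInt (s + 2) ((y ^ 2 / 4 : ℝ) * z x) -
        ((s + 1 : ℝ) : ℂ) * besselInt (s + 1) ((y ^ 2 / 4 : ℝ) * z x) := by
    ext x
    rw [mul_besselInt hs0 (by rw [Complex.re_ofReal_mul]; exact mul_nonneg hb (hz x))]
    push_cast
    rfl
  have h1 := bddMeas_besselInt hzm hz (a := s + 1) (by linarith) hb
  rw [e, P.op_sub (bddMeas_besselInt hzm hz (by linarith) hb) ((BddMeas.const _).mul h1),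
    P.op_const_mul h1, sub_apply, smul_apply, Complex.coe_smul]
  rfl

variable (s) in
/-- The multiplier of the extension. -/
def extMult (z : S → ℂ) (y : ℝ) (x : S) : ℂ :=
  ((1 / Real.Gamma s : ℝ) : ℂ) * besselInt s ((y ^ 2 / 4 : ℝ) * z x)

theorem bddMeas_extMult (hzm : Measurable z) (hz : ∀ x, 0 ≤ (z x).re) (hs0 : 0 < s) (y : ℝ) :
    BddMeas (extMult s z y) :=
  (BddMeas.const _).mul (bddMeas_besselInt hzm hz hs0 (by positivity))

theorem norm_extMult_le (hz : ∀ x, 0 ≤ (z x).re) (hs0 : 0 < s) (y : ℝ) (x : S) :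
    ‖extMult s z y x‖ ≤ 1 := by
  have hG := Real.Gamma_pos_of_pos hs0
  have h := norm_besselInt_le hs0 (w := (y ^ 2 / 4 : ℝ) * z x)
    (by rw [Complex.re_ofReal_mul]; exact mul_nonneg (by positivity) (hz x))
  rw [extMult, norm_mul, Complex.norm_real, Real.norm_of_nonneg (by positivity), one_div,
    inv_mul_le_one₀ hG]
  exact h

theorem norm_mul_extMult_le (hz : ∀ x, 0 ≤ (z x).re) (hs0 : 0 < s) {y : ℝ} (hy : 0 < y) (x : S) :
    ‖z x * extMult s z y x‖ ≤ 8 * Real.Gamma (s + 2) / Real.Gamma s / y ^ 2 := by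
  have hG := Real.Gamma_pos_of_pos hs0
  have h := norm_mul_besselInt_le hs0 (w := (y ^ 2 / 4 : ℝ) * z x)
    (by rw [Complex.re_ofReal_mul]; exact mul_nonneg (by positivity) (hz x))
  have e : z x * extMult s z y x = ((4 / y ^ 2 / Real.Gamma s : ℝ) : ℂ) *
      ((y ^ 2 / 4 : ℝ) * z x * besselInt s ((y ^ 2 / 4 : ℝ) * z x)) := by
    have h1 : (y : ℂ) ≠ 0 := by exact_mod_cast hy.ne'
    have h2 : (Real.Gamma s : ℂ) ≠ 0 := by exact_mod_cast hG.ne'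
    rw [extMult]
    push_cast
    field_simp
  rw [e, norm_mul, Complex.norm_real, Real.norm_of_nonneg (by positivity)]
  calc _ ≤ 4 / y ^ 2 / Real.Gamma s * (2 * Real.Gamma (s + 2)) := by gcongr
    _ = _ := by field_simp; norm_num

theorem ext_eq_op (hzm : Measurable z) (hz : ∀ x, 0 ≤ (z x).re) (hs0 : 0 < s) (y : ℝ) :
    P.ext u z s y = P.op (extMult s z y) u := by
  unfold extMult
  rw [ext, besselOp, P.op_const_mul (bddMeas_besselInt hzm hz hs0 (by positivity)), smul_apply,
    Complex.coe_smul]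

/-- The extension equation. -/
theorem pairing_ext (hzm : Measurable z) (hz : ∀ x, 0 ≤ (z x).re) (hs0 : 0 < s) {y : ℝ}
    (hy : 0 < y) (hv : P.energy z 1 v < ⊤) :
    pairing P.measure z (P.ext u z s y) v =
      inner ℂ v (((1 - 2 * s) / y) • deriv (P.ext u z s) y + deriv (deriv (P.ext u z s)) y) := by
  have hb := bddMeas_extMult hzm hz hs0 y
  have hzb : BddMeas fun x => z x * extMult s z y x :=
    ⟨hzm.mul hb.measurable, _, norm_mul_extMult_le hz hs0 hy⟩
  have hvi : Integrable z (P.measure v) := P.integrable_of_norm_le hzm hv hzm (C := 1) (by simp)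
  have hwb : BddMeas fun x =>
      ((y ^ 2 / 4 : ℝ) * z x) * besselInt s ((y ^ 2 / 4 : ℝ) * z x) := by
    refine ⟨(hzm.const_mul _).mul ((measurable_besselInt s).comp (hzm.const_mul _)), _,
      fun x => norm_mul_besselInt_le hs0 ?_⟩
    rw [Complex.re_ofReal_mul]; exact mul_nonneg (by positivity) (hz x)
  rw [P.ext_ode hzm hz hs0 hy, P.besselOp_recurrence hzm hz hs0, P.ext_eq_op hzm hz hs0,
    P.pairing_op_left hzm hb (hzb.integrable _) hvi, ← P.inner_op hzb, ← Complex.coe_smul,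
    ← smul_apply, ← P.op_const_mul hwb]
  congr 3
  ext x
  have h1 : (y : ℂ) ≠ 0 := by exact_mod_cast hy.ne'
  have h2 : (Real.Gamma s : ℂ) ≠ 0 := by exact_mod_cast (Real.Gamma_pos_of_pos hs0).ne'
  rw [extMult]
  push_cast
  field_simp

/-- Weak decay. -/
theorem tendsto_inner_ext (hzm : Measurable z) (hz : ∀ x, 0 ≤ (z x).re) (hs0 : 0 < s)
    (hz0 : ∀ u, ∀ᵐ x ∂P.measure u, z x ≠ 0) :
    Tendsto (fun y => inner ℂ v (P.ext u z s y)) atTop (𝓝 0) := by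
  have h0 : pairing P.measure (fun _ => 0) u v = 0 := by simp [pairing]
  rw [← h0]
  have h : Tendsto (fun y => pairing P.measure (extMult s z y) u v) atTop
      (𝓝 (pairing P.measure (fun _ => 0) u v)) := by
    -- At `z = 0` the multiplier is constantly 1, so decay holds only off that set; the hypothesis
    -- `hz0` makes it null for all four measures.
    refine tendsto_pairing (fun _ => 1)
      (Eventually.of_forall fun y => (bddMeas_extMult hzm hz hs0 y).measurable)
      (Eventually.of_forall fun y x => norm_extMult_le hz hs0 y x)
      (fun w _ => integrable_const _) fun w _ => (hz0 w).mono fun x hx => ?_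
    have hn : 0 < ‖z x‖ := norm_pos_iff.2 hx
    refine squeeze_zero_norm'
      (a := fun y : ℝ => 8 * Real.Gamma (s + 2) / Real.Gamma s / y ^ 2 / ‖z x‖) ?_ ?_
    · filter_upwards [eventually_gt_atTop 0] with y hy
      rw [le_div_iff₀ hn, mul_comm, ← norm_mul]
      exact norm_mul_extMult_le hz hs0 hy x
    · have := ((tendsto_const_nhds (x := 8 * Real.Gamma (s + 2) / Real.Gamma s)).div_atTop
        (tendsto_pow_atTop (α := ℝ) two_ne_zero)).div_const ‖z x‖
      simpa using this
  refine h.congr fun y => ?_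
  rw [P.ext_eq_op hzm hz hs0, P.inner_op (bddMeas_extMult hzm hz hs0 y)]

end ProjMeasure

namespace ProjMeasure

variable {S Y : Type*} [MeasurableSpace S] [NormedAddCommGroup Y] [InnerProductSpace ℂ Y]
  [CompleteSpace Y] (P : ProjMeasure S Y) {z : S → ℂ} {s : ℝ} {u v : Y}

/-! ### The weighted derivative and the incremental quotient -/

theorem bddMeas_derivMult (hzm : Measurable z) (hz : ∀ x, 0 ≤ (z x).re) (hs0 : 0 < s) {t : ℝ}
    (ht : 0 ≤ t) : BddMeas fun x => derivMult s t (z x) := by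
  have h1 := bddMeas_besselInt hzm hz hs0 ht
  have h2 := bddMeas_besselInt hzm hz (a := s + 1) (by linarith) ht
  have h := (BddMeas.const (((t ^ s : ℝ) : ℂ)⁻¹)).mul
    (((BddMeas.const (s : ℂ)).mul h1).add ((BddMeas.const (-1)).mul h2))
  convert h using 2 with x
  rw [derivMult, div_eq_inv_mul]
  ring

theorem bddMeas_incrMult (hzm : Measurable z) (hz : ∀ x, 0 ≤ (z x).re) (hs0 : 0 < s) {t : ℝ}
    (ht : 0 ≤ t) : BddMeas fun x => incrMult s t (z x) := by
  have h1 := bddMeas_besselInt hzm hz hs0 ht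
  have h := (BddMeas.const (((t ^ s : ℝ) : ℂ)⁻¹)).mul (h1.add (BddMeas.const (-Real.Gamma s)))
  convert h using 2 with x
  rw [incrMult, div_eq_inv_mul]
  ring

theorem op_derivMult (hzm : Measurable z) (hz : ∀ x, 0 ≤ (z x).re) (hs0 : 0 < s) (y : ℝ) :
    P.op (fun x => derivMult s (y ^ 2 / 4) (z x)) u =
      ((y ^ 2 / 4) ^ s)⁻¹ • (s • P.besselOp z s y u - P.besselOp z (s + 1) y u) := by
  have hb : 0 ≤ y ^ 2 / 4 := by positivity
  have h1 := bddMeas_besselInt hzm hz hs0 hb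
  have h2 := bddMeas_besselInt hzm hz (a := s + 1) (by linarith) hb
  have e : (fun x => derivMult s (y ^ 2 / 4) (z x)) = fun x =>
      (((((y ^ 2 / 4) ^ s)⁻¹ * s : ℝ) : ℂ) * besselInt s ((y ^ 2 / 4 : ℝ) * z x)) -
        (((((y ^ 2 / 4) ^ s)⁻¹ : ℝ) : ℂ) * besselInt (s + 1) ((y ^ 2 / 4 : ℝ) * z x)) := by
    ext x
    rw [derivMult, div_eq_inv_mul, Complex.ofReal_mul, Complex.ofReal_inv]
    ring
  rw [e, P.op_sub ((BddMeas.const _).mul h1) ((BddMeas.const _).mul h2), P.op_const_mul h1,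
    P.op_const_mul h2, sub_apply, smul_apply, smul_apply, Complex.coe_smul, Complex.coe_smul,
    smul_sub, smul_smul]
  rfl

theorem op_incrMult (hzm : Measurable z) (hz : ∀ x, 0 ≤ (z x).re) (hs0 : 0 < s) (y : ℝ) :
    P.op (fun x => incrMult s (y ^ 2 / 4) (z x)) u =
      ((y ^ 2 / 4) ^ s)⁻¹ • (P.besselOp z s y u - Real.Gamma s • u) := by
  have hb : 0 ≤ y ^ 2 / 4 := by positivity
  have h1 := bddMeas_besselInt hzm hz hs0 hb
  have e : (fun x => incrMult s (y ^ 2 / 4) (z x)) = fun x =>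
      (((((y ^ 2 / 4) ^ s)⁻¹ : ℝ) : ℂ) * besselInt s ((y ^ 2 / 4 : ℝ) * z x)) -
        ((((y ^ 2 / 4) ^ s)⁻¹ * Real.Gamma s : ℝ) : ℂ) := by
    ext x
    rw [incrMult, div_eq_inv_mul, Complex.ofReal_mul, Complex.ofReal_inv]
    ring
  rw [e, P.op_sub ((BddMeas.const _).mul h1) (BddMeas.const _), P.op_const_mul h1,
    P.op_const, sub_apply, smul_apply, smul_apply, Complex.coe_smul, Complex.coe_smul,
    smul_sub, smul_smul]
  rfl

theorem sq_div_four_rpow {y : ℝ} (hy : 0 < y) (s : ℝ) :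
    (y ^ 2 / 4) ^ s = y ^ (2 * s) / 4 ^ s := by
  rw [Real.div_rpow (by positivity) (by norm_num), ← Real.rpow_natCast, ← Real.rpow_mul hy.le]
  norm_num

theorem rpow_smul_deriv_ext (hzm : Measurable z) (hz : ∀ x, 0 ≤ (z x).re) (hs0 : 0 < s) {y : ℝ}
    (hy : 0 < y) : y ^ (1 - 2 * s) • deriv (P.ext u z s) y =
      (2 / (4 ^ s * Real.Gamma s)) • P.op (fun x => derivMult s (y ^ 2 / 4) (z x)) u := by
  rw [(P.hasDerivAt_ext hzm hz hs0 hy).deriv, P.op_derivMult hzm hz hs0, sq_div_four_rpow hy,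
    smul_smul, smul_smul, smul_smul, Real.rpow_sub hy, Real.rpow_one]
  have h1 := (Real.rpow_pos_of_pos hy (2 * s)).ne'
  have h2 := (Real.rpow_pos_of_pos (show (0 : ℝ) < 4 by norm_num) s).ne'
  have h3 := (Real.Gamma_pos_of_pos hs0).ne'
  congr 1
  field_simp

theorem smul_ext_sub (hzm : Measurable z) (hz : ∀ x, 0 ≤ (z x).re) (hs0 : 0 < s) {y : ℝ}
    (hy : 0 < y) : (1 / y ^ (2 * s)) • (P.ext u z s y - u) =
      (1 / (4 ^ s * Real.Gamma s)) • P.op (fun x => incrMult s (y ^ 2 / 4) (z x)) u := by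
  have h1 := (Real.rpow_pos_of_pos hy (2 * s)).ne'
  have h2 := (Real.rpow_pos_of_pos (show (0 : ℝ) < 4 by norm_num) s).ne'
  have h3 := (Real.Gamma_pos_of_pos hs0).ne'
  rw [ext, P.op_incrMult hzm hz hs0, sq_div_four_rpow hy]
  match_scalars <;> field_simp

/-- The bound for the weighted derivative. -/
theorem norm_inner_deriv_ext_le (hzm : Measurable z) (hz : ∀ x, 0 ≤ (z x).re) (hs0 : 0 < s)
    {C : ℝ} (hC0 : 0 ≤ C)
    (hC : ∀ t : ℝ, 0 < t → ∀ z : ℂ, 0 ≤ z.re → ‖derivMult s t z‖ ≤ C * ‖z‖ ^ s)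
    (hu : P.energy z s u < ⊤) (hv : P.energy z s v < ⊤) {y : ℝ} (hy : 0 < y) :
    ‖(inner ℂ v (y ^ (1 - 2 * s) • deriv (P.ext u z s) y) : ℂ)‖ ≤ 2 / (4 ^ s * Real.Gamma s) * C *
      Real.sqrt (P.energy z s u).toReal * Real.sqrt (P.energy z s v).toReal := by
  have hG := Real.Gamma_pos_of_pos hs0
  have hb : 0 < y ^ 2 / 4 := by positivity
  have hm := bddMeas_derivMult hzm hz hs0 hb.le
  rw [P.rpow_smul_deriv_ext hzm hz hs0 hy, ← Complex.coe_smul, inner_smul_right, norm_mul,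
    Complex.norm_real, Real.norm_of_nonneg (by positivity), P.inner_op hm, mul_assoc, mul_assoc]
  refine mul_le_mul_of_nonneg_left ?_ (by positivity)
  rw [← mul_assoc]
  exact P.norm_pairing_le_energy hzm hu hv hm.measurable hC0 fun x => hC _ hb _ (hz x)

theorem tendsto_sq_div_four : Tendsto (fun y : ℝ => y ^ 2 / 4) (𝓝[>] 0) (𝓝[>] 0) := by
  refine tendsto_nhdsWithin_iff.2 ⟨?_, ?_⟩
  · have : Continuous fun y : ℝ => y ^ 2 / 4 := by fun_prop
    simpa using (this.tendsto 0).mono_left (nhdsWithin_le_nhds (s := Ioi 0))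
  · filter_upwards [self_mem_nhdsWithin] with y hy
    have : (0 : ℝ) < y := hy
    show (0 : ℝ) < y ^ 2 / 4
    positivity

theorem Gamma_neg_lt_zero (hs0 : 0 < s) (hs1 : s < 1) : Real.Gamma (-s) < 0 := by
  have h := Real.Gamma_add_one (s := -s) (by linarith)
  have h1 := Real.Gamma_pos_of_pos (show 0 < -s + 1 by linarith)
  nlinarith

/-- The weighted normal derivative. -/
theorem tendsto_inner_deriv_ext (hzm : Measurable z) (hz : ∀ x, 0 ≤ (z x).re) (hs0 : 0 < s)
    (hs1 : s < 1) (hu : P.energy z s u < ⊤) (hv : P.energy z s v < ⊤) :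
    Tendsto (fun y : ℝ => -(1 / (2 * s) : ℂ) *
      inner ℂ v (y ^ (1 - 2 * s) • deriv (P.ext u z s) y)) (𝓝[>] 0)
      (𝓝 (((|Real.Gamma (-s)| / (4 ^ s * Real.Gamma s) : ℝ) : ℂ) *
        pairing P.measure (fun x => z x ^ (s : ℂ)) u v)) := by
  obtain ⟨C, -, hC⟩ := exists_norm_derivMult_le hs0 hs1
  have h := P.tendsto_inner_op_of_norm_le (l := 𝓝[>] (0 : ℝ)) hzm hu hv
    (m := fun y x => derivMult s (y ^ 2 / 4) (z x)) (C := C)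
    (f := fun x => s * Real.Gamma (-s) * z x ^ (s : ℂ))
    (Eventually.of_forall fun y => bddMeas_derivMult hzm hz hs0 (by positivity))
    (by
      filter_upwards [self_mem_nhdsWithin] with y hy x
      have : (0 : ℝ) < y := hy
      exact hC _ (by positivity) _ (hz x))
    (fun x => by
      have := (tendsto_derivMult hs0 hs1 (hz x)).comp tendsto_sq_div_four
      simpa only [mul_assoc, Function.comp_def] using this)
  rw [pairing_const_mul] at h
  have h' := h.const_mul (-(1 / (2 * s) : ℂ) * ((2 / (4 ^ s * Real.Gamma s) : ℝ) : ℂ))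
  have hs : (s : ℂ) ≠ 0 := by exact_mod_cast hs0.ne'
  have e : -(1 / (2 * s) : ℂ) * ((2 / (4 ^ s * Real.Gamma s) : ℝ) : ℂ) *
      (s * Real.Gamma (-s) * pairing P.measure (fun x => z x ^ (s : ℂ)) u v) =
      ((|Real.Gamma (-s)| / (4 ^ s * Real.Gamma s) : ℝ) : ℂ) *
        pairing P.measure (fun x => z x ^ (s : ℂ)) u v := by
    rw [abs_of_neg (Gamma_neg_lt_zero hs0 hs1)]
    push_cast
    field_simp
  rw [e] at h'
  refine h'.congr' ?_
  filter_upwards [self_mem_nhdsWithin] with y hy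
  rw [P.rpow_smul_deriv_ext hzm hz hs0 hy, ← Complex.coe_smul, inner_smul_right, mul_assoc]

/-- The limit of the incremental quotient. -/
theorem tendsto_inner_ext_sub (hzm : Measurable z) (hz : ∀ x, 0 ≤ (z x).re) (hs0 : 0 < s)
    (hs1 : s < 1) (hu : P.energy z s u < ⊤) (hv : P.energy z s v < ⊤) :
    Tendsto (fun y : ℝ => -inner ℂ v ((1 / y ^ (2 * s)) • (P.ext u z s y - u))) (𝓝[>] 0)
      (𝓝 (((|Real.Gamma (-s)| / (4 ^ s * Real.Gamma s) : ℝ) : ℂ) *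
        pairing P.measure (fun x => z x ^ (s : ℂ)) u v)) := by
  obtain ⟨C, -, hC⟩ := exists_norm_incrMult_le hs0 hs1
  have h := P.tendsto_inner_op_of_norm_le (l := 𝓝[>] (0 : ℝ)) hzm hu hv
    (m := fun y x => incrMult s (y ^ 2 / 4) (z x)) (C := C)
    (f := fun x => Real.Gamma (-s) * z x ^ (s : ℂ))
    (Eventually.of_forall fun y => bddMeas_incrMult hzm hz hs0 (by positivity))
    (by
      filter_upwards [self_mem_nhdsWithin] with y hy x
      have : (0 : ℝ) < y := hy
      exact hC _ (by positivity) _ (hz x))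
    (fun x => (tendsto_incrMult hs0 hs1 (hz x)).comp tendsto_sq_div_four)
  rw [pairing_const_mul] at h
  have h' := h.const_mul (-((1 / (4 ^ s * Real.Gamma s) : ℝ) : ℂ))
  have e : -((1 / (4 ^ s * Real.Gamma s) : ℝ) : ℂ) *
      (Real.Gamma (-s) * pairing P.measure (fun x => z x ^ (s : ℂ)) u v) =
      ((|Real.Gamma (-s)| / (4 ^ s * Real.Gamma s) : ℝ) : ℂ) *
        pairing P.measure (fun x => z x ^ (s : ℂ)) u v := by
    rw [abs_of_neg (Gamma_neg_lt_zero hs0 hs1)]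
    push_cast
    ring
  rw [e] at h'
  refine h'.congr' ?_
  filter_upwards [self_mem_nhdsWithin] with y hy
  rw [P.smul_ext_sub hzm hz hs0 hy, ← Complex.coe_smul, inner_smul_right, neg_mul]

/-! ### Energy of the extension -/

theorem energy_op (hzm : Measurable z) {f : S → ℂ} (hf : BddMeas f) (σ : ℝ) :
    P.energy z σ (P.op f u) =
      ∫⁻ x, ENNReal.ofReal (‖f x‖ ^ 2) * ENNReal.ofReal (‖z x‖ ^ σ) ∂P.measure u := by
  have h1 : Measurable fun x => ENNReal.ofReal (‖f x‖ ^ 2) :=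
    (hf.measurable.norm.pow_const 2).ennreal_ofReal
  have h2 : Measurable fun x => ENNReal.ofReal (‖z x‖ ^ σ) :=
    (hzm.norm.pow_const σ).ennreal_ofReal
  rw [energy, P.measure_op hf, lintegral_withDensity_eq_lintegral_mul _ h1 h2]
  rfl

/-- The multiplier `m` has modulus at most one, so `‖z‖ ‖m‖² ≤ ‖z m‖`, which is bounded for `y > 0`.
-/
theorem energy_ext_lt_top (hzm : Measurable z) (hz : ∀ x, 0 ≤ (z x).re) (hs0 : 0 < s) {y : ℝ}
    (hy : 0 < y) : P.energy z 1 (P.ext u z s y) < ⊤ := by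
  rw [P.ext_eq_op hzm hz hs0, P.energy_op hzm (bddMeas_extMult hzm hz hs0 y)]
  refine (lintegral_mono (g := fun _ =>
    ENNReal.ofReal (8 * Real.Gamma (s + 2) / Real.Gamma s / y ^ 2)) fun x => ?_).trans_lt ?_
  · rw [← ENNReal.ofReal_mul (by positivity), Real.rpow_one]
    refine ENNReal.ofReal_le_ofReal ?_
    refine le_trans ?_ (norm_mul_extMult_le hz hs0 hy x)
    rw [norm_mul, mul_comm, sq]
    refine mul_le_mul_of_nonneg_left ?_ (norm_nonneg _)
    exact mul_le_of_le_one_left (norm_nonneg _) (norm_extMult_le hz hs0 y x)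
  · rw [lintegral_const]
    exact ENNReal.mul_lt_top ENNReal.ofReal_lt_top (measure_lt_top _ _)

/-- By Tonelli the integration in `y` is done first at fixed spectral point, where
`exists_lintegral_besselInt_le` leaves `‖z‖^s`, the density of the given energy. -/
theorem lintegral_energy_ext_lt_top (hzm : Measurable z) (hz : ∀ x, 0 ≤ (z x).re) (hs0 : 0 < s)
    (hs1 : s < 1) (hu : P.energy z s u < ⊤) :
    ∫⁻ y in Ioi (0 : ℝ), ENNReal.ofReal (y ^ (1 - 2 * s)) * P.energy z 1 (P.ext u z s y) < ⊤ := by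
  obtain ⟨C, hC⟩ := exists_lintegral_besselInt_le hs0 hs1
  set G := 1 / Real.Gamma s with hG
  set F : ℝ → S → ℝ≥0∞ := fun y x => ENNReal.ofReal (G ^ 2) * (ENNReal.ofReal (y ^ (1 - 2 * s)) *
    ENNReal.ofReal (‖z x‖ * ‖besselInt s ((y ^ 2 / 4 : ℝ) * z x)‖ ^ 2)) with hF
  have hFm : Measurable (Function.uncurry F) := by
    have h1 : Measurable fun p : ℝ × S => besselInt s ((p.1 ^ 2 / 4 : ℝ) * z p.2) :=
      (measurable_besselInt s).comp (by fun_prop)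
    have : Function.uncurry F = fun p : ℝ × S => ENNReal.ofReal (G ^ 2) *
      (ENNReal.ofReal (p.1 ^ (1 - 2 * s)) *
        ENNReal.ofReal (‖z p.2‖ * ‖besselInt s ((p.1 ^ 2 / 4 : ℝ) * z p.2)‖ ^ 2)) := rfl
    rw [this]
    fun_prop
  have e : ∀ y, ENNReal.ofReal (y ^ (1 - 2 * s)) * P.energy z 1 (P.ext u z s y) =
      ∫⁻ x, F y x ∂P.measure u := by
    intro y
    have hb := bddMeas_extMult hzm hz hs0 y
    rw [P.ext_eq_op hzm hz hs0, P.energy_op hzm hb, ← lintegral_const_mul]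
    · refine lintegral_congr fun x => ?_
      simp only [hF, Real.rpow_one]
      rw [extMult, norm_mul, Complex.norm_real, ← hG, mul_left_comm (ENNReal.ofReal (G ^ 2))]
      congr 1
      rw [← ENNReal.ofReal_mul (sq_nonneg _), ← ENNReal.ofReal_mul (sq_nonneg _), mul_pow,
        Real.norm_eq_abs, sq_abs]
      congr 1
      ring
    · exact (hb.measurable.norm.pow_const 2).ennreal_ofReal.mul
        (hzm.norm.pow_const 1).ennreal_ofReal
  simp only [e]
  rw [lintegral_lintegral_swap hFm.aemeasurable]
  have hle : ∀ x, ∫⁻ y in Ioi (0 : ℝ), F y x ≤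
      ENNReal.ofReal (G ^ 2) * (ENNReal.ofReal C * ENNReal.ofReal (‖z x‖ ^ s)) := by
    intro x
    rw [hF, lintegral_const_mul]
    · rw [← ENNReal.ofReal_mul' (by positivity)]
      gcongr
      exact hC (z x) (hz x)
    · have h1 : Measurable fun y : ℝ => besselInt s ((y ^ 2 / 4 : ℝ) * z x) :=
        (measurable_besselInt s).comp (by fun_prop)
      fun_prop
  refine (lintegral_mono hle).trans_lt ?_
  rw [lintegral_const_mul' _ _ ENNReal.ofReal_ne_top, lintegral_const_mul' _ _ ENNReal.ofReal_ne_top]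
  exact ENNReal.mul_lt_top ENNReal.ofReal_lt_top (ENNReal.mul_lt_top ENNReal.ofReal_lt_top hu)

/-- Continuity in the energy norm provides the simple approximants required by `MemWeightedL2DomHs`.
The dominating constant is uniform as long as `q > y/2`. -/
theorem tendsto_energy_ext_sub (hzm : Measurable z) (hz : ∀ x, 0 ≤ (z x).re) (hs0 : 0 < s) {y : ℝ}
    (hy : 0 < y) :
    Tendsto (fun q => P.energy z 1 (P.ext u z s q - P.ext u z s y)) (𝓝 y) (𝓝 0) := by
  have hb := bddMeas_extMult hzm hz hs0
  have hbs : ∀ q, BddMeas fun x => extMult s z q x - extMult s z y x := fun q => by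
    simpa only [sub_eq_add_neg, neg_one_mul] using (hb q).add ((BddMeas.const (-1)).mul (hb y))
  have e : ∀ q, P.energy z 1 (P.ext u z s q - P.ext u z s y) =
      ∫⁻ x, ENNReal.ofReal (‖extMult s z q x - extMult s z y x‖ ^ 2) *
        ENNReal.ofReal (‖z x‖ ^ (1 : ℝ)) ∂P.measure u := by
    intro q
    rw [P.ext_eq_op hzm hz hs0, P.ext_eq_op hzm hz hs0, ← sub_apply, ← P.op_sub (hb q) (hb y),
      P.energy_op hzm (hbs q)]
  simp only [e]
  set K := 8 * Real.Gamma (s + 2) / Real.Gamma s with hK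
  have hK0 : 0 ≤ K := by
    have h1 := Real.Gamma_pos_of_pos hs0
    have h2 := Real.Gamma_pos_of_pos (show 0 < s + 2 by linarith)
    positivity
  have hlim := tendsto_lintegral_filter_of_dominated_convergence (l := 𝓝 y) (μ := P.measure u)
    (F := fun q x => ENNReal.ofReal (‖extMult s z q x - extMult s z y x‖ ^ 2) *
        ENNReal.ofReal (‖z x‖ ^ (1 : ℝ))) (f := fun _ => 0)
    (fun _ => ENNReal.ofReal (2 * (K / (y / 2) ^ 2 + K / y ^ 2)))
    (Eventually.of_forall fun q => by
      exact ((hbs q).measurable.norm.pow_const 2).ennreal_ofReal.mul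
        (hzm.norm.pow_const 1).ennreal_ofReal) ?_ ?_ ?_
  · simpa using hlim
  · filter_upwards [lt_mem_nhds (show y / 2 < y by linarith)] with q hq
    refine Eventually.of_forall fun x => ?_
    rw [← ENNReal.ofReal_mul (by positivity), Real.rpow_one]
    refine ENNReal.ofReal_le_ofReal ?_
    have hq0 : 0 < q := by linarith
    have h1 := norm_mul_extMult_le hz hs0 hq0 x
    have h2 := norm_mul_extMult_le hz hs0 hy x
    have h3 := norm_extMult_le hz hs0 q x
    have h4 := norm_extMult_le hz hs0 y x
    rw [norm_mul] at h1 h2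
    have h5 := norm_sub_le (extMult s z q x) (extMult s z y x)
    have h6 : K / q ^ 2 ≤ K / (y / 2) ^ 2 := by gcongr
    have h7 : ‖extMult s z q x - extMult s z y x‖ ^ 2 ≤
        2 * (‖extMult s z q x‖ + ‖extMult s z y x‖) := by
      rw [sq]
      exact mul_le_mul (by linarith) h5 (norm_nonneg _) (by norm_num)
    calc _ ≤ 2 * (‖extMult s z q x‖ + ‖extMult s z y x‖) * ‖z x‖ := by gcongr
      _ = 2 * (‖z x‖ * ‖extMult s z q x‖ + ‖z x‖ * ‖extMult s z y x‖) := by ring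
      _ ≤ _ := by linarith
  · rw [lintegral_const]
    exact (ENNReal.mul_lt_top ENNReal.ofReal_lt_top (measure_lt_top _ _)).ne
  · refine Eventually.of_forall fun x => ?_
    have hre : ∀ q : ℝ, 0 ≤ (((q ^ 2 / 4 : ℝ) : ℂ) * z x).re := fun q => by
      rw [Complex.re_ofReal_mul]; exact mul_nonneg (by positivity) (hz x)
    have hc : Continuous fun q : ℝ => ((q ^ 2 / 4 : ℝ) : ℂ) * z x := by fun_prop
    have h1 : Tendsto (fun q : ℝ => besselInt s (((q ^ 2 / 4 : ℝ) : ℂ) * z x)) (𝓝 y)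
        (𝓝 (besselInt s (((y ^ 2 / 4 : ℝ) : ℂ) * z x))) :=
      (continuousWithinAt_besselInt hs0 _).tendsto.comp
        (tendsto_nhdsWithin_iff.2 ⟨hc.tendsto y, Eventually.of_forall hre⟩)
    have h2 := (h1.const_mul ((1 / Real.Gamma s : ℝ) : ℂ)).sub_const (extMult s z y x)
    have h3 : Tendsto (fun q => ‖extMult s z q x - extMult s z y x‖ ^ 2) (𝓝 y) (𝓝 0) := by
      have := (h2.norm).pow 2
      simpa [extMult] using this
    have h4 := ENNReal.Tendsto.mul_const (b := ENNReal.ofReal (‖z x‖ ^ (1 : ℝ)))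
      (ENNReal.tendsto_ofReal h3) (Or.inr ENNReal.ofReal_ne_top)
    simpa using h4

/-! ### The weak representation -/

section Weak

variable {b : ℝ}

theorem integrableOn_lapWeight (hs0 : 0 < s) (hb : 0 ≤ b) {R : ℝ} (hR : 0 ≤ R) :
    IntegrableOn (lapWeight s b) (Ioc 0 R) := by
  refine (integrableOn_rpow_sub_one hs0 R hR).mono' measurable_lapWeight.aestronglyMeasurable ?_
  filter_upwards [ae_restrict_mem measurableSet_Ioc] with r hr
  rw [Real.norm_of_nonneg (lapWeight_nonneg hr.1)]
  exact lapWeight_le hb hr.1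

theorem integrable_lapKer_prod (hzm : Measurable z) (hz : ∀ x, 0 ≤ (z x).re) (hs0 : 0 < s)
    (hb : 0 ≤ b) {R : ℝ} (hR : 0 ≤ R) (hu : P.energy z s u < ⊤) :
    Integrable (Function.uncurry fun (r : ℝ) x => (lapWeight s b r : ℂ) *
      (z x ^ (s : ℂ) * Complex.exp (-(r * z x)))) ((volume.restrict (Ioc 0 R)).prod (P.measure u)) := by
  refine ((integrableOn_lapWeight hs0 hb hR).mul_prod (P.integrable_norm_rpow hzm hu)).mono' ?_ ?_
  · have := measurable_lapWeight (s := s) (b := b)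
    exact Measurable.aestronglyMeasurable (by unfold Function.uncurry; fun_prop)
  · have : ∀ᵐ p : ℝ × S ∂(volume.restrict (Ioc 0 R)).prod (P.measure u), p.1 ∈ Ioc 0 R :=
      Measure.quasiMeasurePreserving_fst.ae (ae_restrict_mem measurableSet_Ioc)
    filter_upwards [this] with p hp
    rw [Function.uncurry, norm_mul, norm_mul, Complex.norm_real,
      Real.norm_of_nonneg (lapWeight_nonneg hp.1), Complex.norm_cpow_real]
    gcongr
    · exact lapWeight_nonneg hp.1
    · exact mul_le_of_le_one_right (by positivity) (norm_exp_neg_mul_le_one (hz _) hp.1.le)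

theorem pairing_adjoint_expOp (hzm : Measurable z) (hz : ∀ x, 0 ≤ (z x).re)
    (hu : P.energy z s u < ⊤) (hv : P.energy z s v < ⊤) {r : ℝ} (hr : 0 ≤ r) :
    pairing P.measure (fun x => z x ^ (s : ℂ)) u
        (ContinuousLinearMap.adjoint (P.expOp z r) v) =
      pairing P.measure (fun x => z x ^ (s : ℂ) * Complex.exp (-(r * z x))) u v := by
  have hm : Measurable fun x => z x ^ (s : ℂ) := hzm.pow_const _
  exact P.pairing_adjoint_op_right hm (bddMeas_exp hzm hz hr)
    (P.integrable_of_norm_le hzm hu hm (norm_cpow_ofReal_le s))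
    (P.integrable_of_norm_le hzm hv hm (norm_cpow_ofReal_le s))

theorem integrableOn_weak (hzm : Measurable z) (hz : ∀ x, 0 ≤ (z x).re) (hs0 : 0 < s)
    (hb : 0 ≤ b) (hu : P.energy z s u < ⊤) (hv : P.energy z s v < ⊤) {R : ℝ} (hR : 0 ≤ R) :
    IntegrableOn (fun r : ℝ => (lapWeight s b r : ℂ) *
      pairing P.measure (fun x => z x ^ (s : ℂ) * Complex.exp (-(r * z x))) u v) (Ioc 0 R) := by
  simp only [← pairing_const_mul]
  exact integrable_pairing fun w hw => by
    refine P.integrable_lapKer_prod hzm hz hs0 hb hR ?_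
    have := (P.integrable_of_mem_polSet (P.integrable_norm_rpow hzm hu)
      (P.integrable_norm_rpow hzm hv) w hw).2
    rwa [hasFiniteIntegral_iff_ofReal (Eventually.of_forall fun x => by positivity)] at this

theorem integral_weak (hzm : Measurable z) (hz : ∀ x, 0 ≤ (z x).re) (hs0 : 0 < s)
    (hb : 0 ≤ b) (hu : P.energy z s u < ⊤) (hv : P.energy z s v < ⊤) {R : ℝ} (hR : 0 ≤ R) :
    ∫ r in Ioc 0 R, (lapWeight s b r : ℂ) *
      pairing P.measure (fun x => z x ^ (s : ℂ) * Complex.exp (-(r * z x))) u v =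
    pairing P.measure (fun x => z x ^ (s : ℂ) * truncLaplace s b (z x) R) u v := by
  simp only [← pairing_const_mul]
  rw [integral_pairing fun w hw => by
    refine P.integrable_lapKer_prod hzm hz hs0 hb hR ?_
    have := (P.integrable_of_mem_polSet (P.integrable_norm_rpow hzm hu)
      (P.integrable_norm_rpow hzm hv) w hw).2
    rwa [hasFiniteIntegral_iff_ofReal (Eventually.of_forall fun x => by positivity)] at this]
  congr 1
  ext x
  rw [truncLaplace, ← integral_const_mul]
  congr 1
  ext r
  ring

/-- The weak representation of the extension. -/
theorem tendsto_weak (hzm : Measurable z) (hz : ∀ x, 0 ≤ (z x).re) (hs0 : 0 < s) (hs1 : s < 1)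
    (hz0 : ∀ u, ∀ᵐ x ∂P.measure u, z x ≠ 0)
    (hu : P.energy z s u < ⊤) (hv : P.energy z s v < ⊤) (y : ℝ) :
    Tendsto (fun R : ℝ => ((1 / Real.Gamma s : ℝ) : ℂ) *
      ∫ r in Ioc 0 R, (lapWeight s (y ^ 2 / 4) r : ℂ) *
        pairing P.measure (fun x => z x ^ (s : ℂ) * Complex.exp (-(r * z x))) u v) atTop
      (𝓝 (inner ℂ v (P.ext u z s y))) := by
  have hb : 0 ≤ y ^ 2 / 4 := by positivity
  rw [ext, ← Complex.coe_smul, inner_smul_right]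
  refine Tendsto.const_mul _ ?_
  rw [besselOp, P.inner_op (bddMeas_besselInt hzm hz hs0 hb)]
  have h : Tendsto (fun R : ℝ => pairing P.measure
      (fun x => z x ^ (s : ℂ) * truncLaplace s (y ^ 2 / 4) (z x) R) u v) atTop
      (𝓝 (pairing P.measure (fun x => besselInt s ((y ^ 2 / 4 : ℝ) * z x)) u v)) := by
    -- The constant is the bound of `norm_cpow_mul_truncLaplace_le`, uniform in `R`; pointwise
    -- convergence is available off `z = 0` only.
    refine tendsto_pairing (fun _ => 1 / s + (2 + 2 / (1 - s))) (Eventually.of_forall fun R => ?_)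
      ?_ (fun w _ => integrable_const _) fun w _ => (hz0 w).mono fun x hx =>
        tendsto_cpow_mul_truncLaplace hs0 hs1 hb (hz x) hx
    · refine (hzm.pow_const _).mul ?_
      have h1 : StronglyMeasurable fun w : ℂ => truncLaplace s (y ^ 2 / 4) w R :=
        (measurable_lapKer s (y ^ 2 / 4)).stronglyMeasurable.integral_prod_right'
      exact h1.measurable.comp hzm
    · filter_upwards [eventually_ge_atTop 0] with R hR x
      exact norm_cpow_mul_truncLaplace_le hs0 hs1 hb (hz x) hR
  refine h.congr' ?_
  filter_upwards [eventually_ge_atTop 0] with R hR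
  exact (P.integral_weak hzm hz hs0 hb hu hv hR).symm

theorem op_eq_self {f : S → ℂ} (hf : BddMeas f) (h : ∀ᵐ x ∂P.measure u, f x = 1) :
    P.op f u = u := by
  have h1 : P.op (fun x => f x - 1) u = 0 := by
    have hb : BddMeas fun x => f x - 1 := by
      simpa only [sub_eq_add_neg] using hf.add (BddMeas.const (-1))
    rw [← norm_eq_zero, ← sq_eq_zero_iff, P.norm_op_sq hb]
    rw [integral_congr_ae (g := fun _ => (0 : ℝ)) (h.mono fun x hx => by simp [hx]), integral_zero]
  rw [P.op_sub hf (BddMeas.const 1), P.op_const, sub_apply, one_smul] at h1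
  exact sub_eq_zero.1 h1

/-- Absolute convergence when the spectral content of `u` stays away from `Re z = 0`. -/
theorem integrableOn_weak_Ioi (hzm : Measurable z) (hz : ∀ x, 0 ≤ (z x).re) (hs0 : 0 < s)
    (hb : 0 ≤ b) (hu : P.energy z s u < ⊤) (hv : P.energy z s v < ⊤) {c : ℝ} (hc : 0 < c)
    (hgap : ∀ᵐ x ∂P.measure u, c ≤ (z x).re) :
    IntegrableOn (fun r : ℝ => (lapWeight s b r : ℂ) *
      pairing P.measure (fun x => z x ^ (s : ℂ) * Complex.exp (-(r * z x))) u v) (Ioi 0) := by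
  set A := {x | c ≤ (z x).re} with hA
  have hAm : MeasurableSet A := measurableSet_le measurable_const (Complex.measurable_re.comp hzm)
  have hf : BddMeas (A.indicator fun _ : S => (1 : ℂ)) := (BddMeas.const 1).indicator hAm
  -- The cutoff to `A` fixes `u`, so it can be inserted into the multiplier although nothing is
  -- assumed on the spectral support of `v`.
  have hfu : P.op (A.indicator fun _ => 1) u = u :=
    P.op_eq_self hf (hgap.mono fun x hx => indicator_of_mem (s := A) hx _)
  set M := Real.sqrt (P.energy z s u).toReal * Real.sqrt (P.energy z s v).toReal
  have hbound : ∀ r : ℝ, 0 < r →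
      ‖pairing P.measure (fun x => z x ^ (s : ℂ) * Complex.exp (-(r * z x))) u v‖ ≤
        Real.exp (-(c * r)) * M := by
    intro r hr
    have hm : Measurable fun x => z x ^ (s : ℂ) * Complex.exp (-(r * z x)) := by fun_prop
    have hmle : ∀ x, ‖z x ^ (s : ℂ) * Complex.exp (-(r * z x))‖ ≤ 1 * ‖z x‖ ^ s := fun x => by
      rw [norm_mul, Complex.norm_cpow_real, one_mul]
      exact mul_le_of_le_one_right (by positivity) (norm_exp_neg_mul_le_one (hz x) hr.le)
    have hmA : Measurable fun x => z x ^ (s : ℂ) * Complex.exp (-(r * z x)) *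
        A.indicator (fun _ => (1 : ℂ)) x := hm.mul hf.measurable
    have hmAle : ∀ x, ‖z x ^ (s : ℂ) * Complex.exp (-(r * z x)) *
        A.indicator (fun _ => (1 : ℂ)) x‖ ≤ Real.exp (-(c * r)) * ‖z x‖ ^ s := fun x => by
      by_cases hx : x ∈ A
      · rw [indicator_of_mem hx, mul_one, norm_mul, Complex.norm_cpow_real, mul_comm,
          Complex.norm_exp, Complex.neg_re, Complex.re_ofReal_mul]
        have : c ≤ (z x).re := hx
        refine mul_le_mul_of_nonneg_right (Real.exp_le_exp.2 ?_) (by positivity)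
        nlinarith
      · rw [indicator_of_notMem hx, mul_zero, norm_zero]
        positivity
    have h := P.pairing_op_left hm hf (P.integrable_of_norm_le hzm hu hmA hmAle)
      (P.integrable_of_norm_le hzm hv hm hmle)
    rw [hfu] at h
    rw [h, ← mul_assoc]
    exact P.norm_pairing_le_energy hzm hu hv hmA (Real.exp_pos _).le hmAle
  refine ((integrableOn_rpow_mul_exp hs0 hc).mul_const M).mono' ?_ ?_
  · have h1 : Measurable fun r : ℝ =>
        pairing P.measure (fun x => z x ^ (s : ℂ) * Complex.exp (-(r * z x))) u v := by
      refine measurable_pairing_param (F := fun (r : ℝ) x => z x ^ (s : ℂ) *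
        Complex.exp (-(r * z x))) ?_ u v
      unfold Function.uncurry
      fun_prop
    have := measurable_lapWeight (s := s) (b := b)
    exact Measurable.aestronglyMeasurable (by fun_prop)
  · filter_upwards [ae_restrict_mem measurableSet_Ioi] with r hr
    have hr : 0 < r := hr
    rw [norm_mul, Complex.norm_real, Real.norm_of_nonneg (lapWeight_nonneg hr), mul_assoc]
    exact mul_le_mul (lapWeight_le hb hr) (hbound r hr) (norm_nonneg _) (by positivity)

end Weak

end ProjMeasure

/-! ### Spectral measures from a continuous functional calculus -/

section BorelInduction

variable {K : Type*} [MetricSpace K] [CompactSpace K] [MeasurableSpace K] [BorelSpace K]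

theorem bddMeas_continuousMap (f : C(K, ℝ)) : BddMeas fun x => (f x : ℂ) :=
  ⟨by fun_prop, ‖f‖, fun x => by rw [Complex.norm_real]; exact f.norm_coe_le_norm x⟩

/-- Bounded Borel functions are generated by the continuous real functions. -/
theorem BddMeas.induction_continuous {p : (K → ℂ) → Prop}
    (cont : ∀ f : C(K, ℝ), p fun x => (f x : ℂ))
    (const_mul : ∀ (c : ℂ) f, BddMeas f → p f → p (fun x => c * f x))
    (add : ∀ f g, BddMeas f → BddMeas g → p f → p g → p (fun x => f x + g x))
    (lim : ∀ (F : ℕ → K → ℂ) (f : K → ℂ) (C : ℝ), (∀ n, BddMeas (F n)) →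
      (∀ n x, ‖F n x‖ ≤ C) → (∀ x, Tendsto (fun n => F n x) atTop (𝓝 (f x))) → (∀ n, p (F n)) →
      p f)
    {f : K → ℂ} (hf : BddMeas f) : p f := by
  have hb : ∀ B : Set K, MeasurableSet B → BddMeas (B.indicator fun _ => (1 : ℂ)) :=
    fun B hB => (BddMeas.const 1).indicator hB
  have one : p fun _ => 1 := by simpa using cont 1
  -- Closed sets form a π-system generating the Borel sets, and the indicator of a closed set is a
  -- limit of continuous functions bounded by one; complements and disjoint unions follow from
  -- linearity and limits.
  have ind : ∀ B : Set K, MeasurableSet B → p (B.indicator fun _ => 1) := by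
    refine MeasurableSpace.induction_on_inter (C := fun B _ => p (B.indicator fun _ => 1))
      (BorelSpace.measurable_eq.trans borel_eq_generateFrom_isClosed) isPiSystem_isClosed ?_ ?_ ?_ ?_
    · simpa using const_mul 0 _ (BddMeas.const 1) one
    · intro B hB
      have hB : IsClosed B := hB
      let g : ℕ → C(K, ℝ) := fun n => ⟨fun x => (hB.apprSeq n x : ℝ), by fun_prop⟩
      have hl := tendsto_pi_nhds.1 (HasOuterApproxClosed.tendsto_apprSeq hB)
      refine lim (fun n x => (g n x : ℂ)) _ 1 (fun n => bddMeas_continuousMap _)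
        (fun n x => ?_) (fun x => ?_) fun n => cont _
      · rw [Complex.norm_real]
        simpa [g] using HasOuterApproxClosed.apprSeq_apply_le_one hB n x
      · have h1 := (Complex.continuous_ofReal.comp NNReal.continuous_coe).continuousAt.tendsto.comp
          (hl x)
        have e : ((Complex.ofReal ∘ NNReal.toReal) (B.indicator (fun _ => 1) x)) =
            B.indicator (fun _ => (1 : ℂ)) x := by
          by_cases hx : x ∈ B <;> simp [hx]
        rw [e] at h1
        exact h1
    · intro B hB h
      have e : (Bᶜ.indicator fun _ => (1 : ℂ)) =
          fun x => (fun _ => 1) x + (fun x => -1 * B.indicator (fun _ => 1) x) x := by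
        ext x
        by_cases hx : x ∈ B <;> simp [hx]
      have hB' : MeasurableSet B := hB
      rw [e]
      exact add _ _ (BddMeas.const 1) ((BddMeas.const (-1)).mul (hb B hB')) one
        (const_mul _ _ (hb B hB') h)
    · intro B hd hB h
      have hB' : ∀ n, MeasurableSet (B n) := hB
      have hfin : ∀ n, p ((⋃ i < n, B i).indicator fun _ => 1) := by
        intro n
        induction n with
        | zero => simpa using const_mul 0 _ (BddMeas.const 1) one
        | succ n ih =>
          have e : ((⋃ i < n + 1, B i).indicator fun _ => (1 : ℂ)) = fun x =>
              (⋃ i < n, B i).indicator (fun _ => 1) x + (B n).indicator (fun _ => 1) x := by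
            rw [Set.biUnion_lt_succ]
            refine Set.indicator_union_of_disjoint ?_ _
            exact Set.disjoint_iUnion₂_left.2 fun i hi => hd hi.ne
          rw [e]
          exact add _ _ (hb _ (MeasurableSet.biUnion (to_countable _) fun i _ => hB' i))
            (hb _ (hB' n)) ih (h n)
      refine lim (fun n => (⋃ i < n, B i).indicator fun _ => 1) _ 1
        (fun n => hb _ (MeasurableSet.biUnion (to_countable _) fun i _ => hB' i))
        (fun n x => ?_) (fun x => ?_) hfin
      · refine (norm_indicator_le_norm_self _ _).trans ?_
        simp
      · refine tendsto_const_nhds.congr' ?_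
        by_cases hx : x ∈ ⋃ i, B i
        · obtain ⟨i, hi⟩ := mem_iUnion.1 hx
          filter_upwards [eventually_gt_atTop i] with n hn
          rw [indicator_of_mem hx, indicator_of_mem (mem_iUnion₂.2 ⟨i, hn, hi⟩)]
        · refine Eventually.of_forall fun n => ?_
          have hx' : x ∉ ⋃ i < n, B i := fun h => hx (iUnion₂_subset_iUnion _ _ h)
          simp only [indicator_of_notMem hx, indicator_of_notMem hx']
  refine BddMeas.induction ?_ add ?_ hf
  · intro c B hB
    have e : (B.indicator fun _ => c) = fun x => c * B.indicator (fun _ => 1) x := by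
      ext x
      by_cases hx : x ∈ B <;> simp [hx]
    rw [e]
    exact const_mul _ _ (hb B hB) (ind B hB)
  · intro F f C hm hC hl h
    exact lim F f C (fun n => ⟨hm n, C, hC n⟩) hC hl h

end BorelInduction

section QuadraticForm

variable {S X : Type*} [MeasurableSpace S] [NormedAddCommGroup X] [InnerProductSpace ℂ X]
  {ν : X → Measure S}

/-- By polarization a bounded operator is determined by its quadratic form, so a weak integral need
only be checked on the diagonal. -/
theorem isOp_of_quadratic {f : S → ℂ} {T : X →L[ℂ] X}
    (h : ∀ φ, inner ℂ φ (T φ) = ∫ x, f x ∂ν φ) : IsOp ν f T := by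
  intro φ ψ
  simp only [pairing, ← h]
  have hI : Complex.I * Complex.I = -1 := Complex.I_mul_I
  simp only [map_add, map_sub, map_smul, inner_add_left, inner_add_right, inner_sub_left,
    inner_sub_right, inner_smul_left, inner_smul_right, Complex.conj_I]
  linear_combination (-(1 / 2) * inner ℂ φ (T ψ) + 1 / 2 * inner ℂ ψ (T φ)) * hI

end QuadraticForm

section FunctionalCalculus

variable {K : Type*} [MetricSpace K] [CompactSpace K] [MeasurableSpace K] [BorelSpace K]
  {X : Type*} [NormedAddCommGroup X] [InnerProductSpace ℂ X] [CompleteSpace X]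

/-- With `g = √f` the operator `Φ f` is `(Φ g)* Φ g`, and the quadratic form is `‖Φ g φ‖²`. -/
theorem inner_starAlgHom_of_nonneg (Φ : C(K, ℝ) →⋆ₐ[ℝ] (X →L[ℂ] X)) {f : C(K, ℝ)} (hf : 0 ≤ f)
    (φ : X) : ∃ r : ℝ, 0 ≤ r ∧ inner ℂ φ (Φ f φ) = (r : ℂ) := by
  let g : C(K, ℝ) := ⟨fun x => Real.sqrt (f x), by fun_prop⟩
  have hg : f = star g * g := by
    ext x
    exact (Real.mul_self_sqrt (hf x)).symm
  refine ⟨‖Φ g φ‖ ^ 2, by positivity, ?_⟩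
  rw [hg, map_mul, map_star, ContinuousLinearMap.star_eq_adjoint]
  change inner ℂ φ (ContinuousLinearMap.adjoint (Φ g) (Φ g φ)) = _
  rw [ContinuousLinearMap.adjoint_inner_right, inner_self_eq_norm_sq_to_K]
  norm_cast

/-- Riesz-Markov for the positive functional `f ↦ ⟨φ, Φ(f)φ⟩`; on a compact space every continuous
function has compact support. The form is real because `f` is real and so `Φ f` is self-adjoint. -/
theorem exists_measure_of_starAlgHom (Φ : C(K, ℝ) →⋆ₐ[ℝ] (X →L[ℂ] X)) (φ : X) :
    ∃ μ : Measure K, IsFiniteMeasure μ ∧ ∀ f : C(K, ℝ), inner ℂ φ (Φ f φ) = ∫ x, (f x : ℂ) ∂μ := by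
  let Λ₀ : CompactlySupportedContinuousMap K ℝ →ₗ[ℝ] ℝ :=
    { toFun := fun f => (inner ℂ φ (Φ (f : C(K, ℝ)) φ)).re
      map_add' := fun f g => by
        have : ((f + g : CompactlySupportedContinuousMap K ℝ) : C(K, ℝ)) = (f : C(K, ℝ)) + g := rfl
        rw [this, map_add, add_apply, inner_add_right, Complex.add_re]
      map_smul' := fun c f => by
        have : ((c • f : CompactlySupportedContinuousMap K ℝ) : C(K, ℝ)) = c • (f : C(K, ℝ)) := rfl
        rw [this, map_smul, smul_apply, ← Complex.coe_smul, inner_smul_right,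
          Complex.re_ofReal_mul]
        rfl }
  let Λ : CompactlySupportedContinuousMap K ℝ →ₚ[ℝ] ℝ := PositiveLinearMap.mk₀ Λ₀ fun f hf => by
    obtain ⟨r, hr, h⟩ := inner_starAlgHom_of_nonneg Φ (f := (f : C(K, ℝ))) hf φ
    change 0 ≤ (inner ℂ φ (Φ (f : C(K, ℝ)) φ)).re
    rw [h]
    simpa using hr
  refine ⟨RealRMK.rieszMeasure Λ, inferInstance, fun f => ?_⟩
  have h := RealRMK.integral_rieszMeasure Λ (CompactlySupportedContinuousMap.continuousMapEquiv f)
  have h1 : ∫ x, f x ∂(RealRMK.rieszMeasure Λ) = (inner ℂ φ (Φ f φ)).re := h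
  rw [integral_complex_ofReal, h1]
  refine Complex.ext (by simp) ?_
  rw [Complex.ofReal_im]
  have hs : ContinuousLinearMap.adjoint (Φ f) = Φ f := by
    rw [← ContinuousLinearMap.star_eq_adjoint, ← map_star]
    congr 1
  have h2 : starRingEnd ℂ (inner ℂ φ (Φ f φ)) = inner ℂ φ (Φ f φ) := by
    rw [inner_conj_symm, ← ContinuousLinearMap.adjoint_inner_right, hs]
  exact Complex.conj_eq_iff_im.1 h2

/-- A continuous functional calculus is integration against a projection-valued measure. -/
theorem exists_projMeasure_of_starAlgHom (Φ : C(K, ℝ) →⋆ₐ[ℝ] (X →L[ℂ] X)) :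
    ∃ P : ProjMeasure K X, ∀ f : C(K, ℝ), IsOp P.measure (fun x => (f x : ℂ)) (Φ f) := by
  choose ν hfin hq using exists_measure_of_starAlgHom Φ
  have hν : ∀ w, ν w univ = ENNReal.ofReal (‖w‖ ^ 2) := by
    intro w
    have h := hq w 1
    rw [map_one, one_apply_eq_self, inner_self_eq_norm_sq_to_K] at h
    have h1 : ‖w‖ ^ 2 = (ν w univ).toReal := by
      have h2 : ((‖w‖ ^ 2 : ℝ) : ℂ) = (((ν w univ).toReal : ℝ) : ℂ) := by
        simpa [Measure.real] using h
      exact_mod_cast h2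
    rw [h1, ENNReal.ofReal_toReal (measure_ne_top _ _)]
  have hex : ∀ f : K → ℂ, BddMeas f →
      ∃ T : X →L[ℂ] X, ∀ φ, inner ℂ φ (T φ) = ∫ x, f x ∂ν φ := by
    intro f hf
    refine BddMeas.induction_continuous (p := fun f => ∃ T : X →L[ℂ] X, ∀ φ,
      inner ℂ φ (T φ) = ∫ x, f x ∂ν φ) ?_ ?_ ?_ ?_ hf
    · exact fun f => ⟨Φ f, fun φ => hq φ f⟩
    · rintro c f - ⟨T, hT⟩
      exact ⟨c • T, fun φ => by rw [smul_apply, inner_smul_right, hT, integral_const_mul]⟩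
    · rintro f g hf hg ⟨T, hT⟩ ⟨T', hT'⟩
      exact ⟨T + T', fun φ => by
        rw [add_apply, inner_add_right, hT, hT',
          integral_add (hf.integrable _) (hg.integrable _)]⟩
    · intro F f C hF hC hl h
      choose T hT using h
      obtain ⟨T', -, hT'⟩ := exists_isOp_of_tendsto hν (fun n => isOp_of_quadratic (hT n))
        (fun n => (hF n).measurable) hC hl
      refine ⟨T', fun φ => tendsto_nhds_unique (hT' φ φ) ?_⟩
      simp only [hT]
      exact tendsto_integral_of_dominated_convergence (fun _ => C)
        (fun n => (hF n).measurable.aestronglyMeasurable) (integrable_const C)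
        (fun n => Eventually.of_forall (hC n)) (Eventually.of_forall hl)
  choose! o ho using hex
  have hop : ∀ f, BddMeas f → IsOp ν f (o f) := fun f hf => isOp_of_quadratic (ho f hf)
  have hcont : ∀ f : C(K, ℝ), o (fun x => (f x : ℂ)) = Φ f := fun f =>
    (hop _ (bddMeas_continuousMap f)).unique (isOp_of_quadratic fun φ => hq φ f)
  have hconst : ∀ (c : ℂ) f, BddMeas f → o (fun x => c * f x) = c • o f := fun c f hf =>
    (hop _ ((BddMeas.const c).mul hf)).unique ((hop f hf).const_mul c)
  have hadd : ∀ f g, BddMeas f → BddMeas g → o (fun x => f x + g x) = o f + o g :=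
    fun f g hf hg => (hop _ (hf.add hg)).unique ((hop f hf).add (hop g hg)
      (fun _ => hf.integrable _) fun _ => hg.integrable _)
  have hlim : ∀ (F : ℕ → K → ℂ) (f : K → ℂ) (C : ℝ), (∀ n, BddMeas (F n)) → (∀ n x, ‖F n x‖ ≤ C) →
      (∀ x, Tendsto (fun n => F n x) atTop (𝓝 (f x))) → ∀ φ ψ,
      Tendsto (fun n => inner ℂ ψ (o (F n) φ)) atTop (𝓝 (inner ℂ ψ (o f φ))) := by
    intro F f C hF hC hl φ ψ
    have hf : BddMeas f := ⟨measurable_of_tendsto_metrizable (fun n => (hF n).measurable)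
      (tendsto_pi_nhds.2 hl), C, fun x => le_of_tendsto (hl x).norm
        (Eventually.of_forall fun n => hC n x)⟩
    obtain ⟨T', hT', h⟩ := exists_isOp_of_tendsto hν (fun n => hop _ (hF n))
      (fun n => (hF n).measurable) hC hl
    rw [(hop f hf).unique hT']
    exact h φ ψ
  have hlim_mul : ∀ (F : ℕ → K → ℂ) (f g : K → ℂ) (C : ℝ), BddMeas g → (∀ n, BddMeas (F n)) →
      (∀ n x, ‖F n x‖ ≤ C) → (∀ x, Tendsto (fun n => F n x) atTop (𝓝 (f x))) → ∀ φ ψ,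
      Tendsto (fun n => inner ℂ ψ (o (fun x => F n x * g x) φ)) atTop
        (𝓝 (inner ℂ ψ (o (fun x => f x * g x) φ))) := by
    intro F f g C hg hF hC hl
    obtain ⟨D, hD⟩ := hg.bdd
    refine hlim (fun n x => F n x * g x) _ (C * D) (fun n => (hF n).mul hg) (fun n x => ?_)
      (fun x => (hl x).mul_const _)
    rw [norm_mul]
    exact mul_le_mul (hC n x) (hD x) (norm_nonneg _) ((norm_nonneg _).trans (hC n x))
  -- Multiplicativity is known for two continuous factors. It is extended one factor at a time:
  -- first a Borel function times a continuous one, then two Borel functions.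
  have hmul_cont : ∀ (f : K → ℂ) (_ : BddMeas f) (g : C(K, ℝ)),
      o (fun x => f x * g x) = o f * Φ g := by
    intro f hf g
    have hg := bddMeas_continuousMap g
    refine BddMeas.induction_continuous (p := fun f => o (fun x => f x * g x) = o f * Φ g)
      ?_ ?_ ?_ ?_ hf
    · intro f
      rw [hcont, ← map_mul, ← hcont]
      simp
    · intro c f hf h
      simp only [mul_assoc]
      rw [hconst _ _ (hf.mul hg), hconst _ _ hf, h, smul_mul_assoc]
    · intro f f' hf hf' h h'
      simp only [add_mul]
      rw [hadd _ _ (hf.mul hg) (hf'.mul hg), hadd _ _ hf hf', h, h', add_mul]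
    · intro F f C hF hC hl h
      ext φ
      refine ext_inner_left ℂ fun ψ => ?_
      refine tendsto_nhds_unique (hlim_mul F f _ C hg hF hC hl φ ψ) ?_
      simp only [h]
      exact hlim F f C hF hC hl (Φ g φ) ψ
  have hmul : ∀ f g : K → ℂ, BddMeas f → BddMeas g → o (fun x => f x * g x) = o f * o g := by
    intro f g hf hg
    refine BddMeas.induction_continuous (p := fun g => o (fun x => f x * g x) = o f * o g)
      ?_ ?_ ?_ ?_ hg
    · intro g
      rw [hmul_cont f hf g, hcont]
    · intro c g hg h
      simp only [mul_left_comm]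
      rw [hconst _ _ (hf.mul hg), hconst _ _ hg, h, mul_smul_comm]
    · intro g g' hg hg' h h'
      simp only [mul_add]
      rw [hadd _ _ (hf.mul hg) (hf.mul hg'), hadd _ _ hg hg', h, h', mul_add]
    · intro F g C hF hC hl h
      ext φ
      refine ext_inner_left ℂ fun ψ => ?_
      have h1 := hlim_mul F g f C hf hF hC hl φ ψ
      simp only [mul_comm _ (f _)] at h1
      refine tendsto_nhds_unique h1 ?_
      simp only [h]
      change Tendsto (fun n => inner ℂ ψ (o f (o (F n) φ))) atTop (𝓝 (inner ℂ ψ (o f (o g φ))))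
      simp only [← ContinuousLinearMap.adjoint_inner_left (o f)]
      exact hlim F g C hF hC hl φ _
  have hb : ∀ B : Set K, MeasurableSet B → BddMeas (B.indicator fun _ => (1 : ℂ)) :=
    fun B hB => (BddMeas.const 1).indicator hB
  have hinter : ∀ B C, MeasurableSet B → MeasurableSet C →
      o ((B ∩ C).indicator fun _ => 1) =
        o (B.indicator fun _ => 1) * o (C.indicator fun _ => 1) := by
    intro B C hB hC
    rw [← hmul _ _ (hb B hB) (hb C hC)]
    congr 1
    ext x
    by_cases h1 : x ∈ B <;> by_cases h2 : x ∈ C <;> simp [h1, h2]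
  have hint : ∀ B, MeasurableSet B → ∀ φ,
      ∫ x, B.indicator (fun _ => (1 : ℂ)) x ∂ν φ = (((ν φ B).toReal : ℝ) : ℂ) := by
    intro B hB φ
    rw [integral_indicator hB]
    simp [Measure.real]
  have hproj : ∀ B, MeasurableSet B → IsStarProjection (o (B.indicator fun _ => 1)) := by
    intro B hB
    refine ⟨?_, ?_⟩
    · rw [IsIdempotentElem, ← hinter B B hB hB, inter_self]
    · rw [IsSelfAdjoint, ContinuousLinearMap.star_eq_adjoint]
      refine (isOp_of_quadratic (ν := ν) fun φ => ?_).unique (hop _ (hb B hB))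
      rw [ContinuousLinearMap.adjoint_inner_right, ← inner_conj_symm, ho _ (hb B hB), hint B hB,
        Complex.conj_ofReal]
  refine ⟨⟨fun B => o (B.indicator fun _ => 1), ν, hproj, ?_, hinter, ?_⟩, fun f =>
    isOp_of_quadratic fun φ => hq φ f⟩
  · have := hcont 1
    simpa using this
  · intro B hB φ
    have h1 : inner ℂ φ (o (B.indicator fun _ => 1) φ) =
        ((‖o (B.indicator fun _ => 1) φ‖ ^ 2 : ℝ) : ℂ) := by
      have h2 : o (B.indicator fun _ => 1) φ =
          o (B.indicator fun _ => 1) (o (B.indicator fun _ => 1) φ) :=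
        (congrArg (fun T : X →L[ℂ] X => T φ) (hproj B hB).isIdempotentElem).symm
      have h3 : ContinuousLinearMap.adjoint (o (B.indicator fun _ => 1)) =
        o (B.indicator fun _ => 1) := (hproj B hB).isSelfAdjoint
      conv_lhs => rw [h2, ← ContinuousLinearMap.adjoint_inner_left, h3]
      rw [inner_self_eq_norm_sq_to_K]
      norm_cast
    rw [ho _ (hb B hB), hint B hB] at h1
    have h4 : (ν φ B).toReal = ‖o (B.indicator fun _ => 1) φ‖ ^ 2 := by exact_mod_cast h1
    rw [← h4, ENNReal.ofReal_toReal (measure_ne_top _ _)]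

end FunctionalCalculus

/-! ### Countable additivity and push-forward of projection-valued measures. -/

namespace ProjMeasure

variable {S X : Type*} [MeasurableSpace S] [NormedAddCommGroup X] [InnerProductSpace ℂ X]
  [CompleteSpace X] (P : ProjMeasure S X)

theorem op_indicator_one {B : Set S} (hB : MeasurableSet B) :
    P.op (B.indicator fun _ => 1) = P.proj B := by
  rw [P.op_indicator_const _ hB, one_smul]

theorem measure_proj {B : Set S} (hB : MeasurableSet B) (φ : X) :
    P.measure (P.proj B φ) = (P.measure φ).restrict B := by
  ext C hC
  rw [Measure.restrict_apply hC, P.measure_apply _ hC, P.measure_apply _ (hC.inter hB),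
    P.proj_inter C B hC hB]
  rfl

/-- Strong countable additivity. -/
theorem hasSum_proj {B : ℕ → Set S} (hB : ∀ n, MeasurableSet (B n))
    (hd : Pairwise (Function.onFun Disjoint B)) (φ : X) :
    HasSum (fun n => P.proj (B n) φ) (P.proj (⋃ n, B n) φ) := by
  have hb : ∀ B : Set S, MeasurableSet B → BddMeas (B.indicator fun _ => (1 : ℂ)) :=
    fun B hB => (BddMeas.const 1).indicator hB
  have hsum : ∀ F : Finset ℕ, P.op ((⋃ n ∈ F, B n).indicator fun _ => 1) φ =
      ∑ n ∈ F, P.proj (B n) φ := by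
    intro F
    induction F using Finset.induction_on with
    | empty =>
      have : ((⋃ n ∈ (∅ : Finset ℕ), B n).indicator fun _ => (1 : ℂ)) = fun _ => 0 := by simp
      rw [this, P.op_const]
      simp
    | insert n F hn ih =>
      have e : ((⋃ i ∈ insert n F, B i).indicator fun _ => (1 : ℂ)) = fun x =>
          (B n).indicator (fun _ => 1) x + (⋃ i ∈ F, B i).indicator (fun _ => 1) x := by
        rw [Finset.set_biUnion_insert]
        refine Set.indicator_union_of_disjoint ?_ _
        refine Set.disjoint_iUnion₂_right.2 fun i hi => hd ?_
        rintro rfl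
        exact hn hi
      rw [e, P.op_add (hb _ (hB n)) (hb _ (Finset.measurableSet_biUnion F fun i _ => hB i)),
        Finset.sum_insert hn, ← ih, P.op_indicator_one (hB n), add_apply]
  have hU := MeasurableSet.iUnion hB
  rw [HasSum, ← P.op_indicator_one hU]
  simp only [← hsum]
  -- Indicators of finite unions converge pointwise to that of the whole union, so additivity of the
  -- scalar measures already yields strong additivity of the projections.
  refine P.tendsto_op (l := atTop)
    (F := fun F : Finset ℕ => (⋃ n ∈ F, B n).indicator fun _ => (1 : ℂ)) (C := 1)
    (Eventually.of_forall fun F => (hb _ (Finset.measurableSet_biUnion F fun i _ => hB i)).measurable)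
    (Eventually.of_forall fun F x => (norm_indicator_le_norm_self _ _).trans (by simp))
    (hb _ hU).measurable (fun x => (norm_indicator_le_norm_self _ _).trans (by simp)) φ
    (Eventually.of_forall fun x => ?_)
  exact (tendsto_indicator_biUnion_finset B (fun _ => (1 : ℂ)) x).mono_right
    (by simp)

/-- The image of a projection-valued measure under a real function. -/
def toResolution (g : S → ℝ) (hg : Measurable g) : ResolutionOfIdentity X where
  proj B := P.proj (g ⁻¹' B)
  isProj B hB := P.isProj _ (hg hB)
  proj_univ := P.proj_univ
  proj_inter B C hB hC := P.proj_inter _ _ (hg hB) (hg hC)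
  hasSum_proj B hB hd φ := by
    rw [preimage_iUnion]
    exact P.hasSum_proj (fun n => hg (hB n)) (fun i j hij => (hd hij).preimage g) φ

end ProjMeasure

namespace ResolutionOfIdentity

variable {X : Type*} [NormedAddCommGroup X] [InnerProductSpace ℂ X] [CompleteSpace X]
  (E : ResolutionOfIdentity X)

theorem measure_apply {B : Set ℝ} (hB : MeasurableSet B) (φ : X) :
    E.measure φ B = ENNReal.ofReal (‖E.proj B φ‖ ^ 2) := by
  rw [measure, Measure.ofMeasurable_apply B hB, E.inner_proj_eq hB]

/-- A resolution of the identity as a projection-valued measure on `ℝ`. -/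
def toProjMeasure : ProjMeasure ℝ X where
  proj := E.proj
  measure := E.measure
  isProj := E.isProj
  proj_univ := E.proj_univ
  proj_inter := E.proj_inter
  measure_apply _ hB φ := E.measure_apply hB φ

end ResolutionOfIdentity

theorem ProjMeasure.measure_toResolution {S X : Type*} [MeasurableSpace S] [NormedAddCommGroup X]
    [InnerProductSpace ℂ X] [CompleteSpace X] (P : ProjMeasure S X) {g : S → ℝ}
    (hg : Measurable g) (φ : X) :
    (P.toResolution g hg).measure φ = (P.measure φ).map g := by
  ext B hB
  rw [ResolutionOfIdentity.measure_apply _ hB, Measure.map_apply hg hB,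
    P.measure_apply _ (hg hB)]
  rfl

/-! ### The spectral theorem for normal nonnegative operators -/

section SpectralTheorem

variable {X : Type*} [NormedAddCommGroup X] [InnerProductSpace ℂ X] [CompleteSpace X]
  {L : X →ₗ.[ℂ] X}

/-- Complex polarization: reality of the form at `φ + ψ` and at `φ + iψ` gives the imaginary and the
real part of the identity. -/
theorem IsNonneg.inner_symm (hn : IsNonneg L) (φ ψ : L.domain) :
    inner ℂ (L φ) (ψ : X) = inner ℂ (φ : X) (L ψ) := by
  have h1 := (hn (φ + ψ)).1
  have h2 := (hn (φ + Complex.I • ψ)).1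
  have h3 := (hn φ).1
  have h4 := (hn ψ).1
  simp only [LinearPMap.map_add, LinearPMap.map_smul, Submodule.coe_add, Submodule.coe_smul,
    inner_add_left, inner_add_right, inner_smul_left, inner_smul_right, Complex.conj_I,
    Complex.add_im, Complex.add_re, Complex.mul_im, Complex.mul_re, Complex.neg_im, Complex.neg_re, Complex.I_re,
    Complex.I_im] at h1 h2
  rw [← inner_conj_symm]
  apply Complex.ext
  · rw [Complex.conj_re]
    linarith
  · rw [Complex.conj_im]
    linarith

/-- This is self-adjointness without mention of `L†`: symmetry puts `L` inside its adjoint, and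
normality says that the two domains coincide. -/
theorem IsNormalOp.eq_of_mem_adjoint (hL : IsNormalOp L) (hn : IsNonneg L) {w w' : X}
    (h : ∀ φ : L.domain, inner ℂ w' (φ : X) = inner ℂ w (L φ)) :
    ∃ hw : w ∈ L.domain, L ⟨w, hw⟩ = w' := by
  have hw : w ∈ L.adjoint.domain := LinearPMap.mem_adjoint_domain_of_exists w ⟨w', h⟩
  have hw' : w ∈ L.domain := hL.domain_eq ▸ hw
  refine ⟨hw', ?_⟩
  have h1 : L.adjoint ⟨w, hw⟩ = w' := LinearPMap.adjoint_apply_eq hL.dense ⟨w, hw⟩ h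
  rw [← h1]
  refine (LinearPMap.IsFormalAdjoint.le_adjoint hL.dense fun x y => ?_).2 rfl
  exact hn.inner_symm x y

/-- The cross term in `‖φ + Lφ‖² = ‖φ‖² + 2 Re⟨φ, Lφ⟩ + ‖Lφ‖²` is nonnegative. -/
theorem IsNonneg.norm_le (hn : IsNonneg L) (φ : L.domain) :
    ‖(φ : X)‖ ≤ ‖(φ : X) + L φ‖ ∧ ‖L φ‖ ≤ ‖(φ : X) + L φ‖ := by
  have h := norm_add_sq (𝕜 := ℂ) (φ : X) (L φ)
  have h1 := (hn φ).2
  rw [RCLike.re_to_complex] at h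
  constructor <;> refine (sq_le_sq₀ (norm_nonneg _) (norm_nonneg _)).1 ?_ <;>
    nlinarith [sq_nonneg ‖(φ : X)‖, sq_nonneg ‖L φ‖]

/-- The range of `1 + L` is closed, since `‖φ + Lφ‖` controls the norm on the complete graph of `L`.
It is dense, since a vector `w` orthogonal to it satisfies `Lw = -w`, which nonnegativity allows
only for `w = 0`. -/
theorem IsNormalOp.exists_add_eq (hL : IsNormalOp L) (hn : IsNonneg L) (ψ : X) :
    ∃ φ : L.domain, (φ : X) + L φ = ψ := by
  have hc : IsClosed (L.graph : Set (X × X)) := hL.closed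
  have : CompleteSpace L.graph := hc.completeSpace_coe
  let f : L.graph →L[ℂ] X :=
    (ContinuousLinearMap.fst ℂ X X + ContinuousLinearMap.snd ℂ X X) ∘L L.graph.subtypeL
  have hf : ∀ p : L.graph, f p = p.1.1 + p.1.2 := fun p => rfl
  have hanti : AntilipschitzWith 1 f := by
    refine AddMonoidHomClass.antilipschitz_of_bound f fun p => ?_
    obtain ⟨φ, h1, h2⟩ := L.mem_graph_iff.1 p.2
    rw [hf, ← h1, ← h2, NNReal.coe_one, one_mul]
    change ‖p.1‖ ≤ _
    rw [Prod.norm_def, ← h1, ← h2]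
    exact max_le (hn.norm_le φ).1 (hn.norm_le φ).2
  have hclosed : IsClosed (f.range : Set X) := hanti.isClosed_range f.uniformContinuous
  have htop : f.range = ⊤ := by
    rw [← hclosed.submodule_topologicalClosure_eq, Submodule.topologicalClosure_eq_top_iff,
      Submodule.eq_bot_iff]
    intro w hw
    have h0 : ∀ φ : L.domain, inner ℂ (-w) (φ : X) = inner ℂ w (L φ) := by
      intro φ
      have h1 : inner ℂ ((φ : X) + L φ) w = 0 :=
        (Submodule.mem_orthogonal _ w).1 hw _ ⟨⟨((φ : X), L φ), L.mem_graph φ⟩, rfl⟩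
      have h2 : inner ℂ w ((φ : X) + L φ) = 0 := inner_eq_zero_symm.1 h1
      rw [inner_add_right] at h2
      rw [inner_neg_left]
      linear_combination -h2
    obtain ⟨hw', h1⟩ := hL.eq_of_mem_adjoint hn h0
    have h2 := (hn ⟨w, hw'⟩).2
    rw [h1, inner_neg_right, inner_self_eq_norm_sq_to_K] at h2
    have h3 : 0 ≤ -‖w‖ ^ 2 := by
      have : (-((‖w‖ : ℂ)) ^ 2).re = -‖w‖ ^ 2 := by
        rw [← Complex.ofReal_pow, ← Complex.ofReal_neg, Complex.ofReal_re]
      rw [← this]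
      exact h2
    have h4 : ‖w‖ ^ 2 = 0 := le_antisymm (by linarith) (by positivity)
    simpa using h4
  obtain ⟨p, hp⟩ : ψ ∈ f.range := htop ▸ Submodule.mem_top
  obtain ⟨φ, h1, h2⟩ := L.mem_graph_iff.1 p.2
  exact ⟨φ, by rw [← hp, h1, h2]; rfl⟩

/-- The resolvent `(1 + L)⁻¹`. -/
theorem IsNormalOp.exists_resolvent (hL : IsNormalOp L) (hn : IsNonneg L) :
    ∃ T : X →L[ℂ] X, IsSelfAdjoint T ∧ (∀ φ : L.domain, T ((φ : X) + L φ) = φ) ∧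
      ∀ ψ, ∃ φ : L.domain, T ψ = φ ∧ (φ : X) + L φ = ψ := by
  choose R hR using hL.exists_add_eq hn
  have hinj : ∀ φ φ' : L.domain, (φ : X) + L φ = φ' + L φ' → φ = φ' := by
    intro φ φ' h
    have h1 := (hn.norm_le (φ - φ')).1
    rw [L.map_sub, Submodule.coe_sub, sub_add_sub_comm, h, sub_self, norm_zero] at h1
    exact Subtype.ext (sub_eq_zero.1 (norm_le_zero_iff.1 h1))
  let T₀ : X →ₗ[ℂ] X :=
    { toFun := fun ψ => (R ψ : X)
      map_add' := fun ψ χ => by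
        rw [← Submodule.coe_add]
        congr 1
        refine hinj _ _ ?_
        rw [hR, L.map_add, Submodule.coe_add, add_add_add_comm, hR, hR]
      map_smul' := fun c ψ => by
        rw [RingHom.id_apply, ← Submodule.coe_smul]
        congr 1
        refine hinj _ _ ?_
        rw [hR, L.map_smul, Submodule.coe_smul, ← smul_add, hR] }
  let T : X →L[ℂ] X := T₀.mkContinuous 1 fun ψ => by
    have := (hn.norm_le (R ψ)).1
    rw [hR] at this
    rw [one_mul]
    exact this
  have hT : ∀ ψ, T ψ = R ψ := fun ψ => rfl
  refine ⟨T, ?_, fun φ => ?_, fun ψ => ⟨R ψ, hT ψ, hR ψ⟩⟩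
  · rw [ContinuousLinearMap.isSelfAdjoint_iff_isSymmetric]
    intro ψ χ
    change inner ℂ (R ψ : X) χ = inner ℂ ψ (R χ : X)
    conv_lhs => rw [← hR χ]
    conv_rhs => rw [← hR ψ]
    rw [inner_add_left, inner_add_right, hn.inner_symm]
  · rw [hT]
    congr 1
    exact hinj _ _ (hR _)

theorem exists_projMeasure_of_isSelfAdjoint {T : X →L[ℂ] X} (hT : IsSelfAdjoint T) :
    ∃ P : ProjMeasure (spectrum ℝ T) X, P.op (fun t => ((t : ℝ) : ℂ)) = T := by
  have : CompactSpace (spectrum ℝ T) := ContinuousFunctionalCalculus.compactSpace_spectrum T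
  obtain ⟨P, hP⟩ := exists_projMeasure_of_starAlgHom (cfcHom hT (R := ℝ))
  refine ⟨P, P.op_eq_of_isOp ?_⟩
  have := hP ((ContinuousMap.id ℝ).restrict (spectrum ℝ T))
  rwa [cfcHom_id] at this

/-- The spectral theorem. -/
theorem IsNormalOp.exists_resolves (hL : IsNormalOp L) (hn : IsNonneg L) :
    ∃ E : ResolutionOfIdentity X, E.Resolves L := by
  obtain ⟨T, hTs, hTL, hTR⟩ := hL.exists_resolvent hn
  obtain ⟨P, hP⟩ := exists_projMeasure_of_isSelfAdjoint hTs
  have : CompactSpace (spectrum ℝ T) := ContinuousFunctionalCalculus.compactSpace_spectrum T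
  have hid : BddMeas fun t : spectrum ℝ T => ((t : ℝ) : ℂ) :=
    bddMeas_continuousMap ((ContinuousMap.id ℝ).restrict (spectrum ℝ T))
  have hsub : BddMeas fun t : spectrum ℝ T => (1 : ℂ) - ((t : ℝ) : ℂ) := by
    simpa only [sub_eq_add_neg, neg_one_mul] using
      (BddMeas.const 1).add ((BddMeas.const (-1)).mul hid)
  have hsubop : ∀ ψ, P.op (fun t : spectrum ℝ T => (1 : ℂ) - ((t : ℝ) : ℂ)) ψ = ψ - T ψ := by
    intro ψ
    rw [P.op_sub (BddMeas.const 1) hid, hP, P.op_const, one_smul]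
    rfl
  have hPa : ∀ ψ, P.op (fun t : spectrum ℝ T => ((t : ℝ) : ℂ)) ψ = T ψ := fun ψ => by rw [hP]
  -- The resolvent is injective, so its spectral projection at `t = 0` vanishes and the conventional
  -- value of `1/t` there plays no role.
  have hne : ∀ φ, ∀ᵐ t : spectrum ℝ T ∂P.measure φ, (t : ℝ) ≠ 0 := by
    intro φ
    set B : Set (spectrum ℝ T) := {t | (t : ℝ) = 0} with hBd
    have hB : MeasurableSet B := measurable_subtype_coe (measurableSet_singleton 0)
    have h1 : T (P.proj B φ) = 0 := by
      rw [← hPa, ← P.op_indicator_one hB,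
        P.op_op hid ((BddMeas.const 1).indicator hB)]
      have : (fun t : spectrum ℝ T => ((t : ℝ) : ℂ) * B.indicator (fun _ => 1) t) =
          fun _ => 0 := by
        ext t
        by_cases ht : t ∈ B
        · have : (t : ℝ) = 0 := ht
          simp [this]
        · simp [ht]
      rw [this, P.op_const]
      simp
    have h2 : P.proj B φ = 0 := by
      obtain ⟨χ, h3, h4⟩ := hTR (P.proj B φ)
      have h5 : χ = 0 := Subtype.ext (h3.symm.trans h1)
      rw [← h4, h5, L.map_zero]
      simp
    rw [ae_iff]
    have h6 := P.measure_apply B hB φ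
    rw [h2] at h6
    simpa [hBd] using h6
  have hgm : Measurable fun t : spectrum ℝ T => (t : ℝ)⁻¹ - 1 := by fun_prop
  refine ⟨P.toResolution (fun t => (t : ℝ)⁻¹ - 1) hgm, ⟨fun φ => ?_, fun φ => ?_⟩⟩
  · rw [P.measure_toResolution, lintegral_map (by fun_prop) hgm]
    constructor
    · intro hφ
      set ψ := φ + L ⟨φ, hφ⟩ with hψ
      have h1 : φ = P.op (fun t => ((t : ℝ) : ℂ)) ψ := by rw [hP, hTL ⟨φ, hφ⟩]
      rw [h1, P.measure_op hid, lintegral_withDensity_eq_lintegral_mul _ (by fun_prop)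
        (by fun_prop)]
      refine (lintegral_mono (g := fun t : spectrum ℝ T =>
        ENNReal.ofReal (‖(1 : ℂ) - ((t : ℝ) : ℂ)‖ ^ 2)) fun t => ?_).trans_lt
          (Integrable.lintegral_lt_top (hsub.integrable_norm_sq _))
      simp only [Pi.mul_apply]
      rw [← ENNReal.ofReal_mul (by positivity), ← Complex.ofReal_one, ← Complex.ofReal_sub,
        Complex.norm_real, Complex.norm_real, Real.norm_eq_abs, Real.norm_eq_abs, sq_abs, sq_abs,
        ← mul_pow]
      refine ENNReal.ofReal_le_ofReal ?_
      rcases eq_or_ne (t : ℝ) 0 with h0 | h0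
      · simp [h0]
      · rw [mul_sub, mul_inv_cancel₀ h0, mul_one]
    · intro hI
      have hint : Integrable (fun t : spectrum ℝ T => ((t : ℝ)⁻¹ - 1) ^ 2) (P.measure φ) :=
        ⟨by fun_prop, by rwa [hasFiniteIntegral_iff_ofReal (Eventually.of_forall fun t => sq_nonneg _)]⟩
      set M := Real.sqrt (∫ t : spectrum ℝ T, ((t : ℝ)⁻¹ - 1) ^ 2 ∂P.measure φ) with hM
      -- Since `Dom L = Dom L†`, it is enough that `χ ↦ ⟨φ, Lχ⟩` be bounded. On the sets `A n`, away
      -- from `t = 0`, the symbol `1/t - 1` is bounded and can be moved onto `φ` with norm at most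
      -- `M`; then `A n` exhausts the spectrum.
      have hbound : ∀ χ : L.domain, ‖inner ℂ φ (L χ)‖ ≤ M * ‖(χ : X)‖ := by
        intro χ
        set ψ := (χ : X) + L χ with hψ
        have h1 : (χ : X) = P.op (fun t => ((t : ℝ) : ℂ)) ψ := by rw [hP, hTL χ]
        have h2 : L χ = P.op (fun t : spectrum ℝ T => (1 : ℂ) - ((t : ℝ) : ℂ)) ψ := by
          rw [hsubop, hTL χ, hψ, add_sub_cancel_left]
        let A : ℕ → Set (spectrum ℝ T) := fun n => {t | 1 / ((n : ℝ) + 1) < |(t : ℝ)|}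
        have hA : ∀ n, MeasurableSet (A n) := fun n =>
          measurableSet_lt measurable_const (by fun_prop)
        let e : ℕ → spectrum ℝ T → ℂ := fun n => (A n).indicator fun _ => 1
        have he : ∀ n, BddMeas (e n) := fun n => (BddMeas.const 1).indicator (hA n)
        let k : ℕ → spectrum ℝ T → ℂ := fun n => (A n).indicator fun t => (((t : ℝ)⁻¹ - 1 : ℝ) : ℂ)
        have hk : ∀ n, BddMeas (k n) := by
          intro n
          refine ⟨Measurable.indicator (by fun_prop) (hA n), (n : ℝ) + 1 + 1, fun t => ?_⟩
          by_cases ht : t ∈ A n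
          · have ht' : 1 / ((n : ℝ) + 1) < |(t : ℝ)| := ht
            simp only [k, indicator_of_mem ht]
            rw [Complex.norm_real]
            refine (norm_sub_le _ _).trans ?_
            rw [norm_one, norm_inv, Real.norm_eq_abs]
            gcongr
            rw [inv_le_comm₀ (lt_trans (by positivity) ht') (by positivity), ← one_div]
            exact ht'.le
          · simp only [k, indicator_of_notMem ht, norm_zero]
            positivity
        have hkM : ∀ n, ‖P.op (k n) φ‖ ≤ M := by
          intro n
          rw [hM]
          refine Real.le_sqrt_of_sq_le ?_
          rw [P.norm_op_sq (hk n)]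
          refine integral_mono ((hk n).integrable_norm_sq _) hint fun t => ?_
          by_cases ht : t ∈ A n
          · simp only [k, indicator_of_mem ht]
            rw [Complex.norm_real, Real.norm_eq_abs, sq_abs]
          · simp only [k, indicator_of_notMem ht]
            simp only [norm_zero, ne_eq, OfNat.ofNat_ne_zero, not_false_eq_true, zero_pow]
            positivity
        have hstep : ∀ n, inner ℂ (P.op (e n) φ) (L χ) = inner ℂ (P.op (k n) φ) (χ : X) := by
          intro n
          rw [h2, h1, ← ContinuousLinearMap.adjoint_inner_right,
            ← ContinuousLinearMap.adjoint_inner_right (P.op (k n)), P.adjoint_op (he n),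
            P.adjoint_op (hk n), P.op_op (he n).conj hsub, P.op_op (hk n).conj hid]
          congr 3
          ext t
          by_cases ht : t ∈ A n
          · have ht' : 1 / ((n : ℝ) + 1) < |(t : ℝ)| := ht
            have h0 : (t : ℝ) ≠ 0 := abs_pos.1 (lt_trans (by positivity) ht')
            have h0' : ((t : ℝ) : ℂ) ≠ 0 := by exact_mod_cast h0
            simp only [e, k, indicator_of_mem ht, Complex.conj_ofReal, map_one]
            push_cast
            field_simp
          · simp [e, k, indicator_of_notMem ht]
        have hlim : Tendsto (fun n => P.op (e n) φ) atTop (𝓝 φ) := by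
          have h3 := P.tendsto_op (l := atTop) (F := e) (f := fun _ => 1) (C := 1)
            (Eventually.of_forall fun n => (he n).measurable)
            (Eventually.of_forall fun n t => (norm_indicator_le_norm_self _ _).trans (by simp))
            measurable_const (by simp) φ ((hne φ).mono fun t ht => ?_)
          · rwa [P.op_const, one_smul] at h3
          · refine tendsto_const_nhds.congr' ?_
            have h4 := tendsto_one_div_add_atTop_nhds_zero_nat (𝕜 := ℝ)
            have h5 : 0 < |(t : ℝ)| := abs_pos.2 ht
            filter_upwards [h4.eventually (gt_mem_nhds h5)] with n hn
            have hn : t ∈ A n := hn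
            simp only [e, indicator_of_mem hn]
        refine le_of_tendsto (hlim.inner tendsto_const_nhds).norm (Eventually.of_forall fun n => ?_)
        rw [hstep]
        exact (norm_inner_le_norm _ _).trans
          (mul_le_mul_of_nonneg_right (hkM n) (norm_nonneg _))
      rw [← hL.domain_eq, LinearPMap.mem_adjoint_domain_iff]
      exact (((innerₛₗ ℂ φ).comp L.toFun).mkContinuous M hbound).continuous
  · rw [P.measure_toResolution, integral_map hgm.aemeasurable (by fun_prop)]
    set ψ := (φ : X) + L φ with hψ
    have h1 : (φ : X) = P.op (fun t => ((t : ℝ) : ℂ)) ψ := by rw [hP, hTL φ]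
    have h2 : L φ = P.op (fun t : spectrum ℝ T => (1 : ℂ) - ((t : ℝ) : ℂ)) ψ := by
      rw [hsubop, hTL φ, hψ, add_sub_cancel_left]
    rw [h2, h1, ← ContinuousLinearMap.adjoint_inner_right, P.adjoint_op hid,
      P.op_op hid.conj hsub, P.inner_op (hid.conj.mul hsub), P.pairing_self, P.measure_op hid]
    have hd : (fun t : spectrum ℝ T => ENNReal.ofReal (‖((t : ℝ) : ℂ)‖ ^ 2)) =
        fun t : spectrum ℝ T => ((Real.toNNReal (‖((t : ℝ) : ℂ)‖ ^ 2) : NNReal) : ℝ≥0∞) := rfl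
    rw [hd, integral_withDensity_eq_integral_smul (by fun_prop), ← integral_complex_ofReal]
    refine integral_congr_ae (Eventually.of_forall fun t => ?_)
    simp only [NNReal.smul_def, smul_eq_mul, Complex.conj_ofReal]
    rw [Real.coe_toNNReal _ (by positivity), Complex.norm_real, Real.norm_eq_abs, sq_abs]
    rcases eq_or_ne (t : ℝ) 0 with h0 | h0
    · simp [h0]
    · have h0' : ((t : ℝ) : ℂ) ≠ 0 := by exact_mod_cast h0
      push_cast
      field_simp

/-- The spectral measures of a nonnegative operator are carried by `[0, ∞)`. -/
theorem ResolutionOfIdentity.Resolves.measure_Iio {E : ResolutionOfIdentity X} (hE : E.Resolves L)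
    (hn : IsNonneg L) (φ : X) : E.measure φ (Iio 0) = 0 := by
  have hfin : ∀ φ, IsFiniteMeasure (E.measure φ) := fun φ =>
    inferInstanceAs (IsFiniteMeasure (E.toProjMeasure.measure φ))
  -- On a bounded piece of the negative axis the projected vector lies in `Dom L`. Its form is the
  -- integral of a negative function yet is nonnegative, so the piece carries no mass.
  have key : ∀ n : ℕ, E.measure φ (Ico (-(n : ℝ)) 0) = 0 := by
    intro n
    set B := Ico (-(n : ℝ)) 0 with hB
    have hBm : MeasurableSet B := measurableSet_Ico
    have hr : E.measure (E.proj B φ) = (E.measure φ).restrict B :=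
      E.toProjMeasure.measure_proj hBm φ
    have hdom : E.proj B φ ∈ L.domain := by
      rw [hE.mem_domain_iff, hr]
      refine (setLIntegral_mono (g := fun _ => ENNReal.ofReal ((n : ℝ) ^ 2)) measurable_const
        fun l hl => ENNReal.ofReal_le_ofReal ?_).trans_lt ?_
      · obtain ⟨h1, h2⟩ := hl
        nlinarith
      · rw [lintegral_const]
        exact ENNReal.mul_lt_top ENNReal.ofReal_lt_top (measure_lt_top _ _)
    have h1 := (hn ⟨_, hdom⟩).2
    rw [hE.inner_eq ⟨_, hdom⟩, Complex.ofReal_re, hr] at h1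
    have hint : IntegrableOn (fun l : ℝ => -l) B (E.measure φ) := by
      refine Integrable.of_bound (by fun_prop) (n : ℝ) ?_
      filter_upwards [ae_restrict_mem hBm] with l hl
      rw [norm_neg, Real.norm_eq_abs, abs_le]
      exact ⟨hl.1, hl.2.le.trans (by positivity)⟩
    have hpos : 0 ≤ᵐ[(E.measure φ).restrict B] fun l => -l := by
      filter_upwards [ae_restrict_mem hBm] with l hl
      have := hl.2
      simp only [Pi.zero_apply]
      linarith
    have h2 : ∫ l in B, -l ∂E.measure φ = 0 :=
      le_antisymm (by rw [integral_neg]; linarith) (integral_nonneg_of_ae hpos)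
    have h3 := (integral_eq_zero_iff_of_nonneg_ae hpos hint).1 h2
    rw [← Measure.restrict_eq_zero, ← ae_eq_bot, ← eventually_false_iff_eq_bot]
    filter_upwards [h3, ae_restrict_mem hBm] with l hl hlB
    exact hlB.2.ne (neg_eq_zero.1 hl)
  have e : Iio (0 : ℝ) = ⋃ n : ℕ, Ico (-(n : ℝ)) 0 := by
    ext l
    simp only [mem_Iio, mem_iUnion, mem_Ico]
    refine ⟨fun h => ?_, fun ⟨n, h⟩ => h.2⟩
    obtain ⟨n, hn⟩ := exists_nat_ge (-l)
    exact ⟨n, by linarith, h⟩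
  rw [e]
  exact measure_iUnion_null key

end SpectralTheorem

/-! ### Operators acting fibrewise on `L²` -/

section Fibre

variable {A X : Type*} [MeasurableSpace A] {μ : Measure A} [NormedAddCommGroup X]
  [InnerProductSpace ℂ X]

theorem exists_clm_of_fibre {T : A → X →L[ℂ] X} {C : ℝ} (hC : ∀ a x, ‖T a x‖ ≤ C * ‖x‖)
    (hT : ∀ g : A → X, StronglyMeasurable g → StronglyMeasurable fun a => T a (g a)) :
    ∃ T' : Lp X 2 μ →L[ℂ] Lp X 2 μ, ∀ g : Lp X 2 μ, T' g =ᵐ[μ] fun a => T a (g a) := by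
  have hmem : ∀ g : Lp X 2 μ, MemLp (fun a => T a (g a)) 2 μ := fun g =>
    (Lp.memLp g).of_le_mul (hT g (Lp.stronglyMeasurable g)).aestronglyMeasurable
      (Eventually.of_forall fun a => hC a (g a))
  have hcoe : ∀ g, (hmem g).toLp _ =ᵐ[μ] fun a => T a (g a) := fun g => (hmem g).coeFn_toLp
  let T₀ : Lp X 2 μ →ₗ[ℂ] Lp X 2 μ :=
    { toFun := fun g => (hmem g).toLp _
      map_add' := fun g h => by
        refine Lp.ext ?_
        filter_upwards [hcoe (g + h), hcoe g, hcoe h, Lp.coeFn_add g h,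
          Lp.coeFn_add ((hmem g).toLp _) ((hmem h).toLp _)] with a h1 h2 h3 h4 h5
        rw [h1, h5, Pi.add_apply, h2, h3, h4, Pi.add_apply, map_add]
      map_smul' := fun c g => by
        refine Lp.ext ?_
        filter_upwards [hcoe (c • g), hcoe g, Lp.coeFn_smul c g,
          Lp.coeFn_smul c ((hmem g).toLp _)] with a h1 h2 h3 h4
        rw [RingHom.id_apply, h1, h4, Pi.smul_apply, h2, h3, Pi.smul_apply, map_smul] }
  refine ⟨T₀.mkContinuous C fun g => ?_, hcoe⟩
  refine Lp.norm_le_mul_norm_of_ae_le_mul ?_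
  filter_upwards [hcoe g] with a ha
  change ‖((hmem g).toLp _ : Lp X 2 μ) a‖ ≤ _
  rw [ha]
  exact hC a _

theorem ofReal_norm_sq_eq_lintegral (g : Lp X 2 μ) :
    ENNReal.ofReal (‖g‖ ^ 2) = ∫⁻ a, ENNReal.ofReal (‖g a‖ ^ 2) ∂μ := by
  have h1 : ((‖g‖ ^ 2 : ℝ) : ℂ) = ((∫ a, ‖g a‖ ^ 2 ∂μ : ℝ) : ℂ) := by
    have h := inner_self_eq_norm_sq_to_K (𝕜 := ℂ) g
    rw [L2.inner_def] at h
    rw [← integral_complex_ofReal]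
    simp only [inner_self_eq_norm_sq_to_K] at h
    push_cast
    exact h.symm
  have h2 : ‖g‖ ^ 2 = ∫ a, ‖g a‖ ^ 2 ∂μ := by exact_mod_cast h1
  rw [h2, ofReal_integral_eq_lintegral_ofReal]
  · exact (memLp_two_iff_integrable_sq_norm (Lp.aestronglyMeasurable g)).1 (Lp.memLp g)
  · exact Eventually.of_forall fun a => sq_nonneg _

end Fibre

/-! ### Fibrewise projection-valued measures on `L²(A; X)` and unitary transport. -/

namespace ProjMeasure

variable {A S X : Type*} [MeasurableSpace A] [MeasurableSpace S]
  [NormedAddCommGroup X] [InnerProductSpace ℂ X] [CompleteSpace X] (P : ProjMeasure S X)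

theorem norm_proj_le {B : Set S} (hB : MeasurableSet B) (φ : X) : ‖P.proj B φ‖ ≤ 1 * ‖φ‖ := by
  rw [← P.op_indicator_one hB]
  exact P.norm_op_le (measurable_const.indicator hB) zero_le_one
    (fun x => (norm_indicator_le_norm_self _ _).trans (by simp)) φ

theorem proj_compl {B : Set S} (hB : MeasurableSet B) (φ : X) :
    P.proj Bᶜ φ = φ - P.proj B φ := by
  have hb : BddMeas (B.indicator fun _ => (1 : ℂ)) := (BddMeas.const 1).indicator hB
  have e : (Bᶜ.indicator fun _ => (1 : ℂ)) = fun x => 1 - B.indicator (fun _ => 1) x := by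
    ext x
    by_cases hx : x ∈ B <;> simp [hx]
  rw [← P.op_indicator_one hB.compl, e, P.op_sub (BddMeas.const 1) hb, P.op_const,
    P.op_indicator_one hB, one_smul]
  rfl

/-- A π-λ argument from rectangles, where the section is constant or empty; strong countable
additivity handles disjoint unions. It makes the fibrewise projections well defined on `L²`, and the
family of measures a kernel. -/
theorem stronglyMeasurable_proj_section {B : Set (A × S)} (hB : MeasurableSet B) {g : A → X}
    (hg : StronglyMeasurable g) : StronglyMeasurable fun a => P.proj (Prod.mk a ⁻¹' B) (g a) := by
  induction B, hB using MeasurableSpace.induction_on_inter generateFrom_prod.symm isPiSystem_prod with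
  | empty =>
    have e : (fun a => P.proj (Prod.mk a ⁻¹' (∅ : Set (A × S))) (g a)) = fun _ => 0 := by
      ext a
      rw [preimage_empty, ← P.op_indicator_one .empty, indicator_empty, P.op_const]
      simp
    rw [e]
    exact stronglyMeasurable_const
  | basic t ht =>
    obtain ⟨s, hs, t, ht, rfl⟩ := ht
    have hs : MeasurableSet s := hs
    have e : (fun a => P.proj (Prod.mk a ⁻¹' (s ×ˢ t)) (g a)) =
        s.indicator fun a => P.proj t (g a) := by
      ext a
      by_cases ha : a ∈ s
      · rw [mk_preimage_prod_right ha, indicator_of_mem ha]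
      · rw [mk_preimage_prod_right_eq_empty ha, indicator_of_notMem ha,
          ← P.op_indicator_one .empty, indicator_empty, P.op_const]
        simp
    rw [e]
    exact ((P.proj t).continuous.comp_stronglyMeasurable hg).indicator hs
  | compl t ht ih =>
    have e : (fun a => P.proj (Prod.mk a ⁻¹' tᶜ) (g a)) =
        fun a => g a - P.proj (Prod.mk a ⁻¹' t) (g a) := by
      ext a
      rw [preimage_compl, P.proj_compl (measurable_prodMk_left ht)]
    rw [e]
    exact hg.sub ih
  | iUnion f hd hf ih =>
    refine stronglyMeasurable_of_tendsto (u := atTop)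
      (f := fun F : Finset ℕ => fun a => ∑ n ∈ F, P.proj (Prod.mk a ⁻¹' f n) (g a))
      (fun F => Finset.stronglyMeasurable_fun_sum F fun n _ => ih n) ?_
    refine tendsto_pi_nhds.2 fun a => ?_
    rw [preimage_iUnion]
    exact P.hasSum_proj (fun n => measurable_prodMk_left (hf n))
      (fun i j hij => (hd hij).preimage _) (g a)

/-- The measures `δ_a ⊗ μ_{u(a)}` on `A × S`. -/
def fibreKernel {u : A → X} (hu : StronglyMeasurable u) : ProbabilityTheory.Kernel A (A × S) where
  toFun a := (P.measure (u a)).map (Prod.mk a)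
  measurable' := by
    refine Measure.measurable_of_measurable_coe _ fun B hB => ?_
    have e : (fun a => (P.measure (u a)).map (Prod.mk a) B) =
        fun a => ENNReal.ofReal (‖P.proj (Prod.mk a ⁻¹' B) (u a)‖ ^ 2) := by
      ext a
      rw [Measure.map_apply measurable_prodMk_left hB,
        P.measure_apply _ (measurable_prodMk_left hB)]
    rw [e]
    exact ((P.stronglyMeasurable_proj_section hB hu).norm.measurable.pow_const 2).ennreal_ofReal

variable (μ : Measure A)

theorem exists_fibre_proj {B : Set (A × S)} (hB : MeasurableSet B) :
    ∃ T : Lp X 2 μ →L[ℂ] Lp X 2 μ,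
      ∀ g : Lp X 2 μ, T g =ᵐ[μ] fun a => P.proj (Prod.mk a ⁻¹' B) (g a) :=
  exists_clm_of_fibre (fun _ φ => P.norm_proj_le (measurable_prodMk_left hB) φ)
    fun _ hg => P.stronglyMeasurable_proj_section hB hg

open Classical in
/-- The fibrewise action of the projections of the sections of a set. -/
def fibreProj (B : Set (A × S)) : Lp X 2 μ →L[ℂ] Lp X 2 μ :=
  if hB : MeasurableSet B then (P.exists_fibre_proj μ hB).choose else 0

theorem coeFn_fibreProj {B : Set (A × S)} (hB : MeasurableSet B) (g : Lp X 2 μ) :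
    P.fibreProj μ B g =ᵐ[μ] fun a => P.proj (Prod.mk a ⁻¹' B) (g a) := by
  rw [fibreProj, dif_pos hB]
  exact (P.exists_fibre_proj μ hB).choose_spec g

/-- The scalar measures of the fibrewise projection-valued measure. -/
def fibreMeasure (u : Lp X 2 μ) : Measure (A × S) :=
  μ.bind (P.fibreKernel (Lp.stronglyMeasurable u))

theorem lintegral_fibreMeasure (u : Lp X 2 μ) {f : A × S → ℝ≥0∞} (hf : Measurable f) :
    ∫⁻ p, f p ∂P.fibreMeasure μ u = ∫⁻ a, ∫⁻ x, f (a, x) ∂P.measure (u a) ∂μ := by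
  rw [fibreMeasure, Measure.lintegral_bind (ProbabilityTheory.Kernel.aemeasurable _) hf.aemeasurable]
  refine lintegral_congr fun a => ?_
  exact lintegral_map hf measurable_prodMk_left

/-- The projection-valued measure on `L²(A; X)` acting fibrewise. -/
def fibre : ProjMeasure (A × S) (Lp X 2 μ) where
  proj := P.fibreProj μ
  measure := P.fibreMeasure μ
  isProj B hB := by
    refine ⟨?_, ?_⟩
    · ext g : 1
      refine Lp.ext ?_
      change P.fibreProj μ B (P.fibreProj μ B g) =ᵐ[μ] _
      filter_upwards [P.coeFn_fibreProj μ hB (P.fibreProj μ B g), P.coeFn_fibreProj μ hB g]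
        with a h1 h2
      rw [h1, h2, P.proj_proj (measurable_prodMk_left hB)]
    · rw [ContinuousLinearMap.isSelfAdjoint_iff_isSymmetric]
      intro g h
      change inner ℂ (P.fibreProj μ B g) h = inner ℂ g (P.fibreProj μ B h)
      rw [L2.inner_def, L2.inner_def]
      refine integral_congr_ae ?_
      filter_upwards [P.coeFn_fibreProj μ hB g, P.coeFn_fibreProj μ hB h] with a h1 h2
      rw [h1, h2, ← ContinuousLinearMap.adjoint_inner_right,
        P.adjoint_proj (measurable_prodMk_left hB)]
  proj_univ := by
    ext g : 1
    refine Lp.ext ?_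
    filter_upwards [P.coeFn_fibreProj μ .univ g] with a h1
    rw [h1, preimage_univ, P.proj_univ]
    rfl
  proj_inter B C hB hC := by
    ext g : 1
    refine Lp.ext ?_
    change _ =ᵐ[μ] P.fibreProj μ B (P.fibreProj μ C g)
    filter_upwards [P.coeFn_fibreProj μ (hB.inter hC) g,
      P.coeFn_fibreProj μ hB (P.fibreProj μ C g), P.coeFn_fibreProj μ hC g] with a h1 h2 h3
    rw [h1, h2, h3, preimage_inter, P.proj_inter _ _ (measurable_prodMk_left hB)
      (measurable_prodMk_left hC)]
    rfl
  measure_apply B hB u := by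
    rw [ofReal_norm_sq_eq_lintegral, fibreMeasure, Measure.bind_apply hB
      (ProbabilityTheory.Kernel.aemeasurable _)]
    refine lintegral_congr_ae ?_
    filter_upwards [P.coeFn_fibreProj μ hB u] with a h1
    change (P.measure (u a)).map (Prod.mk a) B = _
    rw [h1, Measure.map_apply measurable_prodMk_left hB,
      P.measure_apply _ (measurable_prodMk_left hB)]

theorem integral_fibreMeasure {u : Lp X 2 μ} {f : A × S → ℂ} (hf : Measurable f)
    (h : Integrable f (P.fibreMeasure μ u)) :
    Integrable (fun a => ∫ x, f (a, x) ∂P.measure (u a)) μ ∧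
      ∫ p, f p ∂P.fibreMeasure μ u = ∫ a, ∫ x, f (a, x) ∂P.measure (u a) ∂μ := by
  have e : ∀ a, ∫ p, f p ∂P.fibreKernel (Lp.stronglyMeasurable u) a =
      ∫ x, f (a, x) ∂P.measure (u a) := fun a =>
    integral_map measurable_prodMk_left.aemeasurable hf.aestronglyMeasurable
  have h' := h
  rw [fibreMeasure, Measure.comp_eq_comp_const_apply] at h'
  constructor
  · simpa only [e, ProbabilityTheory.Kernel.const_apply] using h'.integral_comp
  · rw [fibreMeasure, Measure.comp_eq_comp_const_apply,
      ProbabilityTheory.Kernel.integral_comp h']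
    simp only [e, ProbabilityTheory.Kernel.const_apply]

theorem pairing_fibre {u v : Lp X 2 μ} {f : A × S → ℂ} (hf : Measurable f)
    (h : ∀ w ∈ polSet u v, Integrable f (P.fibreMeasure μ w)) :
    pairing (P.fibre μ).measure f u v =
      ∫ a, pairing P.measure (fun x => f (a, x)) (u a) (v a) ∂μ := by
  have h1 := P.integral_fibreMeasure μ hf (h _ (add_mem_polSet u v))
  have h2 := P.integral_fibreMeasure μ hf (h _ (sub_mem_polSet u v))
  have h3 := P.integral_fibreMeasure μ hf (h _ (add_I_mem_polSet u v))
  have h4 := P.integral_fibreMeasure μ hf (h _ (sub_I_mem_polSet u v))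
  -- Representatives of sums in `L²` agree with sums of representatives only almost everywhere, so
  -- the fibrewise polarization identity holds for almost every `a`.
  have e : (fun a => pairing P.measure (fun x => f (a, x)) (u a) (v a)) =ᵐ[μ] fun a =>
      (1 / 4) * ((∫ x, f (a, x) ∂P.measure ((u + v : Lp X 2 μ) a)) -
        (∫ x, f (a, x) ∂P.measure ((u - v : Lp X 2 μ) a)) +
        Complex.I * (∫ x, f (a, x) ∂P.measure ((u + Complex.I • v : Lp X 2 μ) a)) -
        Complex.I * (∫ x, f (a, x) ∂P.measure ((u - Complex.I • v : Lp X 2 μ) a))) := by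
    filter_upwards [Lp.coeFn_add u v, Lp.coeFn_sub u v, Lp.coeFn_add u (Complex.I • v),
      Lp.coeFn_sub u (Complex.I • v), Lp.coeFn_smul Complex.I v] with a e1 e2 e3 e4 e5
    rw [e1, e2, e3, e4, Pi.add_apply, Pi.sub_apply, Pi.add_apply, Pi.sub_apply, e5, Pi.smul_apply]
    rfl
  have i12 := h1.1.sub' h2.1
  have i3 := h3.1.const_mul Complex.I
  have i123 := i12.add i3
  simp only [Pi.add_def] at i123
  rw [integral_congr_ae e, integral_const_mul, integral_sub i123 (h4.1.const_mul _),
    integral_add i12 i3, integral_sub h1.1 h2.1, integral_const_mul, integral_const_mul,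
    ← h1.2, ← h2.2, ← h3.2, ← h4.2]
  rfl

/-- Transport of a projection-valued measure along a unitary map. -/
def congr {Y : Type*} [NormedAddCommGroup Y] [InnerProductSpace ℂ Y] [CompleteSpace Y]
    (U : Y ≃ₗᵢ[ℂ] X) : ProjMeasure S Y where
  proj B := (U.symm.toContinuousLinearEquiv : X →L[ℂ] Y) ∘L P.proj B ∘L
    (U.toContinuousLinearEquiv : Y →L[ℂ] X)
  measure φ := P.measure (U φ)
  isProj B hB := by
    refine ⟨?_, ?_⟩
    · ext φ
      change U.symm (P.proj B (U (U.symm (P.proj B (U φ))))) = U.symm (P.proj B (U φ))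
      rw [U.apply_symm_apply, P.proj_proj hB]
    · rw [ContinuousLinearMap.isSelfAdjoint_iff_isSymmetric]
      intro φ ψ
      change inner ℂ (U.symm (P.proj B (U φ))) ψ = inner ℂ φ (U.symm (P.proj B (U ψ)))
      rw [← U.inner_map_map, U.apply_symm_apply, ← U.inner_map_map φ, U.apply_symm_apply,
        ← ContinuousLinearMap.adjoint_inner_right, P.adjoint_proj hB]
  proj_univ := by
    ext φ
    rw [P.proj_univ]
    exact U.symm_apply_apply φ
  proj_inter B C hB hC := by
    ext φ
    change U.symm (P.proj (B ∩ C) (U φ)) =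
      U.symm (P.proj B (U (U.symm (P.proj C (U φ)))))
    rw [U.apply_symm_apply, P.proj_inter B C hB hC]
    rfl
  measure_apply B hB φ := by
    rw [P.measure_apply B hB]
    change _ = ENNReal.ofReal (‖U.symm (P.proj B (U φ))‖ ^ 2)
    rw [U.symm.norm_map]

theorem pairing_congr {Y : Type*} [NormedAddCommGroup Y] [InnerProductSpace ℂ Y] [CompleteSpace Y]
    (U : Y ≃ₗᵢ[ℂ] X) (f : S → ℂ) (φ ψ : Y) :
    pairing (P.congr U).measure f φ ψ = pairing P.measure f (U φ) (U ψ) := by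
  simp only [pairing, congr, map_add, map_sub, map_smul]

end ProjMeasure

/-! ### Fourier transform, translations and fibrewise operators -/

section Fourier

variable {X : Type*} [NormedAddCommGroup X] [InnerProductSpace ℂ X] [CompleteSpace X]

theorem continuous_fourier_timeL2 : Continuous fun u : TimeL2 X => (𝓕 u : TimeL2 X) :=
  (Lp.fourierTransformₗᵢ ℝ X).continuous

theorem denseRange_schwartz_toLp :
    DenseRange fun f : SchwartzMap ℝ X => (f.toLp 2 : TimeL2 X) :=
  SchwartzMap.denseRange_toLpCLM ENNReal.ofNat_ne_top

/-- On Schwartz functions a bounded operator passes under the Fourier integral; both sides are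
continuous and these functions are dense. -/
theorem fourier_compLpL (T : X →L[ℂ] X) (u : TimeL2 X) :
    (𝓕 (T.compLpL 2 volume u : TimeL2 X) : TimeL2 X) = T.compLpL 2 volume (𝓕 u : TimeL2 X) := by
  refine congrFun (DenseRange.equalizer denseRange_schwartz_toLp
    (g := fun u : TimeL2 X => (𝓕 (T.compLpL 2 volume u : TimeL2 X) : TimeL2 X))
    (h := fun u : TimeL2 X => T.compLpL 2 volume (𝓕 u : TimeL2 X))
    (continuous_fourier_timeL2.comp (T.compLpL 2 volume).continuous)
    ((T.compLpL 2 volume).continuous.comp continuous_fourier_timeL2) (funext fun f => ?_)) u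
  have h : ∀ f : SchwartzMap ℝ X, (T.compLpL 2 volume (f.toLp 2 : TimeL2 X) : TimeL2 X) =
      (f.postcompCLM T).toLp 2 := by
    intro f
    refine Lp.ext ?_
    filter_upwards [T.coeFn_compLpL (f.toLp 2 : TimeL2 X), f.coeFn_toLp 2 volume,
      (f.postcompCLM T).coeFn_toLp 2 volume] with t h1 h2 h3
    rw [h1, h2, h3, SchwartzMap.postcompCLM_apply]
  simp only [Function.comp_def]
  rw [h, SchwartzMap.toLp_fourier_eq, SchwartzMap.toLp_fourier_eq, h]
  congr 1
  ext ξ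
  rw [SchwartzMap.postcompCLM_apply, SchwartzMap.fourier_coe, SchwartzMap.fourier_coe,
    Real.fourier_real_eq_integral_exp_smul, Real.fourier_real_eq_integral_exp_smul,
    ← ContinuousLinearMap.integral_comp_comm]
  · simp only [map_smul, SchwartzMap.postcompCLM_apply]
  · have := (Real.fourierIntegral_convergent_iff (μ := volume) (f := f) ξ).2 f.integrable
    refine this.congr (Eventually.of_forall fun v => ?_)
    simp only [Circle.smul_def, Real.fourierChar_apply]
    congr 3
    simp
    ring

theorem fourier_translate (τ : ℝ) (u : TimeL2 X) :
    (𝓕 (translate X τ u) : TimeL2 X) =ᵐ[volume] fun ξ =>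
      Complex.exp (-(τ * (Complex.I * ((2 * Real.pi * ξ : ℝ) : ℂ)))) • (𝓕 u : TimeL2 X) ξ := by
  set e : ℝ → ℂ := fun ξ => Complex.exp (-(τ * (Complex.I * ((2 * Real.pi * ξ : ℝ) : ℂ)))) with he
  have hem : Measurable e := by fun_prop
  have hen : ∀ ξ, ‖e ξ‖ = 1 := fun ξ => by
    rw [he, Complex.norm_exp]
    simp
  -- Multiplication by the phase is realised as a bounded operator on `L²`, so that two continuous
  -- maps can be compared on Schwartz functions.
  obtain ⟨M, hM⟩ := exists_clm_of_fibre (μ := (volume : Measure ℝ))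
    (T := fun ξ => e ξ • (1 : X →L[ℂ] X)) (C := 1)
    (fun ξ x => by rw [smul_apply, norm_smul, hen]; rfl)
    (fun g hg => hem.stronglyMeasurable.smul hg)
  have key : (𝓕 (translate X τ u) : TimeL2 X) = M (𝓕 u : TimeL2 X) := by
    refine congrFun (DenseRange.equalizer denseRange_schwartz_toLp
      (g := fun u : TimeL2 X => (𝓕 (translate X τ u) : TimeL2 X))
      (h := fun u : TimeL2 X => M (𝓕 u : TimeL2 X))
      (continuous_fourier_timeL2.comp (translate X τ).continuous)
      (M.continuous.comp continuous_fourier_timeL2) (funext fun f => ?_)) u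
    have h : translate X τ (f.toLp 2 : TimeL2 X) = (f.compSubConstCLM ℂ τ).toLp 2 := rfl
    simp only [Function.comp_def]
    rw [h, SchwartzMap.toLp_fourier_eq, SchwartzMap.toLp_fourier_eq]
    refine Lp.ext ?_
    filter_upwards [hM ((𝓕 f).toLp 2 : TimeL2 X), (𝓕 f).coeFn_toLp 2 volume,
      (𝓕 (f.compSubConstCLM ℂ τ)).coeFn_toLp 2 volume] with ξ h1 h2 h3
    rw [h1, h2, h3, smul_apply, one_apply_eq_self, SchwartzMap.fourier_coe, SchwartzMap.fourier_coe,
      Real.fourier_real_eq_integral_exp_smul, Real.fourier_real_eq_integral_exp_smul,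
      ← integral_smul, ← integral_add_right_eq_self _ τ]
    refine integral_congr_ae (Eventually.of_forall fun v => ?_)
    simp only [SchwartzMap.compSubConstCLM_apply, add_sub_cancel_right]
    rw [smul_smul, he, ← Complex.exp_add]
    congr 2
    push_cast
    ring
  rw [key]
  filter_upwards [hM (𝓕 u : TimeL2 X)] with ξ h1
  rw [h1]
  rfl

end Fourier

/-! ### The projection-valued measure of the parabolic operator -/

section Joint

variable {X : Type*} [NormedAddCommGroup X] [InnerProductSpace ℂ X] [CompleteSpace X]

/-- The joint spectral measure of `(∂ₜ, L)`, `E` being the spectral resolution of `L`. -/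
def timeProj (E : ResolutionOfIdentity X) : ProjMeasure (ℝ × ℝ) (TimeL2 X) :=
  (E.toProjMeasure.fibre volume).congr (Lp.fourierTransformₗᵢ ℝ X)

/-- The symbol of `∂ₜ + L`, extended to negative `l` so as to have nonnegative real part. -/
def posSymbol (p : ℝ × ℝ) : ℂ := symbol p.1 (max p.2 0)

theorem measurable_posSymbol : Measurable posSymbol := by
  unfold posSymbol symbol; fun_prop

theorem posSymbol_re (p : ℝ × ℝ) : (posSymbol p).re = max p.2 0 := by
  simp [posSymbol, symbol]

theorem posSymbol_im (p : ℝ × ℝ) : (posSymbol p).im = 2 * Real.pi * p.1 := by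
  simp [posSymbol, symbol]

theorem posSymbol_re_nonneg (p : ℝ × ℝ) : 0 ≤ (posSymbol p).re := by
  rw [posSymbol_re]; exact le_max_right _ _

theorem timeProj_measure (E : ResolutionOfIdentity X) (u : TimeL2 X) :
    (timeProj E).measure u = E.toProjMeasure.fibreMeasure volume (𝓕 u : TimeL2 X) := rfl

theorem timeProj_measure_eq_zero (E : ResolutionOfIdentity X) (u : TimeL2 X) {B : Set (ℝ × ℝ)}
    (hB : MeasurableSet B)
    (h : ∀ᵐ ξ : ℝ, E.measure ((𝓕 u : TimeL2 X) ξ) (Prod.mk ξ ⁻¹' B) = 0) :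
    (timeProj E).measure u B = 0 := by
  rw [timeProj_measure, ← lintegral_indicator_one hB, E.toProjMeasure.lintegral_fibreMeasure
    volume _ (measurable_one.indicator hB)]
  rw [lintegral_eq_zero_of_ae_eq_zero]
  filter_upwards [h] with ξ hξ
  have : (fun l => B.indicator (1 : ℝ × ℝ → ℝ≥0∞) (ξ, l)) =
    (Prod.mk ξ ⁻¹' B).indicator 1 := rfl
  rw [this, lintegral_indicator_one (measurable_prodMk_left hB)]
  exact hξ

/-- The imaginary part is `2πξ`, so the symbol can vanish only at the single frequency `ξ = 0`. This
holds even when `L` has a kernel. -/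
theorem ae_posSymbol_ne_zero (E : ResolutionOfIdentity X) (u : TimeL2 X) :
    ∀ᵐ p ∂(timeProj E).measure u, posSymbol p ≠ 0 := by
  rw [ae_iff]
  simp only [not_not]
  refine timeProj_measure_eq_zero E u (measurable_posSymbol (measurableSet_singleton 0)) ?_
  have h0 : ∀ᵐ ξ : ℝ, ξ ≠ 0 := by simp [ae_iff]
  filter_upwards [h0] with ξ hξ
  have : Prod.mk ξ ⁻¹' {p | posSymbol p = 0} = ∅ := by
    refine eq_empty_of_forall_notMem fun l hl => hξ ?_
    have hl : posSymbol (ξ, l) = 0 := hl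
    have := posSymbol_im (ξ, l)
    rw [hl] at this
    simpa [Real.pi_ne_zero] using this.symm
  rw [this, measure_empty]

theorem ae_le_posSymbol_re (E : ResolutionOfIdentity X) (u : TimeL2 X) {c : ℝ}
    (h : ∀ᵐ ξ : ℝ, E.measure ((𝓕 u : TimeL2 X) ξ) (Iio c) = 0) :
    ∀ᵐ p ∂(timeProj E).measure u, c ≤ (posSymbol p).re := by
  rw [ae_iff]
  refine timeProj_measure_eq_zero E u ?_ ?_
  · exact (measurableSet_le measurable_const
      (Complex.measurable_re.comp measurable_posSymbol)).compl
  filter_upwards [h] with ξ hξ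
  refine measure_mono_null (fun l hl => ?_) hξ
  have hl : ¬ c ≤ (posSymbol (ξ, l)).re := hl
  rw [posSymbol_re, not_le] at hl
  exact (le_max_left _ _).trans_lt hl

variable {L : X →ₗ.[ℂ] X}

theorem ae_posSymbol_eq (hs : ∀ φ, (spectralResolution L).measure φ (Iio 0) = 0) (ξ : ℝ) (φ : X) :
    ∀ᵐ l ∂(spectralResolution L).measure φ, posSymbol (ξ, l) = symbol ξ l := by
  have : ∀ᵐ l ∂(spectralResolution L).measure φ, ¬ l < 0 := by
    rw [ae_iff]
    simp only [not_not]
    exact hs φ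
  filter_upwards [this] with l hl
  rw [posSymbol, max_eq_left (not_lt.1 hl)]

theorem hsEnergy_eq (hs : ∀ φ, (spectralResolution L).measure φ (Iio 0) = 0) (σ : ℝ)
    (u : TimeL2 X) : hsEnergy L σ u = (timeProj (spectralResolution L)).energy posSymbol σ u := by
  rw [ProjMeasure.energy, timeProj_measure, ProjMeasure.lintegral_fibreMeasure _ _ _
    (measurable_posSymbol.norm.pow_const σ).ennreal_ofReal]
  refine lintegral_congr fun ξ => lintegral_congr_ae ?_
  filter_upwards [ae_posSymbol_eq hs ξ ((𝓕 u : TimeL2 X) ξ)] with l hl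
  rw [hl]

theorem hsForm_eq (hs : ∀ φ, (spectralResolution L).measure φ (Iio 0) = 0) {σ : ℝ}
    {u v : TimeL2 X} (hu : hsEnergy L σ u < ⊤) (hv : hsEnergy L σ v < ⊤) :
    hsForm L σ u v = pairing (timeProj (spectralResolution L)).measure
      (fun p => posSymbol p ^ (σ : ℂ)) u v := by
  have hm : Measurable fun p => posSymbol p ^ (σ : ℂ) := measurable_posSymbol.pow_const _
  rw [hsEnergy_eq hs] at hu hv
  have hi := (timeProj (spectralResolution L)).integrable_of_mem_polSet
    ((timeProj (spectralResolution L)).integrable_of_norm_le measurable_posSymbol hu hm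
      (ProjMeasure.norm_cpow_ofReal_le σ))
    ((timeProj (spectralResolution L)).integrable_of_norm_le measurable_posSymbol hv hm
      (ProjMeasure.norm_cpow_ofReal_le σ))
  have hi' : ∀ w ∈ polSet (𝓕 u : TimeL2 X) (𝓕 v : TimeL2 X), Integrable
      (fun p => posSymbol p ^ (σ : ℂ))
      ((spectralResolution L).toProjMeasure.fibreMeasure volume w) := by
    have h1 := hi _ (add_mem_polSet u v)
    have h2 := hi _ (sub_mem_polSet u v)
    have h3 := hi _ (add_I_mem_polSet u v)
    have h4 := hi _ (sub_I_mem_polSet u v)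
    rw [timeProj_measure] at h1 h2 h3 h4
    rintro w (rfl | rfl | rfl | rfl)
    · convert! h1 using 2
      exact ((Lp.fourierTransformₗᵢ ℝ X).map_add u v).symm
    · convert! h2 using 2
      exact ((Lp.fourierTransformₗᵢ ℝ X).map_sub u v).symm
    · convert! h3 using 2
      exact (((Lp.fourierTransformₗᵢ ℝ X).map_add u _).trans
        (congrArg _ ((Lp.fourierTransformₗᵢ ℝ X).map_smul _ v))).symm
    · convert! h4 using 2
      exact (((Lp.fourierTransformₗᵢ ℝ X).map_sub u _).trans
        (congrArg _ ((Lp.fourierTransformₗᵢ ℝ X).map_smul _ v))).symm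
  rw [timeProj, ProjMeasure.pairing_congr]
  refine Eq.trans ?_ (ProjMeasure.pairing_fibre _ volume hm hi').symm
  refine integral_congr_ae (Eventually.of_forall fun ξ => ?_)
  refine pairing_congr_ae fun w _ => ?_
  filter_upwards [ae_posSymbol_eq hs ξ w] with l hl
  rw [hl]

/-- The function `e^{-τl}` is unbounded for `l < 0`, but negative `l` are null, so `max l 0` may
replace `l`. The resulting bounded symbol shows that the operator chosen in
`ResolutionOfIdentity.integral` is not the default one. -/
theorem semigroup_isOp (hs : ∀ φ, (spectralResolution L).measure φ (Iio 0) = 0) {τ : ℝ}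
    (hτ : 0 ≤ τ) : IsOp (spectralResolution L).measure
      (fun l => Complex.exp (-(τ * ((max l 0 : ℝ) : ℂ)))) (semigroup L τ) := by
  set E := spectralResolution L with hE
  have hb : BddMeas fun l : ℝ => Complex.exp (-(τ * ((max l 0 : ℝ) : ℂ))) :=
    ProjMeasure.bddMeas_exp (z := fun l : ℝ => ((max l 0 : ℝ) : ℂ)) (by fun_prop)
      (fun l => by rw [Complex.ofReal_re]; exact le_max_right _ _) hτ
  have hp : ∀ φ ψ, E.pairing (fun l => Complex.exp (-(τ * l))) φ ψ =
      pairing E.measure (fun l => Complex.exp (-(τ * ((max l 0 : ℝ) : ℂ)))) φ ψ := by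
    intro φ ψ
    refine pairing_congr_ae fun w _ => ?_
    have : ∀ᵐ l ∂E.measure w, ¬ l < 0 := by
      rw [ae_iff]
      simp only [not_not]
      exact hs w
    filter_upwards [this] with l hl
    rw [max_eq_left (not_lt.1 hl)]
  have hex : ∃ T : X →L[ℂ] X, ∀ φ ψ,
      inner ℂ ψ (T φ) = E.pairing (fun l => Complex.exp (-(τ * l))) φ ψ :=
    ⟨E.toProjMeasure.op _, fun φ ψ => by rw [hp]; exact E.toProjMeasure.inner_op hb φ ψ⟩
  intro φ ψ
  rw [← hp, semigroup, ResolutionOfIdentity.integral, dif_pos hex]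
  exact hex.choose_spec φ ψ

/-- On the Fourier side the translation contributes the phase `e^{-2πiτξ}` and the semigroup of `L`
acts on each fibre; the product of the two symbols is `e^{-τz}`. -/
theorem parabolicSemigroup_eq (hs : ∀ φ, (spectralResolution L).measure φ (Iio 0) = 0) {τ : ℝ}
    (hτ : 0 ≤ τ) :
    parabolicSemigroup L τ = (timeProj (spectralResolution L)).expOp posSymbol τ := by
  symm
  refine ProjMeasure.op_eq_of_isOp _ fun u v => ?_
  have hb := ProjMeasure.bddMeas_exp measurable_posSymbol posSymbol_re_nonneg hτ
  rw [timeProj, ProjMeasure.pairing_congr]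
  refine Eq.trans ?_ (ProjMeasure.pairing_fibre _ volume hb.measurable fun w _ =>
    hb.integrable (((spectralResolution L).toProjMeasure.fibre volume).measure w)).symm
  rw [← (Lp.fourierTransformₗᵢ ℝ X).inner_map_map, L2.inner_def]
  refine integral_congr_ae ?_
  have h1 : (Lp.fourierTransformₗᵢ ℝ X (parabolicSemigroup L τ u) : TimeL2 X) =
      (semigroup L τ).compLpL 2 volume (𝓕 (translate X τ u) : TimeL2 X) :=
    fourier_compLpL _ _
  rw [h1]
  filter_upwards [(semigroup L τ).coeFn_compLpL (𝓕 (translate X τ u) : TimeL2 X),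
    fourier_translate τ u] with ξ h2 h3
  rw [h2, h3, map_smul, inner_smul_right, semigroup_isOp hs hτ, ← pairing_const_mul]
  refine congrArg (fun f => pairing _ f _ _) (funext fun l => ?_)
  rw [← Complex.exp_add, posSymbol, symbol]
  congr 1
  ring

end Joint

/-! ### The extension in terms of the joint spectral measure -/

section Extension

variable {X : Type*} [NormedAddCommGroup X] [InnerProductSpace ℂ X] [CompleteSpace X]

variable {L : X →ₗ.[ℂ] X} {s : ℝ}

theorem spectralResolution_resolves (hL : IsNormalOp L) (hn : IsNonneg L) :
    (spectralResolution L).Resolves L := by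
  have h := hL.exists_resolves hn
  rw [spectralResolution, dif_pos h]
  exact h.choose_spec

theorem extension_eq (hs : ∀ φ, (spectralResolution L).measure φ (Iio 0) = 0) (hs0 : 0 < s)
    (u : TimeL2 X) {y : ℝ} (hy : 0 ≤ y) :
    extension L s u y = (timeProj (spectralResolution L)).ext u posSymbol s y := by
  rcases hy.eq_or_lt with rfl | hy
  · rw [ProjMeasure.ext_zero _ hs0, extension, if_pos rfl]
  · have h := ((timeProj (spectralResolution L)).integral_weight_expOp measurable_posSymbol
      posSymbol_re_nonneg hs0 hy u).2
    have h' : ∫ τ in Ioi (0 : ℝ), (Real.exp (-y ^ 2 / (4 * τ)) / τ ^ (1 + s)) •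
        parabolicSemigroup L τ u =
          ((y ^ 2 / 4) ^ s)⁻¹ • (timeProj (spectralResolution L)).besselOp posSymbol s y u :=
      (setIntegral_congr_fun measurableSet_Ioi fun τ hτ => by
        rw [parabolicSemigroup_eq hs (le_of_lt hτ)]; rfl).trans h
    rw [extension, if_neg hy.ne', h', smul_smul, ProjMeasure.sq_div_four_rpow hy]
    change _ = (1 / Real.Gamma s) • (timeProj (spectralResolution L)).besselOp posSymbol s y u
    congr 1
    have h1 : y ^ (2 * s) ≠ 0 := (Real.rpow_pos_of_pos hy _).ne'
    have h2 : (4 : ℝ) ^ s ≠ 0 := (Real.rpow_pos_of_pos (by norm_num) _).ne'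
    have h3 := (Real.Gamma_pos_of_pos hs0).ne'
    field_simp

theorem semigroupHsForm_eq (hs : ∀ φ, (spectralResolution L).measure φ (Iio 0) = 0)
    {u v : TimeL2 X} (hu : hsEnergy L s u < ⊤) (hv : hsEnergy L s v < ⊤) {r : ℝ} (hr : 0 ≤ r) :
    semigroupHsForm L s r u v = pairing (timeProj (spectralResolution L)).measure
      (fun p => posSymbol p ^ (s : ℂ) * Complex.exp (-(r * posSymbol p))) u v := by
  set P := timeProj (spectralResolution L) with hP
  have hb := ProjMeasure.bddMeas_exp measurable_posSymbol posSymbol_re_nonneg hr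
  -- The adjoint of the semigroup has multiplier of modulus at most one, so it preserves `Dom(H^s)`
  -- and the form may be evaluated there.
  have hv' : hsEnergy L s (ContinuousLinearMap.adjoint (P.expOp posSymbol r) v) < ⊤ := by
    rw [hsEnergy_eq hs] at hv ⊢
    rw [ProjMeasure.expOp, P.adjoint_op hb, P.energy_op measurable_posSymbol hb.conj]
    refine (lintegral_mono fun p => ?_).trans_lt hv
    refine mul_le_of_le_one_left (zero_le) (ENNReal.ofReal_le_one.2 ?_)
    rw [RCLike.norm_conj]
    exact pow_le_one₀ (norm_nonneg _) (norm_exp_neg_mul_le_one (posSymbol_re_nonneg p) hr)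
  rw [semigroupHsForm, parabolicSemigroup_eq hs hr, hsForm_eq hs hu hv']
  rw [hsEnergy_eq hs] at hu hv
  exact P.pairing_adjoint_expOp measurable_posSymbol posSymbol_re_nonneg hu hv hr

theorem lapWeight_sq_div_four (s y r : ℝ) :
    lapWeight s (y ^ 2 / 4) r = Real.exp (-y ^ 2 / (4 * r)) / r ^ (1 - s) := by
  rw [lapWeight, div_div, neg_div]

theorem memWeightedL2DomHs_extension (hs : ∀ φ, (spectralResolution L).measure φ (Iio 0) = 0)
    (hs0 : 0 < s) (hs1 : s < 1) {u : TimeL2 X} (hu : hsEnergy L s u < ⊤) :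
    MemWeightedL2DomHs L 1 (1 - 2 * s) (extension L s u) := by
  set P := timeProj (spectralResolution L) with hP
  have hU : ∀ y, 0 < y → extension L s u y = P.ext u posSymbol s y := fun y hy =>
    extension_eq hs hs0 u hy.le
  have h1 : (1 : ℝ) ∈ Ioi (0 : ℝ) := zero_lt_one' ℝ
  -- The variable `y` is approximated by simple functions with values in `(0, ∞)`, so each
  -- approximant takes values of the extension itself, which lie in `Dom(H)`.
  refine ⟨⟨fun n => (SimpleFunc.approxOn id measurable_id (Ioi (0 : ℝ)) 1 h1 n).map
    (P.ext u posSymbol s), fun n y => ?_, ?_⟩, ?_⟩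
  · have hy : SimpleFunc.approxOn id measurable_id (Ioi (0 : ℝ)) 1 h1 n y ∈ Ioi (0 : ℝ) :=
      SimpleFunc.approxOn_mem measurable_id h1 n y
    rw [SimpleFunc.map_apply, domHs, mem_ofPred_eq, hsEnergy_eq hs]
    exact P.energy_ext_lt_top measurable_posSymbol posSymbol_re_nonneg hs0 hy
  · filter_upwards [ae_restrict_mem measurableSet_Ioi] with y hy
    have ht : Tendsto (fun n => SimpleFunc.approxOn id measurable_id (Ioi (0 : ℝ)) 1 h1 n y)
        atTop (𝓝 y) := SimpleFunc.tendsto_approxOn measurable_id h1 (subset_closure hy)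
    simp only [SimpleFunc.map_apply, hsEnergy_eq hs, hU y hy]
    exact ⟨((P.continuous_ext measurable_posSymbol posSymbol_re_nonneg hs0).tendsto y).comp ht,
      (P.tendsto_energy_ext_sub measurable_posSymbol posSymbol_re_nonneg hs0 hy).comp ht⟩
  · rw [setLIntegral_congr_fun measurableSet_Ioi fun y hy => by rw [hsEnergy_eq hs, hU y hy]]
    rw [hsEnergy_eq hs] at hu
    exact P.lintegral_energy_ext_lt_top measurable_posSymbol posSymbol_re_nonneg hs0 hs1 hu

end Extension

end ParabolicExtension

end

/-! ### The extension theorem. -/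

open ParabolicExtension in
theorem mainTheorem4 (s : ℝ) (hs0 : 0 < s) (hs1 : s < 1) :
    ∃ C : ℝ, ∀ (Ω : Type u) [MeasurableSpace Ω] (η : Measure Ω)
      (L : Lp ℂ 2 η →ₗ.[ℂ] Lp ℂ 2 η), IsNormalOp L → IsNonneg L →
      ∀ u ∈ domHs L s, ∀ U : ℝ → TimeL2 (Lp ℂ 2 η), U = extension L s u →
      -- the three expressions for `U`
      (∀ y > 0,
        (IntegrableOn (fun τ : ℝ => (Real.exp (-y ^ 2 / (4 * τ)) / τ ^ (1 + s)) •
            parabolicSemigroup L τ u) (Ioi 0) ∧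
          U y = (y ^ (2 * s) / (4 ^ s * Real.Gamma s)) •
            ∫ τ in Ioi (0 : ℝ), (Real.exp (-y ^ 2 / (4 * τ)) / τ ^ (1 + s)) •
              parabolicSemigroup L τ u) ∧
        (IntegrableOn (fun r : ℝ => (Real.exp (-r) / r ^ (1 - s)) •
            parabolicSemigroup L (y ^ 2 / (4 * r)) u) (Ioi 0) ∧
          U y = (1 / Real.Gamma s) •
            ∫ r in Ioi (0 : ℝ), (Real.exp (-r) / r ^ (1 - s)) •
              parabolicSemigroup L (y ^ 2 / (4 * r)) u) ∧
        (∀ v ∈ domHs L s,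
          (∀ R > 0, IntegrableOn (fun r : ℝ =>
            ((Real.exp (-y ^ 2 / (4 * r)) / r ^ (1 - s) : ℝ) : ℂ) * semigroupHsForm L s r u v)
            (Ioc 0 R)) ∧
          Tendsto (fun R : ℝ => ((1 / Real.Gamma s : ℝ) : ℂ) *
            ∫ r in Ioc 0 R,
              ((Real.exp (-y ^ 2 / (4 * r)) / r ^ (1 - s) : ℝ) : ℂ) * semigroupHsForm L s r u v)
            atTop (𝓝 (inner ℂ v (U y))) ∧
          -- absolute convergence when the spectral content of `u` stays away from `0`
          ((∃ c > 0, ∀ᵐ ξ : ℝ, (spectralResolution L).measure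
              ((𝓕 u : TimeL2 (Lp ℂ 2 η)) ξ) (Iio c) = 0) →
            IntegrableOn (fun r : ℝ =>
              ((Real.exp (-y ^ 2 / (4 * r)) / r ^ (1 - s) : ℝ) : ℂ) * semigroupHsForm L s r u v)
              (Ioi 0)))) ∧
      -- regularity
      (∀ y > 0, U y ∈ domHs L 1) ∧
      ContDiffOn ℝ ∞ U (Ioi 0) ∧
      ContinuousOn U (Ici 0) ∧
      MemWeightedL2DomHs L 1 (1 - 2 * s) U ∧
      -- the extension equation
      (∀ v ∈ domHs L 1, ∀ y > 0,
        hsForm L 1 (U y) v = inner ℂ v (((1 - 2 * s) / y) • deriv U y + deriv (deriv U) y)) ∧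
      -- the boundary value
      Tendsto U (𝓝[>] 0) (𝓝 u) ∧
      -- weak decay
      (∀ v : TimeL2 (Lp ℂ 2 η), Tendsto (fun y => inner ℂ v (U y)) atTop (𝓝 0)) ∧
      -- bound for the weighted derivative
      (∀ v ∈ domHs L s, ∀ y > 0,
        ‖inner ℂ v (y ^ (1 - 2 * s) • deriv U y)‖ ≤ C * hsNorm L s u * hsNorm L s v) ∧
      -- the weighted normal derivative and the incremental quotient
      (∀ v ∈ domHs L s,
        Tendsto (fun y : ℝ => -(1 / (2 * s) : ℂ) * inner ℂ v (y ^ (1 - 2 * s) • deriv U y))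
          (𝓝[>] 0)
          (𝓝 (((|Real.Gamma (-s)| / (4 ^ s * Real.Gamma s) : ℝ) : ℂ) * hsForm L s u v)) ∧
        Tendsto (fun y : ℝ => -inner ℂ v ((1 / y ^ (2 * s)) • (U y - U 0)))
          (𝓝[>] 0)
          (𝓝 (((|Real.Gamma (-s)| / (4 ^ s * Real.Gamma s) : ℝ) : ℂ) * hsForm L s u v))) := by
  obtain ⟨C, hC0, hC⟩ := exists_norm_derivMult_le hs0 hs1
  -- The prefactor is that of `rpow_smul_deriv_ext`; both it and `C` depend on `s` only and are
  -- fixed before `Ω` and `L`.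
  refine ⟨2 / (4 ^ s * Real.Gamma s) * C, fun Ω _ η L hL hn u hu U hUe => ?_⟩
  have hs : ∀ φ, (spectralResolution L).measure φ (Iio 0) = 0 :=
    (spectralResolution_resolves hL hn).measure_Iio hn
  have hzm := measurable_posSymbol
  have hz := posSymbol_re_nonneg
  set P := timeProj (spectralResolution L) with hP
  have hz0 := ae_posSymbol_ne_zero (spectralResolution L)
  have hen : ∀ {σ : ℝ} {w : TimeL2 (Lp ℂ 2 η)}, w ∈ domHs L σ → P.energy posSymbol σ w < ⊤ :=
    fun {σ w} hw => by rw [← hsEnergy_eq hs]; exact hw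
  have hnorm : ∀ w, hsNorm L s w = Real.sqrt (P.energy posSymbol s w).toReal := fun w => by
    rw [hsNorm, hsEnergy_eq hs]
  have hU : ∀ y, 0 ≤ y → U y = P.ext u posSymbol s y := fun y hy => by
    rw [hUe, extension_eq hs hs0 u hy]
  have hU0 : U 0 = u := by rw [hU 0 le_rfl, P.ext_zero hs0]
  -- The identification with `P.ext` is available for `y ≥ 0` only, so derivatives are compared
  -- through germs at points `y > 0`.
  have hev : ∀ y, 0 < y → U =ᶠ[𝓝 y] P.ext u posSymbol s := fun y hy =>
    (lt_mem_nhds hy).mono fun q hq => hU q (le_of_lt hq)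
  have hd : ∀ y, 0 < y → deriv U y = deriv (P.ext u posSymbol s) y := fun y hy =>
    (hev y hy).deriv_eq
  have hdd : ∀ y, 0 < y → deriv (deriv U) y = deriv (deriv (P.ext u posSymbol s)) y :=
    fun y hy => (hev y hy).deriv.deriv_eq
  have hpos : ∀ᶠ y : ℝ in 𝓝[>] 0, 0 < y := self_mem_nhdsWithin
  refine ⟨fun y hy => ⟨⟨?_, ?_⟩, ⟨?_, ?_⟩, fun v hv => ?_⟩, fun y hy => ?_, ?_, ?_, ?_,
    fun v hv y hy => ?_, ?_, fun v => ?_, fun v hv y hy => ?_, fun v hv => ⟨?_, ?_⟩⟩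
  · refine (P.integral_weight_expOp hzm hz hs0 hy u).1.congr_fun (fun τ hτ => ?_)
      measurableSet_Ioi
    beta_reduce
    rw [parabolicSemigroup_eq hs (le_of_lt hτ)]
    rfl
  · rw [hUe, extension, if_neg hy.ne']
    rfl
  · refine (P.integral_gamma_expOp (y := y) hzm hz hs0 u).1.congr_fun (fun r hr => ?_)
      measurableSet_Ioi
    beta_reduce
    have : 0 ≤ y ^ 2 / (4 * r) := div_nonneg (sq_nonneg y) (mul_nonneg (by norm_num) (le_of_lt hr))
    rw [parabolicSemigroup_eq hs this]
    rfl
  · rw [hU y (le_of_lt hy), ProjMeasure.ext, ← (P.integral_gamma_expOp (y := y) hzm hz hs0 u).2]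
    congr 1
    refine setIntegral_congr_fun measurableSet_Ioi fun r hr => ?_
    have : 0 ≤ y ^ 2 / (4 * r) := div_nonneg (sq_nonneg y) (mul_nonneg (by norm_num) (le_of_lt hr))
    rw [parabolicSemigroup_eq hs this]
    rfl
  · have hw : ∀ r : ℝ, 0 < r → (lapWeight s (y ^ 2 / 4) r : ℂ) * pairing P.measure
          (fun p => posSymbol p ^ (s : ℂ) * Complex.exp (-(r * posSymbol p))) u v =
        ((Real.exp (-y ^ 2 / (4 * r)) / r ^ (1 - s) : ℝ) : ℂ) * semigroupHsForm L s r u v :=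
      fun r hr => by rw [semigroupHsForm_eq hs hu hv hr.le, lapWeight_sq_div_four]
    have hb : 0 ≤ y ^ 2 / 4 := by positivity
    refine ⟨fun R hR => ?_, ?_, fun ⟨c, hc, hgap⟩ => ?_⟩
    · exact (P.integrableOn_weak hzm hz hs0 hb (hen hu) (hen hv) (le_of_lt hR)).congr_fun
        (fun r hr => hw r hr.1) measurableSet_Ioc
    · rw [hU y (le_of_lt hy)]
      refine (P.tendsto_weak hzm hz hs0 hs1 hz0 (hen hu) (hen hv) y).congr fun R => ?_
      rw [setIntegral_congr_fun measurableSet_Ioc fun r hr => hw r hr.1]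
    · exact (P.integrableOn_weak_Ioi hzm hz hs0 hb (hen hu) (hen hv) hc
        (ae_le_posSymbol_re _ u hgap)).congr_fun (fun r hr => hw r hr) measurableSet_Ioi
  · rw [hU y (le_of_lt hy), domHs, mem_ofPred_eq, hsEnergy_eq hs]
    exact P.energy_ext_lt_top hzm hz hs0 hy
  · exact (P.contDiffOn_ext hzm hz hs0).congr fun y hy => hU y (le_of_lt hy)
  · exact (P.continuous_ext hzm hz hs0).continuousOn.congr fun y hy => hU y hy
  · rw [hUe]
    exact memWeightedL2DomHs_extension hs hs0 hs1 hu
  · have h1 : hsEnergy L 1 (P.ext u posSymbol s y) < ⊤ := by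
      rw [hsEnergy_eq hs]
      exact P.energy_ext_lt_top hzm hz hs0 hy
    rw [hd y hy, hdd y hy, hU y (le_of_lt hy), hsForm_eq hs h1 hv]
    refine Eq.trans ?_ (P.pairing_ext hzm hz hs0 hy (hen hv))
    simp only [Complex.ofReal_one, Complex.cpow_one, hP]
  · have h := ((P.continuous_ext (u := u) hzm hz hs0).tendsto 0).mono_left
      (nhdsWithin_le_nhds (s := Ioi 0))
    rw [P.ext_zero hs0] at h
    exact h.congr' (hpos.mono fun y hy => (hU y hy.le).symm)
  · refine (P.tendsto_inner_ext (u := u) (v := v) hzm hz hs0 hz0).congr' ?_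
    filter_upwards [eventually_gt_atTop 0] with y hy
    rw [hU y hy.le]
  · rw [hd y hy, hnorm, hnorm]
    exact P.norm_inner_deriv_ext_le hzm hz hs0 hC0 hC (hen hu) (hen hv) hy
  · rw [hsForm_eq hs hu hv]
    refine (P.tendsto_inner_deriv_ext hzm hz hs0 hs1 (hen hu) (hen hv)).congr' ?_
    filter_upwards [hpos] with y hy
    rw [hd y hy]
    rfl
  · rw [hsForm_eq hs hu hv, hU0]
    refine (P.tendsto_inner_ext_sub hzm hz hs0 hs1 (hen hu) (hen hv)).congr' ?_
    filter_upwards [hpos] with y hy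
    rw [hU y hy.le]
    rfl
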